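/- Let $\mathbf{k}$ be a commutative unitary ring containing $\mathbb{Q}$, let $X=\{x_i\mid i\ge 1\}$ be commuting variables and $t$ a further variable. For a commutative additive semigroup $A$, let $QS(A)$ be the quasi-shuffle Hopf algebra: the free $\mathbf{k}$-module on the words with letters in $A$, with unit the empty word $\emptyset$, the quasi-shuffle product $(x,a)*(y,b)=(x,a*(y,b))+(y,(x,a)*b)+(x+y,a*b)$ (letters $x,y$, words $a,b$), the deconcatenation coproduct and the counit $\alpha\mapsto\delta_{\alpha,\emptyset}$. Words in $\mathbb{N}=\{0,1,2,\dots\}$ are weak compositions; words in $\mathbb{P}=\{1,2,\dots\}$ are compositions. For $\alpha=(\alpha_1,\dots,\alpha_n)\in\mathbb{N}^n$ and $\beta=(\beta_1,\dots,\beta_n)\in\mathbb{P}^n$ let $$\phi\binom{\alpha}{\beta}=\sum_{1\le i_1<\cdots<i_n}x_{i_1}^{\alpha_1}\cdots x_{i_n}^{\alpha_n}\,e^{(i_1+t)\beta_1z}\cdots e^{(i_n+t)\beta_nz}\in\mathbf{k}[[X]][t][z^{-1},z]],$$ where the coefficient of each monomial in $X$, a series which converges for $t\ge0$ and $\operatorname{Re}z<0$,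 is replaced by its Laurent expansion at $z=0$ (whose coefficients are polynomials in $t$ over $\mathbb{Q}$). Let $P$ be the projection of Laurent series in $z$ onto their polar parts. Put $\phi_\pm(\emptyset)=1$ and, for $n\ge1$ and $w=\binom{\alpha}{\beta}=(w_1,\dots,w_n)$, with $w_j=\binom{\alpha_j}{\beta_j}$, put $$\bar\phi(w)=\phi(w)+\sum_{i=1}^{n-1}\phi(w_1,\dots,w_i)\,\phi_-(w_{i+1},\dots,w_n),\qquad \phi_-(w)=-P(\bar\phi(w)),\qquad \phi_+(w)=(\mathrm{id}-P)(\bar\phi(w)).$$ For a weak composition $\alpha$ of length $n$, the renormalized monomial quasisymmetric function is $M_\alpha=\phi_+\binom{\alpha}{\delta^n}\big|_{z=0}\in\mathbf{k}[[X]][t]$, where $\delta^n=(\delta,\dots,\delta)$ with $\delta\in\mathbb{P}$; it does not depend on $\delta$. Let $\mathrm{RenQSym}\subseteq\mathbf{k}[[X]][t]$ be the $\mathbf{k}$-span of all $M_\alpha$, $\alpha$ a weak composition, and let $\mathrm{QSym}\subseteq\mathbf{k}[[X]]$ be the $\mathbf{k}$-span of the monomial quasisymmetric functions $\sum_{i_1<\cdots<i_n}x_{i_1}^{\alpha_1}\cdots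 x_{i_n}^{\alpha_n}$, $\alpha$ a composition. Then $\mathrm{RenQSym}$ and $\mathrm{QSym}$ are subalgebras of $\mathbf{k}[[X]][t]$ and $\mathbf{k}[[X]]$, and sending each word $\alpha$ to the (renormalized) monomial quasisymmetric function of $\alpha$ defines algebra isomorphisms $QS(\mathbb{N})\cong\mathrm{RenQSym}$ and $QS(\mathbb{P})\cong\mathrm{QSym}$. With the Hopf algebra structures transported along these isomorphisms, $\mathrm{RenQSym}$ has $\mathrm{QSym}$ both as a Hopf subalgebra and as a Hopf quotient algebra: the inclusion $\mathrm{QSym}\subseteq\mathrm{RenQSym}$ (constant polynomials in $t$) is a homomorphism of Hopf algebras, and there is a Hopf ideal $I$ of $\mathrm{RenQSym}$ such that $\mathrm{RenQSym}/I\cong\mathrm{QSym}$ as Hopf algebras. -/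

import Mathlib

noncomputable section

open scoped TensorProduct

universe u v

/-- The underlying module `𝐤⟨A⟩ = ⨁ₙ 𝐤 Aⁿ` of the quasi-shuffle algebra `QS(A)`: the free module on
the words with letters in `A`. -/
def QuasiShuffle (k : Type u) (A : Type v) [CommRing k] : Type (max u v) := List A →₀ k

namespace QuasiShuffle

variable {k : Type u} {A : Type v} [CommRing k]

instance : AddCommGroup (QuasiShuffle k A) := inferInstanceAs (AddCommGroup (List A →₀ k))

instance : Module k (QuasiShuffle k A) := inferInstanceAs (Module k (List A →₀ k))

/-- The basis element of `QS(A)` given by a word. -/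
def word (k : Type u) {A : Type v} [CommRing k] (a : List A) : QuasiShuffle k A :=
  Finsupp.single a (1 : k)

/-- The basis of `QS(A)` consisting of all words. -/
def basis (k : Type u) (A : Type v) [CommRing k] : Module.Basis (List A) k (QuasiShuffle k A) :=
  Module.Basis.ofRepr (LinearEquiv.refl k (List A →₀ k))

@[simp] theorem basis_apply (a : List A) : basis k A a = word k a := rfl

theorem hom_ext {M : Type*} [AddCommMonoid M] [Module k M] {f g : QuasiShuffle k A →ₗ[k] M}
    (h : ∀ a, f (word k a) = g (word k a)) : f = g :=
  (basis k A).ext h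

theorem ind {p : QuasiShuffle k A → Prop} (u : QuasiShuffle k A) (zero : p 0)
    (add : ∀ u v, p u → p v → p (u + v)) (smul : ∀ (r : k) a, p (r • word k a)) : p u := by
  refine Finsupp.induction_linear (motive := p) u zero add fun a r => ?_
  have h : r • word k a = (Finsupp.single a r : List A →₀ k) := by
    rw [word]
    exact (Finsupp.smul_single_one a r)
  exact h ▸ smul r a

/-- The linear map that prepends the letter `x` to every word. -/
def cons (x : A) : QuasiShuffle k A →ₗ[k] QuasiShuffle k A :=
  (basis k A).constr k fun a => word k (x :: a)

@[simp] theorem cons_word (x : A) (a : List A) : cons x (word k a) = word k (x :: a) := (basis k A).constr_basis k (fun a => word k (x :: a)) a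

instance : One (QuasiShuffle k A) := ⟨word k []⟩

theorem one_def : (1 : QuasiShuffle k A) = word k [] := rfl

section Product

variable [AddCommSemigroup A]

/-- The quasi-shuffle product of two words. -/
def mulWord (k : Type u) {A : Type v} [CommRing k] [AddCommSemigroup A] :
    List A → List A → QuasiShuffle k A
  | [], b => word k b
  | x :: a, [] => word k (x :: a)
  | x :: a, y :: b =>
      cons x (mulWord k a (y :: b)) + cons y (mulWord k (x :: a) b) + cons (x + y) (mulWord k a b)
  termination_by a b => a.length + b.length

/-- The quasi-shuffle product, as a bilinear map. -/
def mulBilin (k : Type u) (A : Type v) [CommRing k] [AddCommSemigroup A] :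
    QuasiShuffle k A →ₗ[k] QuasiShuffle k A →ₗ[k] QuasiShuffle k A :=
  (basis k A).constr k fun a => (basis k A).constr k fun b => mulWord k a b

theorem mulBilin_word (a b : List A) :
    mulBilin k A (word k a) (word k b) = mulWord k a b := by
  rw [mulBilin, ← basis_apply, ← basis_apply, Module.Basis.constr_basis,
    Module.Basis.constr_basis]

instance : Mul (QuasiShuffle k A) := ⟨fun a b => mulBilin k A a b⟩

theorem mul_def (a b : QuasiShuffle k A) : a * b = mulBilin k A a b := rfl

theorem word_mul_word (a b : List A) : word k a * word k b = mulWord k a b := mulBilin_word a b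

theorem nil_mul (b : QuasiShuffle k A) : word k [] * b = b := by
  have : mulBilin k A (word k []) = LinearMap.id := by
    refine hom_ext fun b => ?_
    rw [mulBilin_word, mulWord, LinearMap.id_apply]
  rw [mul_def, this, LinearMap.id_apply]

theorem mulWord_comm (a b : List A) : mulWord k a b = mulWord k b a := by
  induction a, b using mulWord.induct with
  | case1 b => cases b <;> simp [mulWord]
  | case2 x a => simp [mulWord]
  | case3 x a y b h1 h2 h3 =>
    rw [mulWord, mulWord, h1, h2, h3, add_comm x y]
    abel

theorem mul_comm' (a b : QuasiShuffle k A) : a * b = b * a := by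
  have : mulBilin k A = (mulBilin k A).flip := by
    refine hom_ext fun a => hom_ext fun b => ?_
    rw [LinearMap.flip_apply, mulBilin_word, mulBilin_word, mulWord_comm]
  rw [mul_def, mul_def, this, LinearMap.flip_apply, ← this]

theorem cons_mul_cons' (x y : A) (a b : QuasiShuffle k A) :
    cons x a * cons y b = cons x (a * cons y b) + cons y (cons x a * b) + cons (x + y) (a * b) := by
  have h : (mulBilin k A).compl₁₂ (cons x) (cons y)
      = ((mulBilin k A).compl₂ (cons y)).compr₂ (cons x)
        + ((mulBilin k A).comp (cons x)).compr₂ (cons y)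
        + (mulBilin k A).compr₂ (cons (x + y)) := by
    refine hom_ext fun a => hom_ext fun b => ?_
    simp [mulBilin_word, mulWord]
  simpa [mul_def] using LinearMap.congr_fun (LinearMap.congr_fun h a) b

instance : NonUnitalNonAssocCommRing (QuasiShuffle k A) where
  left_distrib a b c := map_add (mulBilin k A a) b c
  right_distrib a b c := by simp [mul_def]
  zero_mul a := by simp [mul_def]
  mul_zero a := by simp [mul_def]
  mul_comm := mul_comm'

theorem word_assoc (a b c : List A) :
    (word k a * word k b) * word k c = word k a * (word k b * word k c) := by
  induction hn : a.length + b.length + c.length using Nat.strong_induction_on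
    generalizing a b c with
  | _ n ih =>
  subst hn
  rcases a with _ | ⟨x, a⟩
  · simp [nil_mul]
  rcases b with _ | ⟨y, b⟩
  · rw [mul_comm (word k (x :: a)) (word k []), nil_mul, nil_mul]
  rcases c with _ | ⟨z, c⟩
  · rw [mul_comm _ (word k []), mul_comm _ (word k []), nil_mul, nil_mul]
  have e1 := ih _ (by simp +arith) a (y :: b) (z :: c) rfl
  have e2 := ih _ (by simp +arith) (x :: a) b (z :: c) rfl
  have e3 := ih _ (by simp) (x :: a) (y :: b) c rfl
  have e4 := ih _ (by simp +arith) a b (z :: c) rfl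
  have e5 := ih _ (by simp +arith) a (y :: b) c rfl
  have e6 := ih _ (by simp +arith) (x :: a) b c rfl
  have e7 := ih _ (by simp +arith) a b c rfl
  simp only [← cons_word] at e1 e2 e3 e4 e5 e6 e7 ⊢
  rw [cons_mul_cons' y z (word k b) (word k c), mul_add, mul_add] at e1
  rw [cons_mul_cons' x y (word k a) (word k b), add_mul, add_mul] at e3
  rw [cons_mul_cons' x y (word k a) (word k b), cons_mul_cons' y z (word k b) (word k c)]
  have f1 := congrArg (cons x) e1
  have f3 := congrArg (cons z) e3
  simp only [map_add] at f1 f3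
  simp only [add_mul, mul_add, cons_mul_cons']
  rw [e2, e4, e5, e6, e7, add_assoc x y z]
  linear_combination (norm := abel) f1 + f3

instance : CommRing (QuasiShuffle k A) where
  mul_assoc a b c := by
    induction a using ind with
    | zero => simp only [zero_mul]
    | add a a' h h' => simp only [add_mul, h, h']
    | smul r a =>
    simp only [mul_def, map_smul, LinearMap.smul_apply]
    congr 1
    induction b using ind with
    | zero => simp
    | add b b' h h' => simp only [map_add, LinearMap.add_apply, h, h']
    | smul r b =>
    simp only [map_smul, LinearMap.smul_apply]
    congr 1
    induction c using ind with
    | zero => simp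
    | add c c' h h' => simp only [map_add, h, h']
    | smul r c =>
    simp only [map_smul]
    congr 1
    exact word_assoc a b c
  one_mul := nil_mul
  mul_one a := by rw [mul_comm]; exact nil_mul a

instance : Algebra k (QuasiShuffle k A) :=
  Algebra.ofModule (fun r a b => by simp [mul_def]) (fun r a b => by simp [mul_def])

end Product

section Coproduct

/-- The deconcatenation coproduct of a word. -/
def comulWord (k : Type u) {A : Type v} [CommRing k] (a : List A) :
    QuasiShuffle k A ⊗[k] QuasiShuffle k A :=
  ∑ i ∈ Finset.range (a.length + 1), word k (a.take i) ⊗ₜ[k] word k (a.drop i)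

instance : CoalgebraStruct k (QuasiShuffle k A) where
  comul := (basis k A).constr k (comulWord k)
  counit := (basis k A).constr k fun a => if a = [] then 1 else 0

open Coalgebra

theorem comul_word (a : List A) : comul (R := k) (word k a) = comulWord k a :=
  (basis k A).constr_basis k (comulWord k) a

theorem counit_word (a : List A) :
    counit (R := k) (word k a) = if a = [] then (1 : k) else 0 :=
  (basis k A).constr_basis k (fun a => if a = [] then (1 : k) else 0) a

theorem counit_cons (x : A) (u : QuasiShuffle k A) : counit (R := k) (cons x u) = 0 := by
  have : (counit (R := k)).comp (cons x) = (0 : QuasiShuffle k A →ₗ[k] k) :=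
    hom_ext fun a => by simp [counit_word]
  exact LinearMap.congr_fun this u

theorem comul_cons (x : A) (u : QuasiShuffle k A) :
    comul (R := k) (cons x u)
      = word k [] ⊗ₜ[k] cons x u + (cons x).rTensor (QuasiShuffle k A) (comul u) := by
  have : (comul (R := k)).comp (cons x)
      = (TensorProduct.mk k (QuasiShuffle k A) (QuasiShuffle k A) (word k [])).comp (cons x)
        + ((cons x).rTensor (QuasiShuffle k A)).comp comul := by
    refine hom_ext fun a => ?_
    simp only [LinearMap.comp_apply, LinearMap.add_apply, TensorProduct.mk_apply, cons_word,
      comul_word, comulWord, map_sum, LinearMap.rTensor_tmul, List.length_cons]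
    rw [Finset.sum_range_succ']
    simp [add_comm]
  exact LinearMap.congr_fun this u

theorem comul_nil : comul (R := k) (word k ([] : List A)) = word k [] ⊗ₜ[k] word k [] := by
  simp [comul_word, comulWord]

theorem assoc_rTensor_cons (x : A) (s : QuasiShuffle k A ⊗[k] QuasiShuffle k A)
    (q : QuasiShuffle k A) :
    TensorProduct.assoc k _ _ _ ((cons x).rTensor (QuasiShuffle k A) s ⊗ₜ[k] q)
      = (cons x).rTensor _ (TensorProduct.assoc k _ _ _ (s ⊗ₜ[k] q)) := by
  induction s with
  | zero => simp
  | tmul a b => simp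
  | add s t hs ht => simp only [map_add, TensorProduct.add_tmul, hs, ht]

theorem assoc_comul_rTensor_cons (x : A) (t : QuasiShuffle k A ⊗[k] QuasiShuffle k A) :
    TensorProduct.assoc k _ _ _ ((comul (R := k)).rTensor (QuasiShuffle k A)
        ((cons x).rTensor (QuasiShuffle k A) t))
      = word k [] ⊗ₜ[k] (cons x).rTensor (QuasiShuffle k A) t
        + (cons x).rTensor _ (TensorProduct.assoc k _ _ _
            ((comul (R := k)).rTensor (QuasiShuffle k A) t)) := by
  induction t with
  | zero => simp
  | tmul a b =>
    simp only [LinearMap.rTensor_tmul, comul_cons, TensorProduct.add_tmul, map_add,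
      assoc_rTensor_cons, TensorProduct.assoc_tmul]
  | add s t hs ht =>
    simp only [map_add, TensorProduct.tmul_add, hs, ht]
    abel

theorem lTensor_rTensor_cons {M : Type*} [AddCommGroup M] [Module k M]
    (f : QuasiShuffle k A →ₗ[k] M) (x : A) (t : QuasiShuffle k A ⊗[k] QuasiShuffle k A) :
    f.lTensor (QuasiShuffle k A) ((cons x).rTensor (QuasiShuffle k A) t)
      = (cons x).rTensor M (f.lTensor (QuasiShuffle k A) t) := by
  rw [← LinearMap.comp_apply, ← LinearMap.comp_apply, LinearMap.lTensor_comp_rTensor,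
    LinearMap.rTensor_comp_lTensor]

instance : Coalgebra k (QuasiShuffle k A) where
  coassoc := by
    refine hom_ext fun a => ?_
    induction a with
    | nil => simp [comul_nil]
    | cons x a ih =>
      simp only [LinearMap.comp_apply, LinearEquiv.coe_coe] at ih ⊢
      rw [← cons_word, comul_cons, map_add, map_add, map_add, assoc_comul_rTensor_cons, ih,
        LinearMap.rTensor_tmul, comul_nil, LinearMap.lTensor_tmul, comul_cons,
        lTensor_rTensor_cons, TensorProduct.assoc_tmul, TensorProduct.tmul_add]
      abel
  rTensor_counit_comp_comul := by
    refine hom_ext fun a => ?_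
    cases a with
    | nil => simp [comul_nil, counit_word]
    | cons x a =>
      rw [← cons_word]
      have h : (counit (R := k)).comp (cons x) = (0 : QuasiShuffle k A →ₗ[k] k) :=
        LinearMap.ext fun u => counit_cons x u
      simp only [LinearMap.comp_apply, comul_cons, map_add, LinearMap.rTensor_tmul, counit_word,
        TensorProduct.mk_apply, if_true]
      rw [← LinearMap.comp_apply, ← LinearMap.rTensor_comp, h]
      simp
  lTensor_counit_comp_comul := by
    refine hom_ext fun a => ?_
    induction a with
    | nil => simp [comul_nil, counit_word]
    | cons x a ih =>
      simp only [LinearMap.comp_apply] at ih ⊢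
      rw [← cons_word, comul_cons, map_add, lTensor_rTensor_cons, ih, LinearMap.lTensor_tmul,
        counit_cons]
      simp

end Coproduct

section Hopf

variable [AddCommSemigroup A]

open Coalgebra

theorem rTensor_cons_mul (x y : A) (s t : QuasiShuffle k A ⊗[k] QuasiShuffle k A) :
    (cons x).rTensor (QuasiShuffle k A) s * (cons y).rTensor (QuasiShuffle k A) t
      = (cons x).rTensor (QuasiShuffle k A) (s * (cons y).rTensor (QuasiShuffle k A) t)
        + (cons y).rTensor (QuasiShuffle k A) ((cons x).rTensor (QuasiShuffle k A) s * t)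
        + (cons (x + y)).rTensor (QuasiShuffle k A) (s * t) := by
  induction s with
  | zero => simp
  | add s s' h h' =>
    simp only [map_add, add_mul, h, h']
    abel
  | tmul a b =>
  induction t with
  | zero => simp
  | add t t' h h' =>
    simp only [map_add, mul_add, h, h']
    abel
  | tmul c d =>
    simp only [LinearMap.rTensor_tmul, Algebra.TensorProduct.tmul_mul_tmul, cons_mul_cons',
      TensorProduct.add_tmul]

theorem nil_tmul_mul_rTensor (y : A) (u : QuasiShuffle k A)
    (t : QuasiShuffle k A ⊗[k] QuasiShuffle k A) :
    word k [] ⊗ₜ[k] u * (cons y).rTensor (QuasiShuffle k A) t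
      = (cons y).rTensor (QuasiShuffle k A) (word k [] ⊗ₜ[k] u * t) := by
  induction t with
  | zero => simp
  | add t t' h h' => simp only [map_add, mul_add, h, h']
  | tmul c d =>
    simp only [LinearMap.rTensor_tmul, Algebra.TensorProduct.tmul_mul_tmul, nil_mul]

theorem comul_one' : comul (R := k) (word k ([] : List A)) = 1 := by
  rw [comul_nil]; rfl

theorem comul_word_mul (a b : List A) :
    comul (R := k) (word k a * word k b) = comul (R := k) (word k a) * comul (R := k) (word k b) := by
  induction a, b using mulWord.induct with
  | case1 b => rw [nil_mul, comul_one', one_mul]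
  | case2 x a => rw [mul_comm, nil_mul, comul_one', mul_one]
  | case3 x a y b h1 h2 h3 =>
    rw [← cons_word, ← cons_word] at *
    rw [cons_mul_cons', map_add, map_add, comul_cons, comul_cons, comul_cons, h1, h2, h3,
      comul_cons, comul_cons]
    have hc : ∀ s : QuasiShuffle k A ⊗[k] QuasiShuffle k A,
        (cons x).rTensor (QuasiShuffle k A) s * word k [] ⊗ₜ[k] cons y (word k b)
          = (cons x).rTensor (QuasiShuffle k A) (s * word k [] ⊗ₜ[k] cons y (word k b)) := by
      intro s
      rw [mul_comm, nil_tmul_mul_rTensor, mul_comm]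
    simp only [map_add, mul_add, add_mul, TensorProduct.tmul_add, rTensor_cons_mul,
      nil_tmul_mul_rTensor, hc, Algebra.TensorProduct.tmul_mul_tmul, nil_mul, cons_mul_cons']
    abel

theorem counit_word_mul (a b : List A) :
    counit (R := k) (word k a * word k b) = counit (R := k) (word k a) * counit (R := k) (word k b) := by
  rcases a with _ | ⟨x, a⟩
  · simp [nil_mul, counit_word]
  rcases b with _ | ⟨y, b⟩
  · rw [mul_comm]
    simp [nil_mul, counit_word]
  · simp only [← cons_word, cons_mul_cons', map_add, counit_cons]
    simp

instance : Bialgebra k (QuasiShuffle k A) :=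
  Bialgebra.mk' k _ (by simp [one_def, counit_word])
    (by
      intro a b
      induction a using ind with
      | zero => simp
      | add a a' h h' => simp only [add_mul, map_add, h, h']
      | smul r a =>
      induction b using ind with
      | zero => simp
      | add b b' h h' => simp only [mul_add, map_add, h, h']
      | smul s b => simp only [smul_mul_assoc, mul_smul_comm, map_smul, counit_word_mul])
    (by rw [one_def, comul_nil]; rfl)
    (by
      intro a b
      induction a using ind with
      | zero => simp
      | add a a' h h' => simp only [add_mul, map_add, h, h']
      | smul r a =>
      induction b using ind with
      | zero => simp
      | add b b' h h' => simp only [mul_add, map_add, h, h']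
      | smul s b => simp only [smul_mul_assoc, mul_smul_comm, map_smul, comul_word_mul])

/-- The left convolution inverse of `g`, for `g` with `g(∅) = 1`. -/
def convInvWord (g : List A → QuasiShuffle k A) : List A → QuasiShuffle k A
  | [] => 1
  | x :: a => -∑ i : Fin (a.length + 1),
      convInvWord g ((x :: a).take i) * g ((x :: a).drop i)
  termination_by a => a.length
  decreasing_by
    have := i.isLt
    simp only [List.length_take, List.length_cons]
    omega

theorem convInvWord_nil (g : List A → QuasiShuffle k A) : convInvWord g [] = 1 := by
  rw [convInvWord]

/-- The linear extension of `convInvWord`. -/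
def convInv (g : QuasiShuffle k A →ₗ[k] QuasiShuffle k A) :
    QuasiShuffle k A →ₗ[k] QuasiShuffle k A :=
  (basis k A).constr k (convInvWord fun a => g (word k a))

theorem convInv_word (g : QuasiShuffle k A →ₗ[k] QuasiShuffle k A) (a : List A) :
    convInv g (word k a) = convInvWord (fun a => g (word k a)) a :=
  (basis k A).constr_basis k _ a

theorem convInv_one (g : QuasiShuffle k A →ₗ[k] QuasiShuffle k A) : convInv g 1 = 1 := by
  rw [one_def, convInv_word, convInvWord_nil, one_def]

theorem convInv_mul (g : QuasiShuffle k A →ₗ[k] QuasiShuffle k A) (hg : g 1 = 1) :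
    WithConv.toConv (convInv g) * WithConv.toConv g = 1 := by
  refine WithConv.ext (hom_ext fun a => ?_)
  change LinearMap.mul' k _ (TensorProduct.map (convInv g) g (comul (word k a)))
    = algebraMap k _ (counit (word k a))
  rw [comul_word, comulWord, map_sum, map_sum, counit_word]
  simp only [TensorProduct.map_tmul, LinearMap.mul'_apply, convInv_word]
  have hg' : g (word k []) = 1 := hg
  rcases a with _ | ⟨x, a⟩
  · simp [convInvWord_nil, hg']
  · rw [Finset.sum_range_succ, List.take_length, List.drop_length, hg', mul_one,
      convInvWord, Finset.sum_range]
    simp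

instance : HopfAlgebra k (QuasiShuffle k A) :=
  HopfAlgebra.ofConvInverse (convInv LinearMap.id) (convInv_mul _ rfl) (by
    have h1 := convInv_mul (k := k) (A := A) LinearMap.id rfl
    have h2 := convInv_mul (k := k) (A := A) (convInv LinearMap.id)
      (convInv_one _)
    have := left_inv_eq_right_inv h2 h1
    rw [this] at h2
    exact h2)

end Hopf

end QuasiShuffle

section Transport

variable {k : Type*} {H : Type*} {B : Type*} [CommRing k] [CommRing H] [CommRing B]
  [HopfAlgebra k H] [Algebra k B]

/-- The bialgebra structure on `B` transported from `H` along an algebra isomorphism. -/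
abbrev transportBialgebra (e : H ≃ₐ[k] B) : Bialgebra k B :=
  Bialgebra.ofAlgHom
    ((Algebra.TensorProduct.map e.toAlgHom e.toAlgHom).comp
      ((Bialgebra.comulAlgHom k H).comp e.symm.toAlgHom))
    ((Bialgebra.counitAlgHom k H).comp e.symm.toAlgHom)
    (by
      ext b
      obtain ⟨a, rfl⟩ := e.surjective b
      have h := congrArg (TensorProduct.map e.toLinearMap
        (TensorProduct.map e.toLinearMap e.toLinearMap)) (Coalgebra.coassoc_apply (R := k) a)
      have h0 : ∀ (s : H ⊗[k] H) (y : H), TensorProduct.map e.toLinearMap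
          (TensorProduct.map e.toLinearMap e.toLinearMap)
          (TensorProduct.assoc k H H H (s ⊗ₜ[k] y))
          = Algebra.TensorProduct.assoc k k k B B B
              (Algebra.TensorProduct.map e.toAlgHom e.toAlgHom s ⊗ₜ[k] e y) := by
        intro s y
        induction s with
        | zero => simp
        | add s t hs ht => simp only [TensorProduct.add_tmul, map_add, hs, ht]
        | tmul x z => simp
      have h1 : ∀ t : H ⊗[k] H, TensorProduct.map e.toLinearMap
          (TensorProduct.map e.toLinearMap e.toLinearMap)
          (TensorProduct.assoc k H H H (Coalgebra.comul.rTensor H t))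
          = Algebra.TensorProduct.assoc k k k B B B (Algebra.TensorProduct.map
            ((Algebra.TensorProduct.map e.toAlgHom e.toAlgHom).comp
              ((Bialgebra.comulAlgHom k H).comp e.symm.toAlgHom)) (AlgHom.id k B)
              (Algebra.TensorProduct.map e.toAlgHom e.toAlgHom t)) := by
        intro t
        induction t with
        | zero => simp
        | add s t hs ht => simp only [map_add, hs, ht]
        | tmul x y =>
          rw [LinearMap.rTensor_tmul, h0]
          simp
      have h2 : ∀ t : H ⊗[k] H, TensorProduct.map e.toLinearMap
          (TensorProduct.map e.toLinearMap e.toLinearMap) (Coalgebra.comul.lTensor H t)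
          = Algebra.TensorProduct.map (AlgHom.id k B)
            ((Algebra.TensorProduct.map e.toAlgHom e.toAlgHom).comp
              ((Bialgebra.comulAlgHom k H).comp e.symm.toAlgHom))
              (Algebra.TensorProduct.map e.toAlgHom e.toAlgHom t) := by
        intro t
        induction t with
        | zero => simp
        | add s t hs ht => simp only [map_add, hs, ht]
        | tmul x y =>
          simp only [LinearMap.lTensor_tmul, TensorProduct.map_tmul, Algebra.TensorProduct.map_tmul,
            AlgHom.comp_apply]
          simp
          rfl
      rw [h1, h2] at h
      simpa using h)
    (by
      ext b
      obtain ⟨a, rfl⟩ := e.surjective b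
      have h := congrArg (TensorProduct.map LinearMap.id e.toLinearMap)
        (Coalgebra.rTensor_counit_comul (R := k) a)
      have h1 : ∀ t : H ⊗[k] H, TensorProduct.map LinearMap.id e.toLinearMap
          (Coalgebra.counit.rTensor H t) = Algebra.TensorProduct.map
            ((Bialgebra.counitAlgHom k H).comp e.symm.toAlgHom) (AlgHom.id k B)
              (Algebra.TensorProduct.map e.toAlgHom e.toAlgHom t) := by
        intro t
        induction t with
        | zero => simp
        | add s t hs ht => simp only [map_add, hs, ht]
        | tmul x y => simp
      rw [h1] at h
      simpa using h)
    (by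
      ext b
      obtain ⟨a, rfl⟩ := e.surjective b
      have h := congrArg (TensorProduct.map e.toLinearMap LinearMap.id)
        (Coalgebra.lTensor_counit_comul (R := k) a)
      have h1 : ∀ t : H ⊗[k] H, TensorProduct.map e.toLinearMap LinearMap.id
          (Coalgebra.counit.lTensor H t) = Algebra.TensorProduct.map (AlgHom.id k B)
            ((Bialgebra.counitAlgHom k H).comp e.symm.toAlgHom)
              (Algebra.TensorProduct.map e.toAlgHom e.toAlgHom t) := by
        intro t
        induction t with
        | zero => simp
        | add s t hs ht => simp only [map_add, hs, ht]
        | tmul x y => simp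
      rw [h1] at h
      simpa using h)

/-- The Hopf algebra structure on `B` transported from `H` along an algebra isomorphism. -/
abbrev transportHopfAlgebra (e : H ≃ₐ[k] B) : HopfAlgebra k B :=
  letI : Bialgebra k B := transportBialgebra e
  letI : HopfAlgebraStruct k B :=
    { antipode := e.toLinearMap.comp ((HopfAlgebra.antipode k).comp e.symm.toLinearMap) }
  HopfAlgebra.ofSurjective
    (BialgHom.ofAlgHom e.toAlgHom
      (by
        ext a
        change Coalgebra.counit (e.symm (e a)) = _
        simp)
      (by
        ext a
        change TensorProduct.map _ _ _ = TensorProduct.map _ _ (Coalgebra.comul (e.symm (e a)))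
        rw [AlgEquiv.symm_apply_apply]
        rfl))
    e.surjective
    (by
      ext a
      change e (HopfAlgebra.antipode k (e.symm (e a))) = e (HopfAlgebra.antipode k a)
      rw [AlgEquiv.symm_apply_apply])

end Transport

/-- `f` is a homomorphism of Hopf algebras over `k`. -/
def IsHopfHom (k : Type*) {H K : Type*} [CommRing k] [CommRing H] [CommRing K] [HopfAlgebra k H]
    [HopfAlgebra k K] (f : H → K) : Prop :=
  ∃ φ : H →ₐc[k] K, (∀ x, φ x = f x) ∧
    ∀ x, f (HopfAlgebra.antipode k x) = HopfAlgebra.antipode k (f x)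

/-- `K` is a Hopf quotient algebra of `H`: it is isomorphic, as a Hopf algebra, to the quotient of
`H` by a Hopf ideal. -/
def IsHopfQuotient (k H K : Type*) [CommRing k] [CommRing H] [CommRing K] [HopfAlgebra k H]
    [HopfAlgebra k K] : Prop :=
  ∃ (I : Ideal H) (_ : I.IsHopfIdeal k) (e : H ⧸ I → K), Function.Bijective e ∧ IsHopfHom k e

section Renormalization

open scoped Topology

/-- The index tuples `i₁ < ⋯ < iₙ` of positive integers with `x_{i₁}^{α₁} ⋯ x_{iₙ}^{αₙ} = x^d`. -/
def indexTuples {n : ℕ} (α : Fin n → ℕ) (d : ℕ+ →₀ ℕ) : Set (Fin n → ℕ+) :=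
  {I | StrictMono I ∧ ∑ j, Finsupp.single (I j) (α j) = d}

/-- The monomial quasisymmetric function
`M_α = ∑_{i₁ < ⋯ < iₙ} x_{i₁}^{α₁} ⋯ x_{iₙ}^{αₙ}` of a composition `α`: the coefficient of `x^d` is
the number of index tuples whose monomial is `x^d`. -/
def monomialQSym (k : Type*) [CommRing k] (α : List ℕ+) : MvPowerSeries ℕ+ k :=
  fun d => (Nat.card (indexTuples (fun j => (α.get j : ℕ)) d) : k)

/-- The module of quasisymmetric functions. -/
def QSym (k : Type*) [CommRing k] : Submodule k (MvPowerSeries ℕ+ k) :=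
  Submodule.span k (Set.range (monomialQSym k))

/-- `Φ ∈ ℚ[[X]][t][z⁻¹, z]]` is the regularization
`∑_{i₁ < ⋯ < iₙ} x_{i₁}^{α₁} ⋯ x_{iₙ}^{αₙ} e^{(i₁ + t) β₁ z} ⋯ e^{(iₙ + t) βₙ z}`
of the directed weak composition `w = ((α₁, β₁), …, (αₙ, βₙ))`: for every monomial `x^d` and every
real `t ≥ 0`, the coefficient series of `x^d` converges for all `z` with `Re z < 0` close to `0`,
and `Φ` provides the Laurent expansion at `z = 0` of its sum. -/
def IsRegularization (w : List (ℕ × ℕ+))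
    (Φ : LaurentSeries (Polynomial (MvPowerSeries ℕ+ ℚ))) : Prop :=
  ∀ (d : ℕ+ →₀ ℕ) (t : ℝ), 0 ≤ t → ∀ᶠ z : ℂ in 𝓝[{z : ℂ | z.re < 0}] 0, ∃ s : ℂ,
    HasSum (fun I : indexTuples (fun j => (w.get j).1) d =>
      ∏ j, Complex.exp ((((I.1 j : ℕ) : ℂ) + (t : ℂ)) * (((w.get j).2 : ℕ) : ℂ) * z)) s ∧
    HasSum (fun n : ℤ =>
      (Φ.coeff n).sum (fun i f => ((MvPowerSeries.coeff d f : ℚ) : ℂ) * (t : ℂ) ^ i) * z ^ n) s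

/-- The regularization map `φ` on directed weak compositions, with values in
`𝐤[[X]][t][z⁻¹, z]]`: the unique `Φ` with `IsRegularization w Φ`, read with coefficients in `𝐤`. -/
def regularization (k : Type*) [CommRing k] [Algebra ℚ k] (w : List (ℕ × ℕ+)) :
    LaurentSeries (Polynomial (MvPowerSeries ℕ+ k)) :=
  (Classical.epsilon (IsRegularization w)).map
    (Polynomial.mapRingHom (MvPowerSeries.map (σ := ℕ+) (algebraMap ℚ k)))

/-- The projection `P` of a Laurent series onto its polar part. -/
def polarPart {S : Type*} [CommRing S] (f : LaurentSeries S) : LaurentSeries S :=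
  HahnSeries.truncLT (0 : ℤ) f

variable {A S : Type*} [CommRing S]

/-- The counterterm `φ₋` of the Algebraic Birkhoff Factorization `φ = φ₊ ⋆ φ₋^{⋆(-1)}` with respect
to the deconcatenation coproduct and the projection `P`, on words:
`φ₋(w) = -P(φ(w) + ∑_{0 < i < n} φ(w₁ ⋯ wᵢ) φ₋(wᵢ₊₁ ⋯ wₙ))`. -/
def birkhoffMinus (φ : List A → LaurentSeries S) : List A → LaurentSeries S
  | [] => 1
  | x :: a => -polarPart (φ (x :: a) + ∑ i : Fin a.length,
      φ ((x :: a).take (i + 1)) * birkhoffMinus φ ((x :: a).drop (i + 1)))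
  termination_by w => w.length
  decreasing_by
    simp only [List.drop_succ_cons, List.length_drop, List.length_cons]
    omega

/-- The renormalization `φ₊` of the Algebraic Birkhoff Factorization `φ = φ₊ ⋆ φ₋^{⋆(-1)}`, on words:
`φ₊(w) = (id - P)(φ(w) + ∑_{0 < i < n} φ(w₁ ⋯ wᵢ) φ₋(wᵢ₊₁ ⋯ wₙ))`. -/
def birkhoffPlus (φ : List A → LaurentSeries S) : List A → LaurentSeries S
  | [] => 1
  | x :: a =>
      let u := φ (x :: a) + ∑ i : Fin a.length,
        φ ((x :: a).take (i + 1)) * birkhoffMinus φ ((x :: a).drop (i + 1))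
      u - polarPart u

/-- The directional quasisymmetric function `Z(w) = φ₊(w)|_{z = 0} ∈ 𝐤[[X]][t]` of a directed weak
composition. -/
def directionalQSym (k : Type*) [CommRing k] [Algebra ℚ k] (w : List (ℕ × ℕ+)) :
    Polynomial (MvPowerSeries ℕ+ k) :=
  (birkhoffPlus (regularization k) w).coeff 0

/-- The renormalized monomial quasisymmetric function of a weak composition `α`, computed in the
constant direction `(δ, …, δ)`. -/
def renormalizedMonomial (k : Type*) [CommRing k] [Algebra ℚ k] (δ : ℕ+) (α : List ℕ) :
    Polynomial (MvPowerSeries ℕ+ k) :=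
  directionalQSym k (α.map fun a => (a, δ))

/-- The module of renormalized quasisymmetric functions. -/
def RenQSym (k : Type*) [CommRing k] [Algebra ℚ k] :
    Submodule k (Polynomial (MvPowerSeries ℕ+ k)) :=
  Submodule.span k {M | ∃ δ α, M = renormalizedMonomial k δ α}

end Renormalization

end

/-! Write a word as u0^m with u empty or ending in a nonzero letter, and fix a monomial x^d with
largest index L = `maxIndex d`. The indices attached to u range over finitely many lists, none
exceeding L, and those attached to the trailing zeros form an arbitrary increasing list above L
(`bijOn_append`). Hence the coefficient of x^d in the regularization is a factor regular at z = 0,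
whose value there is the number c of index lists of u, times the regularization of 0^m with t
replaced by t + L.

The regularizations of the words 0^m are the elementary symmetric functions of the variables
e^{(j+t)δz}, j ≥ 1. By Newton's identities (`derivative_zeroGen`) the logarithmic derivative of
their generating series is built from the power sums p_n. The polar part of p_n is -1/(nδz), and its
constant term is -(t + 1/2) for every n (`exists_powerSumSeries_add`). Cancelling the poles in the
logarithmic derivative yields counterterms free of t and leaves (1 + X)^{-(t+1/2)} at z = 0. Being
free of t, the same counterterms cancel the poles after the shift by L. So the Birkhoff counterterm
of u0^m vanishes for nonempty u, and the coefficient of x^d in M_{u0^m} is c · binom(-(t + L + 1/2),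
m) (`coeffPoly_renormalizedMonomial`).

At t = -N - 1/2 with N ≥ L this is c · binom(N - L, m), the coefficient of x^d in the monomial
quasisymmetric polynomial in N variables. These polynomials multiply by the quasi-shuffle rule, and
together they separate the elements of QS(ℕ). A polynomial in t that vanishes at all these nodes
from some N on is zero, so both properties pass to the M_α, which gives the algebra isomorphism
(`hopf_of_specialization`).

For a composition, m = 0 and t disappears: M_α is the usual monomial quasisymmetric function, and
the inclusion QSym ⊆ RenQSym is the map QS(ℙ) → QS(ℕ) of words. It has a Hopf retraction, which
kills words ending in 0 and otherwise deletes each 0 at the cost of a sign (`dropZerosHom`). The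
kernel of this retraction is the required Hopf ideal. -/

noncomputable section

open scoped TensorProduct

universe u v

/-! ### Antipodes, kernels and quotients of split Hopf algebra homomorphisms -/

section HopfHom

open Coalgebra WithConv LinearMap

variable {k H K : Type*} [CommRing k] [CommRing H] [CommRing K] [HopfAlgebra k H]
  [HopfAlgebra k K]

/-- A bialgebra homomorphism between Hopf algebras intertwines the antipodes. -/
theorem BialgHom.map_antipode_eq (φ : H →ₐc[k] K) (x : H) :
    φ (HopfAlgebra.antipode k x) = HopfAlgebra.antipode k (φ x) := by
  have h1 : toConv (φ.toLinearMap ∘ₗ HopfAlgebra.antipode k)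
      * toConv φ.toLinearMap = (1 : WithConv (H →ₗ[k] K)) := by
    apply ofConv_injective
    calc _ = (AlgHomClass.toAlgHom φ).toLinearMap ∘ₗ
            (toConv (HopfAlgebra.antipode k) * toConv .id : WithConv (H →ₗ[k] H)).ofConv := by
          rw [algHom_comp_convMul_distrib]; rfl
      _ = _ := by rw [_root_.LinearMap.antipode_mul_id, algHom_comp_convOne]
  have h2 : toConv φ.toLinearMap * toConv (HopfAlgebra.antipode k ∘ₗ φ.toLinearMap)
      = (1 : WithConv (H →ₗ[k] K)) := by
    apply ofConv_injective
    calc _ = (toConv .id * toConv (HopfAlgebra.antipode k) : WithConv (K →ₗ[k] K)).ofConv ∘ₗ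
          φ.toCoalgHom.toLinearMap := by
          rw [convMul_comp_coalgHom_distrib]; rfl
      _ = _ := by rw [_root_.LinearMap.id_mul_antipode]; exact convOne_comp_coalgHom φ.toCoalgHom
  have h3 := left_inv_eq_right_inv h1 h2
  exact LinearMap.congr_fun (congrArg ofConv h3) x

theorem isHopfHom_of_bialgHom (φ : H →ₐc[k] K) : IsHopfHom k φ :=
  ⟨φ, fun _ => rfl, fun x => φ.map_antipode_eq x⟩

/-- The kernel of a homomorphism of Hopf algebras with a linear section is a Hopf ideal. -/
theorem isHopfIdeal_ker (p : H →ₐc[k] K) (s : K →ₗ[k] H) (hs : ∀ y, p (s y) = y) :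
    (RingHom.ker (p : H →ₐ[k] K)).IsHopfIdeal k where
  counit_eq_zero x hx := by
    have hx' : p x = 0 := hx
    rw [← CoalgHomClass.counit_comp_apply p x, hx', map_zero]
  map_mkQ_comul_eq_zero x hx := by
    set I := (RingHom.ker (p : H →ₐ[k] K)).restrictScalars k
    have hx' : p x = 0 := hx
    -- Over a general ring the kernel of p ⊗ p need not be generated by the two obvious pieces. The
    -- section makes the quotient map factor linearly through p, so its tensor square kills whatever
    -- p ⊗ p kills.
    have hq : I.mkQ = (I.mkQ ∘ₗ s) ∘ₗ p.toLinearMap := by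
      refine LinearMap.ext fun a => ?_
      refine (Submodule.Quotient.eq I).2 ?_
      change p (a - s (p a)) = 0
      rw [map_sub, hs, sub_self]
    have h := CoalgHomClass.map_comp_comul_apply p x
    rw [hx', map_zero] at h
    rw [hq, TensorProduct.map_comp, LinearMap.comp_apply]
    refine (congrArg _ h).trans (map_zero _)
  antipode_mem x hx := by
    have hx' : p x = 0 := hx
    change p (HopfAlgebra.antipode k x) = 0
    rw [p.map_antipode_eq, hx', map_zero]

/-- A Hopf algebra onto which there is a linearly split homomorphism of Hopf algebras is a Hopf
quotient algebra. -/
theorem isHopfQuotient_of_section (p : H →ₐc[k] K) (s : K →ₗ[k] H) (hs : ∀ y, p (s y) = y) :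
    IsHopfQuotient k H K := by
  have hI := isHopfIdeal_ker p s hs
  set I := RingHom.ker (p : H →ₐ[k] K)
  let e : H ⧸ I →ₐ[k] K := Ideal.Quotient.liftₐ I (p : H →ₐ[k] K) fun _ ha => ha
  have he : ∀ a, e (Ideal.Quotient.mk I a) = p a := fun a => rfl
  let φ : H ⧸ I →ₐc[k] K := BialgHom.ofAlgHom e
    (by
      refine Ideal.Quotient.algHom_ext k (AlgHom.ext fun a => ?_)
      change counit (R := k) (p a) = counit (R := k) a
      exact CoalgHomClass.counit_comp_apply p a)
    (by
      refine Ideal.Quotient.algHom_ext k (AlgHom.ext fun a => ?_)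
      change TensorProduct.map e.toLinearMap e.toLinearMap (TensorProduct.map
        (Ideal.Quotient.mkₐ k I).toLinearMap (Ideal.Quotient.mkₐ k I).toLinearMap (comul a))
        = comul (R := k) (p a)
      rw [← LinearMap.comp_apply, ← TensorProduct.map_comp]
      exact CoalgHomClass.map_comp_comul_apply p a)
  refine ⟨I, hI, φ, ⟨?_, ?_⟩, isHopfHom_of_bialgHom φ⟩
  · intro a b hab
    obtain ⟨a, rfl⟩ := Ideal.Quotient.mk_surjective a
    obtain ⟨b, rfl⟩ := Ideal.Quotient.mk_surjective b
    refine Ideal.Quotient.eq.2 ?_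
    have hab' : p a = p b := hab
    change p (a - b) = 0
    rw [map_sub, hab', sub_self]
  · exact fun y => ⟨Ideal.Quotient.mk I (s y), hs y⟩

end HopfHom

/-! ### Homomorphisms between transported Hopf algebras -/

section TransportHom

variable {k H K B C : Type*} [CommRing k] [CommRing H] [CommRing K] [CommRing B] [CommRing C]
  [HopfAlgebra k H] [HopfAlgebra k K] [Algebra k B] [Algebra k C]

/-- The homomorphism between transported Hopf algebras induced by a bialgebra homomorphism. -/
def transportHom (e : H ≃ₐ[k] B) (e' : K ≃ₐ[k] C) (φ : H →ₐc[k] K) :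
    letI := transportHopfAlgebra e
    letI := transportHopfAlgebra e'
    B →ₐc[k] C :=
  letI := transportHopfAlgebra e
  letI := transportHopfAlgebra e'
  BialgHom.ofAlgHom ((e'.toAlgHom.comp (φ : H →ₐ[k] K)).comp e.symm.toAlgHom)
    (by
      refine AlgHom.ext fun b => ?_
      change Coalgebra.counit (R := k) (e'.symm (e' (φ (e.symm b))))
        = Coalgebra.counit (R := k) (e.symm b)
      rw [AlgEquiv.symm_apply_apply]
      exact CoalgHomClass.counit_comp_apply φ _)
    (by
      refine AlgHom.ext fun b => ?_
      obtain ⟨a, rfl⟩ := e.surjective b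
      change TensorProduct.map _ _ (TensorProduct.map e.toLinearMap e.toLinearMap
          (Coalgebra.comul (R := k) (e.symm (e a))))
        = TensorProduct.map e'.toLinearMap e'.toLinearMap
          (Coalgebra.comul (R := k) (e'.symm (e' (φ (e.symm (e a))))))
      rw [AlgEquiv.symm_apply_apply, AlgEquiv.symm_apply_apply,
        ← CoalgHomClass.map_comp_comul_apply φ a]
      generalize Coalgebra.comul (R := k) a = t
      induction t with
      | zero => simp
      | add s t hs ht => rw [map_add, map_add, hs, ht, map_add, map_add]
      | tmul x y =>
        change (e' (φ (e.symm (e x)))) ⊗ₜ[k] (e' (φ (e.symm (e y)))) = e' (φ x) ⊗ₜ[k] e' (φ y)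
        rw [AlgEquiv.symm_apply_apply, AlgEquiv.symm_apply_apply])

theorem transportHom_apply (e : H ≃ₐ[k] B) (e' : K ≃ₐ[k] C) (φ : H →ₐc[k] K) (a : H) :
    letI := transportHopfAlgebra e
    letI := transportHopfAlgebra e'
    transportHom e e' φ (e a) = e' (φ a) := by
  change e' (φ (e.symm (e a))) = e' (φ a)
  rw [AlgEquiv.symm_apply_apply]

theorem isHopfQuotient_transport (e : H ≃ₐ[k] B) (e' : K ≃ₐ[k] C) (φ : H →ₐc[k] K)
    (ψ : K →ₐc[k] H) (h : ∀ y, φ (ψ y) = y) :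
    letI := transportHopfAlgebra e
    letI := transportHopfAlgebra e'
    IsHopfQuotient k B C := by
  let := transportHopfAlgebra e
  let := transportHopfAlgebra e'
  refine isHopfQuotient_of_section (transportHom e e' φ)
    (e.toLinearMap ∘ₗ ψ.toLinearMap ∘ₗ e'.symm.toLinearMap) fun c => ?_
  obtain ⟨y, rfl⟩ := e'.surjective c
  refine (transportHom_apply e e' φ _).trans ?_
  change e' (φ (ψ (e'.symm (e' y)))) = e' y
  rw [AlgEquiv.symm_apply_apply, h]

end TransportHom

/-! ### The inclusion QS(ℙ) → QS(ℕ) and its retraction by signed deletion of zeros -/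

namespace QuasiShuffle

open Coalgebra

variable {k : Type*} [CommRing k]

/-- An algebra homomorphism out of a quasi-shuffle algebra, from a linear map that is
multiplicative on words. -/
def algHomOfWords {A : Type*} [AddCommSemigroup A] {B : Type*} [CommRing B] [Algebra k B]
    (f : QuasiShuffle k A →ₗ[k] B) (h1 : f (word k []) = 1)
    (hmul : ∀ a b, f (word k a * word k b) = f (word k a) * f (word k b)) :
    QuasiShuffle k A →ₐ[k] B :=
  AlgHom.ofLinearMap f h1 (by
    intro a b
    induction a using ind with
    | zero => simp
    | add a a' h h' => simp only [add_mul, map_add, h, h']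
    | smul r a =>
    induction b using ind with
    | zero => simp
    | add b b' h h' => simp only [mul_add, map_add, h, h']
    | smul s b => simp only [smul_mul_assoc, mul_smul_comm, map_smul, hmul])

/-- The linear map relabelling the letters along `φ`. -/
def mapLetters {A B : Type*} (φ : A → B) : QuasiShuffle k A →ₗ[k] QuasiShuffle k B :=
  (basis k A).constr k fun a => word k (a.map φ)

theorem mapLetters_word {A B : Type*} (φ : A → B) (a : List A) :
    mapLetters φ (word k a) = word k (a.map φ) :=
  (basis k A).constr_basis k (fun a => word k (a.map φ)) a

theorem mapLetters_cons {A B : Type*} (φ : A → B) (x : A) (u : QuasiShuffle k A) :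
    mapLetters φ (cons x u) = cons (φ x) (mapLetters φ u) := by
  have : (mapLetters φ).comp (cons x) = (cons (k := k) (φ x)).comp (mapLetters φ) :=
    hom_ext fun a => by simp [mapLetters_word]
  exact LinearMap.congr_fun this u

theorem mapLetters_mul {A B : Type*} [AddCommSemigroup A] [AddCommSemigroup B] (φ : A → B)
    (hφ : ∀ x y, φ (x + y) = φ x + φ y) (a b : List A) :
    mapLetters φ (word k a * word k b)
      = mapLetters φ (word k a) * mapLetters φ (word k b) := by
  induction a, b using mulWord.induct with
  | case1 b => rw [nil_mul, mapLetters_word _ [], List.map_nil, nil_mul]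
  | case2 x a => rw [mul_comm, nil_mul, mapLetters_word _ [], List.map_nil, mul_comm, nil_mul]
  | case3 x a y b h1 h2 h3 =>
    rw [← cons_word, ← cons_word] at *
    rw [cons_mul_cons', map_add, map_add, mapLetters_cons, mapLetters_cons, mapLetters_cons, h1, h2,
      h3, mapLetters_cons, mapLetters_cons, cons_mul_cons', hφ]

/-- A semigroup homomorphism induces a homomorphism of quasi-shuffle bialgebras. -/
def mapHom {A B : Type*} [AddCommSemigroup A] [AddCommSemigroup B] (φ : A → B)
    (hφ : ∀ x y, φ (x + y) = φ x + φ y) : QuasiShuffle k A →ₐc[k] QuasiShuffle k B :=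
  BialgHom.ofAlgHom
    (algHomOfWords (mapLetters φ) (mapLetters_word φ []) (mapLetters_mul φ hφ))
    (AlgHom.toLinearMap_injective (hom_ext fun a => by
      change counit (R := k) (mapLetters φ (word k a)) = counit (R := k) (word k a)
      rw [mapLetters_word, counit_word, counit_word]
      simp))
    (AlgHom.toLinearMap_injective (hom_ext fun a => by
      change TensorProduct.map (mapLetters φ) (mapLetters φ) (comul (R := k) (word k a))
        = comul (R := k) (mapLetters φ (word k a))
      rw [mapLetters_word, comul_word, comul_word, comulWord, comulWord, map_sum]
      simp [mapLetters_word]))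

theorem mapHom_word {A B : Type*} [AddCommSemigroup A] [AddCommSemigroup B] (φ : A → B)
    (hφ : ∀ x y, φ (x + y) = φ x + φ y) (a : List A) :
    mapHom φ hφ (word k a) = word k (a.map φ) :=
  mapLetters_word φ a

/-- Deleting the letters `0`: a word ending in `0` goes to `0`, any other word goes to
`(-1)^(number of zeros)` times the word of its non-zero letters. -/
def dropZerosWord (k : Type*) [CommRing k] : List ℕ → QuasiShuffle k ℕ+
  | [] => word k []
  | 0 :: a => (if a = [] then 1 else 0) - dropZerosWord k a
  | (n + 1) :: a => cons n.succPNat (dropZerosWord k a)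

/-- The linear extension of `dropZerosWord`. -/
def dropZeros : QuasiShuffle k ℕ →ₗ[k] QuasiShuffle k ℕ+ :=
  (basis k ℕ).constr k (dropZerosWord k)

theorem dropZeros_word (a : List ℕ) : dropZeros (word k a) = dropZerosWord k a :=
  (basis k ℕ).constr_basis k (dropZerosWord k) a

theorem dropZeros_nil : dropZeros (word k []) = word k [] := by
  rw [dropZeros_word, dropZerosWord]

theorem dropZeros_cons_zero (u : QuasiShuffle k ℕ) :
    dropZeros (cons 0 u) = counit (R := k) u • (1 : QuasiShuffle k ℕ+) - dropZeros u := by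
  have : dropZeros.comp (cons 0) = (counit (R := k)).smulRight (1 : QuasiShuffle k ℕ+)
      - (dropZeros (k := k)) := by
    refine hom_ext fun a => ?_
    simp only [LinearMap.comp_apply, LinearMap.sub_apply, LinearMap.smulRight_apply, cons_word,
      dropZeros_word, dropZerosWord, counit_word]
    split <;> simp
  exact LinearMap.congr_fun this u

theorem dropZeros_cons_succ (n : ℕ) (u : QuasiShuffle k ℕ) :
    dropZeros (cons (n + 1) u) = cons n.succPNat (dropZeros u) := by
  have : dropZeros.comp (cons (n + 1)) = (cons (k := k) n.succPNat).comp dropZeros := by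
    refine hom_ext fun a => ?_
    simp only [LinearMap.comp_apply, cons_word, dropZeros_word, dropZerosWord]
  exact LinearMap.congr_fun this u

/-- Plain deletion of zeros is not multiplicative: (0) * (n) = (0, n) + (n, 0) + (n). Sending (0, n)
to -(n) and (n, 0) to 0 makes this consistent with (0) ↦ 0. In general a leading zero acts as u ↦
ε(u) - D(u), where D is `dropZeros`, and multiplicativity of the counit ε closes the induction. -/
theorem dropZeros_mul (a b : List ℕ) :
    dropZeros (word k a * word k b) = dropZeros (word k a) * dropZeros (word k b) := by
  induction a, b using mulWord.induct with
  | case1 b => rw [nil_mul, dropZeros_nil, nil_mul]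
  | case2 x a => rw [mul_comm, nil_mul, dropZeros_nil, mul_comm, nil_mul]
  | case3 x a y b h1 h2 h3 =>
    rw [← cons_word, ← cons_word] at *
    rw [cons_mul_cons', map_add, map_add]
    have hε : ∀ u v : QuasiShuffle k ℕ, counit (R := k) (u * v)
      = counit (R := k) u * counit (R := k) v := fun u v => Bialgebra.counit_mul u v
    rcases x with _ | m <;> rcases y with _ | n
    · simp only [add_zero, dropZeros_cons_zero, h1, h2, h3, hε, counit_cons]
      simp only [mul_zero, zero_mul, zero_smul, mul_sub, sub_mul, Algebra.mul_smul_comm,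
        Algebra.smul_mul_assoc, mul_one, one_mul, smul_smul, smul_sub,
        mul_comm (counit (R := k) (word k b))]
      abel
    · rw [zero_add]
      simp only [dropZeros_cons_zero, dropZeros_cons_succ, h1, h2, h3, hε, counit_cons]
      simp only [mul_zero, zero_smul, sub_mul, Algebra.smul_mul_assoc, one_mul, map_sub, map_smul]
      abel
    · rw [add_zero]
      simp only [dropZeros_cons_zero, dropZeros_cons_succ, h1, h2, h3, hε, counit_cons]
      simp only [zero_mul, zero_smul, mul_sub, Algebra.mul_smul_comm, mul_one, map_sub, map_smul]
      abel
    · rw [show m + 1 + (n + 1) = (m + n + 1) + 1 by ring]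
      simp only [dropZeros_cons_succ, h1, h2, h3, cons_mul_cons']
      congr 3
      exact PNat.eq (by simp only [Nat.succPNat_coe, PNat.add_coe]; omega)

theorem map_dropZeros_rTensor_succ (n : ℕ) (t : QuasiShuffle k ℕ ⊗[k] QuasiShuffle k ℕ) :
    TensorProduct.map dropZeros dropZeros ((cons (n + 1)).rTensor (QuasiShuffle k ℕ) t)
      = (cons n.succPNat).rTensor (QuasiShuffle k ℕ+)
        (TensorProduct.map dropZeros dropZeros t) := by
  induction t with
  | zero => simp
  | tmul a b => simp [dropZeros_cons_succ]
  | add s t hs ht => simp only [map_add, hs, ht]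

theorem map_dropZeros_rTensor_zero (t : QuasiShuffle k ℕ ⊗[k] QuasiShuffle k ℕ) :
    TensorProduct.map dropZeros dropZeros ((cons 0).rTensor (QuasiShuffle k ℕ) t)
      = TensorProduct.map ((Algebra.linearMap k (QuasiShuffle k ℕ+)).comp LinearMap.id) dropZeros
          ((counit (R := k)).rTensor (QuasiShuffle k ℕ) t)
        - TensorProduct.map dropZeros dropZeros t := by
  induction t with
  | zero => simp
  | tmul a b =>
    simp [dropZeros_cons_zero, TensorProduct.sub_tmul, Algebra.algebraMap_eq_smul_one]
  | add s t hs ht =>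
    simp only [map_add, hs, ht]
    abel

/-- For a leading zero, D ⊗ D applied to 1 ⊗ 0a gives ε(a) 1 ⊗ 1 - 1 ⊗ D(a). The counit law turns
the remaining cuts into 1 ⊗ D(a) - (D ⊗ D)Δ(a), so the middle terms cancel. -/
theorem comul_dropZeros (a : List ℕ) :
    TensorProduct.map dropZeros dropZeros (comul (R := k) (word k a))
      = comul (R := k) (dropZeros (word k a)) := by
  induction a with
  | nil => rw [comul_nil, TensorProduct.map_tmul, dropZeros_nil, comul_nil]
  | cons x a ih =>
    rw [← cons_word, comul_cons, map_add, TensorProduct.map_tmul, dropZeros_nil]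
    rcases x with _ | n
    · rw [map_dropZeros_rTensor_zero, ih, rTensor_counit_comul, dropZeros_cons_zero, map_sub,
        map_smul, TensorProduct.map_tmul, one_def, comul_nil]
      simp only [LinearMap.comp_id, Algebra.linearMap_apply, map_one, TensorProduct.tmul_sub,
        TensorProduct.tmul_smul, one_def]
      abel
    · rw [map_dropZeros_rTensor_succ, ih, dropZeros_cons_succ, comul_cons]

theorem counit_dropZeros (a : List ℕ) :
    counit (R := k) (dropZeros (word k a)) = counit (R := k) (word k a) := by
  induction a with
  | nil => rw [dropZeros_nil, counit_word, counit_word]; rfl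
  | cons x a ih =>
    rw [← cons_word]
    rcases x with _ | n
    · rw [dropZeros_cons_zero, map_sub, map_smul, ih, one_def, counit_word [], counit_cons]
      simp
    · rw [dropZeros_cons_succ, counit_cons, counit_cons]

/-- Deleting zeros is a homomorphism of bialgebras `QS(ℕ) → QS(ℙ)`. -/
def dropZerosHom : QuasiShuffle k ℕ →ₐc[k] QuasiShuffle k ℕ+ :=
  BialgHom.ofAlgHom (algHomOfWords dropZeros dropZeros_nil dropZeros_mul)
    (AlgHom.toLinearMap_injective (hom_ext counit_dropZeros))
    (AlgHom.toLinearMap_injective (hom_ext comul_dropZeros))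

/-- The inclusion `QS(ℙ) → QS(ℕ)`. -/
def inclHom : QuasiShuffle k ℕ+ →ₐc[k] QuasiShuffle k ℕ :=
  mapHom (fun n : ℕ+ => (n : ℕ)) PNat.add_coe

theorem inclHom_word (a : List ℕ+) :
    inclHom (word k a) = word k (a.map fun n : ℕ+ => (n : ℕ)) :=
  mapHom_word _ _ a

theorem dropZerosHom_inclHom (u : QuasiShuffle k ℕ+) : dropZerosHom (inclHom u) = u := by
  have : dropZeros.comp (mapLetters fun n : ℕ+ => (n : ℕ)) = (LinearMap.id (R := k)) := by
    refine hom_ext fun a => ?_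
    rw [LinearMap.comp_apply, mapLetters_word, dropZeros_word, LinearMap.id_apply]
    induction a with
    | nil => rfl
    | cons x a ih =>
      obtain ⟨n, rfl⟩ : ∃ n : ℕ, x = n.succPNat := ⟨x.natPred, by simp⟩
      rw [List.map_cons, Nat.succPNat_coe, Nat.succ_eq_add_one, dropZerosWord, ih, cons_word]
  exact LinearMap.congr_fun this u

end QuasiShuffle

/-! ### Coefficients of x^d as polynomials in t, and vanishing at infinitely many nodes -/

section CoeffPoly

variable {k : Type*} [CommRing k]

/-- Taking the coefficient of `x^d` in every coefficient of a polynomial over `k[[X]]`. -/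
def coeffPoly (d : ℕ+ →₀ ℕ) :
    Polynomial (MvPowerSeries ℕ+ k) →ₗ[k] Polynomial k where
  toFun P := ⟨.ofCoeff (P.toFinsupp.coeff.mapRange (MvPowerSeries.coeff (R := k) d) (map_zero _))⟩
  map_add' P Q := by
    ext i
    simp [Polynomial.coeff]
  map_smul' r P := by
    ext i
    simp [Polynomial.coeff]

@[simp] theorem coeff_coeffPoly (d : ℕ+ →₀ ℕ) (P : Polynomial (MvPowerSeries ℕ+ k)) (i : ℕ) :
    (coeffPoly d P).coeff i = MvPowerSeries.coeff d (P.coeff i) := rfl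

theorem ext_coeffPoly {P Q : Polynomial (MvPowerSeries ℕ+ k)}
    (h : ∀ d, coeffPoly d P = coeffPoly d Q) : P = Q := by
  ext i d
  rw [← coeff_coeffPoly, h, coeff_coeffPoly]

theorem coeff_eval_C (d : ℕ+ →₀ ℕ) (P : Polynomial (MvPowerSeries ℕ+ k)) (r : k) :
    MvPowerSeries.coeff d (P.eval (MvPowerSeries.C r)) = (coeffPoly d P).eval r := by
  have hdeg : (coeffPoly d P).natDegree ≤ P.natDegree := by
    refine Polynomial.natDegree_le_iff_coeff_eq_zero.2 fun N hN => ?_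
    rw [coeff_coeffPoly, Polynomial.coeff_eq_zero_of_natDegree_lt hN, map_zero]
  rw [Polynomial.eval_eq_sum_range, Polynomial.eval_eq_sum_range' (Nat.lt_succ_of_le hdeg), map_sum]
  refine Finset.sum_congr rfl fun i _ => ?_
  rw [← map_pow, MvPowerSeries.coeff_mul_C, coeff_coeffPoly]

/-- A polynomial with infinitely many roots, whose pairwise differences are units, vanishes. -/
theorem Polynomial.eq_zero_of_forall_eval_eq_zero {p : Polynomial k} {r : ℕ → k} {N₀ : ℕ}
    (hr : ∀ i j, i ≠ j → IsUnit (r i - r j)) (hp : ∀ N, N₀ ≤ N → p.eval (r N) = 0) : p = 0 := by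
  nontriviality k
  induction hn : p.natDegree using Nat.strong_induction_on generalizing p N₀ with
  | _ n ih =>
  have h0 := hp N₀ le_rfl
  obtain ⟨q, rfl⟩ := Polynomial.dvd_iff_isRoot.2 h0
  by_cases hq : q = 0
  · rw [hq, mul_zero]
  have hdeg := (Polynomial.monic_X_sub_C (r N₀)).natDegree_mul' hq
  rw [Polynomial.natDegree_X_sub_C] at hdeg
  rw [ih q.natDegree (by omega) (p := q) (N₀ := N₀ + 1) (fun N hN => ?_) rfl, mul_zero]
  have := hp N (by omega)
  rw [Polynomial.eval_mul, Polynomial.eval_sub, Polynomial.eval_X, Polynomial.eval_C] at this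
  -- The coefficient ring may have zero divisors; the factor X - r N₀ can be cancelled at the later
  -- nodes because differences of nodes are units.
  exact ((hr N N₀ (by omega)).mul_right_eq_zero).1 this

end CoeffPoly

/-! ### Monomial quasisymmetric polynomials in finitely many variables -/

section Truncation

variable {k : Type*} [CommRing k]

/-- The exponent of the monomial `x_{i₁}^{α₁} ⋯ x_{iₙ}^{αₙ}`. -/
def monomialExponent (l : List ℕ+) (α : List ℕ) : ℕ+ →₀ ℕ :=
  (List.zipWith (fun i a => Finsupp.single i a) l α).sum

@[simp] theorem monomialExponent_nil (l : List ℕ+) : monomialExponent l [] = 0 := by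
  simp [monomialExponent]

@[simp] theorem monomialExponent_nil_left (α : List ℕ) : monomialExponent [] α = 0 := by
  simp [monomialExponent]

@[simp] theorem monomialExponent_cons (i : ℕ+) (l : List ℕ+) (a : ℕ) (α : List ℕ) :
    monomialExponent (i :: l) (a :: α) = Finsupp.single i a + monomialExponent l α := by
  simp [monomialExponent]

/-- The monomial quasisymmetric polynomial of the word `α` in the variables indexed by a list. -/
def truncWord (k : Type*) [CommRing k] : List ℕ → List ℕ+ → MvPowerSeries ℕ+ k
  | [], _ => 1
  | _ :: _, [] => 0
  | a :: α, n :: ns => truncWord k (a :: α) ns + MvPowerSeries.X n ^ a * truncWord k α ns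

/-- The linear extension of `truncWord`. -/
def trunc (ns : List ℕ+) : QuasiShuffle k ℕ →ₗ[k] MvPowerSeries ℕ+ k :=
  (QuasiShuffle.basis k ℕ).constr k fun α => truncWord k α ns

open QuasiShuffle

theorem trunc_word (ns : List ℕ+) (α : List ℕ) : trunc ns (word k α) = truncWord k α ns :=
  (QuasiShuffle.basis k ℕ).constr_basis k (fun α => truncWord k α ns) α

theorem trunc_one (ns : List ℕ+) : trunc ns (word k []) = 1 := by
  rw [trunc_word, truncWord]

theorem trunc_nil_cons (a : ℕ) (u : QuasiShuffle k ℕ) : trunc [] (cons a u) = 0 := by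
  have : (trunc []).comp (cons (k := k) a) = 0 :=
    hom_ext fun α => by rw [LinearMap.comp_apply, cons_word, trunc_word, truncWord]; rfl
  exact LinearMap.congr_fun this u

theorem trunc_cons_cons (n : ℕ+) (ns : List ℕ+) (a : ℕ) (u : QuasiShuffle k ℕ) :
    trunc (n :: ns) (cons a u) = trunc ns (cons a u) + MvPowerSeries.X n ^ a * trunc ns u := by
  have : (trunc (n :: ns)).comp (cons (k := k) a) = (trunc ns).comp (cons a)
      + (LinearMap.mulLeft k (MvPowerSeries.X n ^ a)).comp (trunc ns) :=
    hom_ext fun α => by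
      simp only [LinearMap.comp_apply, LinearMap.add_apply, LinearMap.mulLeft_apply, cons_word,
        trunc_word, truncWord]
  exact LinearMap.congr_fun this u

/-- Induction on the variables. A first variable used by the first factor only, the second only, or
both accounts for the three terms of the quasi-shuffle recursion; if neither uses it, the remaining
variables do the work. -/
theorem trunc_word_mul (ns : List ℕ+) (a b : List ℕ) :
    trunc ns (word k a * word k b) = trunc ns (word k a) * trunc ns (word k b) := by
  induction ns generalizing a b with
  | nil =>
    rcases a with _ | ⟨x, a⟩
    · rw [nil_mul, trunc_one, one_mul]
    rcases b with _ | ⟨y, b⟩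
    · rw [mul_comm, nil_mul, trunc_one, mul_one]
    rw [← cons_word, ← cons_word, cons_mul_cons']
    simp only [map_add, trunc_nil_cons]
    simp
  | cons n ns ih =>
    rcases a with _ | ⟨x, a⟩
    · rw [nil_mul, trunc_one, one_mul]
    rcases b with _ | ⟨y, b⟩
    · rw [mul_comm, nil_mul, trunc_one, mul_one]
    have e1 := ih (x :: a) (y :: b)
    have e2 := ih a (y :: b)
    have e3 := ih (x :: a) b
    have e4 := ih a b
    rw [← cons_word, ← cons_word] at *
    rw [cons_mul_cons', map_add, map_add] at e1
    rw [cons_mul_cons', map_add, map_add]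
    simp only [trunc_cons_cons, e2, e3, e4, pow_add]
    linear_combination e1

theorem trunc_mul (ns : List ℕ+) (u v : QuasiShuffle k ℕ) :
    trunc ns (u * v) = trunc ns u * trunc ns v :=
  map_mul (algHomOfWords (k := k) (trunc ns) (trunc_one ns) (trunc_word_mul ns)) u v

theorem truncWord_eq_sum (α : List ℕ) (ns : List ℕ+) :
    truncWord k α ns = ((ns.sublistsLen α.length).map
      fun l => MvPowerSeries.monomial (monomialExponent l α) (1 : k)).sum := by
  induction ns generalizing α with
  | nil =>
    rcases α with _ | ⟨a, α⟩
    · simp [truncWord]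
    · simp [truncWord]
  | cons n ns ih =>
    rcases α with _ | ⟨a, α⟩
    · simp [truncWord]
    rw [truncWord, ih, ih, List.length_cons, List.sublistsLen_succ_cons, List.map_append,
      List.sum_append, List.map_map, ← List.sum_map_mul_left, MvPowerSeries.X_pow_eq]
    congr 3
    funext l
    simp [MvPowerSeries.monomial_mul_monomial]

/-- The list `[1, …, N]`. -/
def firstIndices (N : ℕ) : List ℕ+ := (List.range N).map Nat.succPNat

@[simp] theorem length_firstIndices (N : ℕ) : (firstIndices N).length = N := by
  simp [firstIndices]

theorem mem_firstIndices {N : ℕ} {i : ℕ+} : i ∈ firstIndices N ↔ (i : ℕ) ≤ N := by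
  simp only [firstIndices, List.mem_map, List.mem_range]
  constructor
  · rintro ⟨a, ha, rfl⟩
    simpa using ha
  · intro h
    refine ⟨i.natPred, ?_, by simp⟩
    have := PNat.natPred_add_one i
    omega

theorem nodup_firstIndices (N : ℕ) : (firstIndices N).Nodup :=
  List.nodup_range.map Nat.succPNat_injective

/-- The largest index of a variable occurring in `x^d`, or `0`. -/
def maxIndex (d : ℕ+ →₀ ℕ) : ℕ := d.support.sup fun i => (i : ℕ)

theorem maxIndex_le_iff {d : ℕ+ →₀ ℕ} {N : ℕ} :
    maxIndex d ≤ N ↔ ∀ i : ℕ+, d i ≠ 0 → (i : ℕ) ≤ N := by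
  simp [maxIndex]

theorem maxIndex_mono {d d' : ℕ+ →₀ ℕ} (h : d ≤ d') : maxIndex d ≤ maxIndex d' :=
  maxIndex_le_iff.2 fun i hi => maxIndex_le_iff.1 le_rfl i fun h0 =>
    hi (Nat.le_zero.1 (h0 ▸ h i))

theorem monomialExponent_apply_of_notMem {l : List ℕ+} {i : ℕ+} (hi : i ∉ l) (α : List ℕ) :
    monomialExponent l α i = 0 := by
  induction l generalizing α with
  | nil => simp
  | cons j l ih =>
    rcases α with _ | ⟨a, α⟩
    · simp
    simp only [List.mem_cons, not_or] at hi
    rw [monomialExponent_cons, Finsupp.add_apply, Finsupp.single_eq_of_ne hi.1, ih hi.2, add_zero]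

theorem monomialExponent_injective {l : List ℕ+} (hl : l.Nodup) {α β : List ℕ}
    (hα : α.length = l.length) (hβ : β.length = l.length)
    (h : monomialExponent l α = monomialExponent l β) : α = β := by
  induction l generalizing α β with
  | nil => rw [List.length_eq_zero_iff.1 hα, List.length_eq_zero_iff.1 hβ]
  | cons i l ih =>
    rcases α with _ | ⟨a, α⟩
    · simp at hα
    rcases β with _ | ⟨b, β⟩
    · simp at hβ
    have hi := (List.nodup_cons.1 hl).1
    rw [monomialExponent_cons, monomialExponent_cons] at h
    have h1 := DFunLike.congr_fun h i
    simp only [Finsupp.add_apply, Finsupp.single_eq_same, monomialExponent_apply_of_notMem hi,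
      add_zero] at h1
    subst h1
    rw [ih (List.nodup_cons.1 hl).2 (by simpa using hα) (by simpa using hβ) (add_left_cancel h)]

/-- The coefficient of the leading monomial of `α` separates `α` from all words that are not
shorter. -/
theorem coeff_truncWord_leading {α β : List ℕ} (h : α.length ≤ β.length) :
    MvPowerSeries.coeff (monomialExponent (firstIndices α.length) α)
      (truncWord k β (firstIndices α.length)) = if β = α then 1 else 0 := by
  rw [truncWord_eq_sum]
  rcases h.lt_or_eq with h | h
  · rw [List.sublistsLen_of_length_lt (by simpa using h), if_neg (by rintro rfl; omega)]
    simp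
  · have : (firstIndices α.length).sublistsLen β.length = [firstIndices α.length] := by
      rw [← h]
      have := List.sublistsLen_length (firstIndices α.length)
      rwa [length_firstIndices] at this
    rw [this]
    classical
    simp only [List.map_cons, List.map_nil, List.sum_cons, List.sum_nil, add_zero,
      MvPowerSeries.coeff_monomial]
    refine if_congr ⟨fun h' => ?_, fun h' => by rw [h']⟩ rfl rfl
    exact (monomialExponent_injective (nodup_firstIndices _) (by simp) (by simp [h]) h').symm

/-- Triangularity by length. In exactly n variables a word longer than n contributes nothing, and a
word of length n contributes the single monomial with its letters as exponents. Shorter words are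
already excluded by induction. -/
theorem eq_zero_of_coeff_trunc {x : QuasiShuffle k ℕ}
    (h : ∀ d N, maxIndex d ≤ N → MvPowerSeries.coeff d (trunc (firstIndices N) x) = 0) :
    x = 0 := by
  refine (QuasiShuffle.basis k ℕ).repr.map_eq_zero_iff.1 (Finsupp.ext fun α => ?_)
  induction hn : α.length using Nat.strong_induction_on generalizing α with
  | _ n ih =>
  subst hn
  have h1 := h (monomialExponent (firstIndices α.length) α) α.length
    (maxIndex_le_iff.2 fun i hi => mem_firstIndices.1 (by
      by_contra hc
      exact hi (monomialExponent_apply_of_notMem hc α)))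
  rw [← (QuasiShuffle.basis k ℕ).linearCombination_repr x, Finsupp.linearCombination_apply,
    Finsupp.sum, map_sum, map_sum] at h1
  simp only [basis_apply, map_smul, trunc_word, smul_eq_mul] at h1
  rw [Finset.sum_eq_single α] at h1
  · rwa [coeff_truncWord_leading le_rfl, if_pos rfl, mul_one] at h1
  · intro β _ hβ
    rcases lt_or_ge β.length α.length with hlt | hge
    · rw [ih _ hlt β rfl]
      simp
    · rw [coeff_truncWord_leading hge, if_neg hβ, mul_zero]
  · intro hα
    rw [Finsupp.notMem_support_iff.1 hα, zero_mul]

end Truncation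

/-! ### From specialization at the nodes t = -N - 1/2 to the Hopf algebra statement -/

section Assembly

open QuasiShuffle

variable {k : Type*} [CommRing k] [Algebra ℚ k]

/-- The value of `t` for which `-(t + 1/2)`, the regularized number of variables, is `N`. -/
def node (k : Type*) [CommRing k] [Algebra ℚ k] (N : ℕ) : k := algebraMap ℚ k (-(N : ℚ) - 1 / 2)

theorem isUnit_node_sub (i j : ℕ) (h : i ≠ j) : IsUnit (node k i - node k j) := by
  rw [node, node, ← map_sub]
  refine IsUnit.map _ (isUnit_iff_ne_zero.2 ?_)
  have : (i : ℚ) ≠ j := by exact_mod_cast h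
  intro h'
  exact this (by linarith)

theorem eq_of_coeff_eval_node {P Q : Polynomial (MvPowerSeries ℕ+ k)}
    (h : ∀ d N, maxIndex d ≤ N → MvPowerSeries.coeff d (P.eval (MvPowerSeries.C (node k N)))
      = MvPowerSeries.coeff d (Q.eval (MvPowerSeries.C (node k N)))) : P = Q := by
  refine ext_coeffPoly fun d => sub_eq_zero.1 ?_
  rw [← map_sub]
  refine Polynomial.eq_zero_of_forall_eval_eq_zero (r := node k) (N₀ := maxIndex d)
    isUnit_node_sub fun N hN => ?_
  rw [← coeff_eval_C, Polynomial.eval_sub, map_sub, h d N hN, sub_self]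

variable {M : List ℕ → Polynomial (MvPowerSeries ℕ+ k)}

/-- The restriction to monomials in x₁, …, x_N is essential: beyond them the truncation vanishes
while the specialized function need not, as the composition (1) and the monomial x_{N+1} show. -/
theorem coeff_eval_constr
    (hM : ∀ α d N, maxIndex d ≤ N → MvPowerSeries.coeff d
      ((M α).eval (MvPowerSeries.C (node k N)))
        = MvPowerSeries.coeff d (truncWord k α (firstIndices N)))
    (u : QuasiShuffle k ℕ) {d : ℕ+ →₀ ℕ} {N : ℕ} (hd : maxIndex d ≤ N) :
    MvPowerSeries.coeff d (((QuasiShuffle.basis k ℕ).constr k M u).eval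
      (MvPowerSeries.C (node k N))) = MvPowerSeries.coeff d (trunc (firstIndices N) u) := by
  induction u using QuasiShuffle.ind with
  | zero => simp
  | add u v hu hv => simp only [map_add, Polynomial.eval_add, hu, hv]
  | smul r a =>
    rw [map_smul, map_smul, Polynomial.eval_smul, map_smul, map_smul, trunc_word, ← basis_apply,
      Module.Basis.constr_basis, hM a d N hd]

/-- Both sides specialize to the same product of polynomials in N variables. The coefficient of x^d
in a product only involves divisors of x^d, whose largest index is again at most N. -/
theorem constr_mul
    (hM : ∀ α d N, maxIndex d ≤ N → MvPowerSeries.coeff d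
      ((M α).eval (MvPowerSeries.C (node k N)))
        = MvPowerSeries.coeff d (truncWord k α (firstIndices N)))
    (u v : QuasiShuffle k ℕ) :
    (QuasiShuffle.basis k ℕ).constr k M (u * v)
      = (QuasiShuffle.basis k ℕ).constr k M u * (QuasiShuffle.basis k ℕ).constr k M v := by
  classical
  refine eq_of_coeff_eval_node fun d N hN => ?_
  rw [coeff_eval_constr hM _ hN, trunc_mul, Polynomial.eval_mul, MvPowerSeries.coeff_mul,
    MvPowerSeries.coeff_mul]
  refine Finset.sum_congr rfl fun p hp => ?_
  have hp' := Finset.HasAntidiagonal.mem_antidiagonal.1 hp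
  rw [coeff_eval_constr hM, coeff_eval_constr hM]
  · exact (maxIndex_mono (hp' ▸ le_add_self)).trans hN
  · exact (maxIndex_mono (hp' ▸ le_self_add)).trans hN

theorem constr_injective
    (hM : ∀ α d N, maxIndex d ≤ N → MvPowerSeries.coeff d
      ((M α).eval (MvPowerSeries.C (node k N)))
        = MvPowerSeries.coeff d (truncWord k α (firstIndices N))) :
    Function.Injective ((QuasiShuffle.basis k ℕ).constr k M) := by
  refine (injective_iff_map_eq_zero _).2 fun u hu => eq_zero_of_coeff_trunc fun d N hN => ?_
  rw [← coeff_eval_constr hM u hN, hu]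
  simp

/-- The Hopf algebra statement, for a family of functions `M α` that specializes to the
quasisymmetric polynomials in `N` variables and extends the monomial quasisymmetric functions. -/
theorem hopf_of_specialization
    (hM : ∀ α d N, maxIndex d ≤ N → MvPowerSeries.coeff d
      ((M α).eval (MvPowerSeries.C (node k N)))
        = MvPowerSeries.coeff d (truncWord k α (firstIndices N)))
    (hQ : ∀ α : List ℕ+, M (α.map fun n : ℕ+ => (n : ℕ)) = Polynomial.C (monomialQSym k α)) :
    ∃ (R : Subalgebra k (Polynomial (MvPowerSeries ℕ+ k)))
      (Q : Subalgebra k (MvPowerSeries ℕ+ k))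
      (f : QuasiShuffle k ℕ ≃ₐ[k] R) (g : QuasiShuffle k ℕ+ ≃ₐ[k] Q),
      Subalgebra.toSubmodule R = Submodule.span k (Set.range M) ∧
      Subalgebra.toSubmodule Q = QSym k ∧
      (∀ α : List ℕ, (f (QuasiShuffle.word k α) : Polynomial (MvPowerSeries ℕ+ k)) = M α) ∧
      (∀ α : List ℕ+,
        (g (QuasiShuffle.word k α) : MvPowerSeries ℕ+ k) = monomialQSym k α) ∧
      letI := transportHopfAlgebra (k := k) (H := QuasiShuffle k ℕ) (B := R) f
      letI := transportHopfAlgebra (k := k) (H := QuasiShuffle k ℕ+) (B := Q) g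
      (∃ ι : Q → R,
        (∀ q : Q, (ι q : Polynomial (MvPowerSeries ℕ+ k))
          = Polynomial.C (q : MvPowerSeries ℕ+ k)) ∧
        IsHopfHom k ι) ∧
      IsHopfQuotient k R Q := by
  let F := (QuasiShuffle.basis k ℕ).constr k M
  have hF : ∀ α, F (word k α) = M α := fun α => (QuasiShuffle.basis k ℕ).constr_basis k M α
  have hF1 : F (word k []) = 1 := by
    rw [hF]
    refine eq_of_coeff_eval_node fun d N hN => ?_
    rw [hM _ _ _ hN, truncWord, Polynomial.eval_one]
  let f₀ := algHomOfWords F hF1 fun a b => constr_mul hM _ _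
  have hf₀ : ∀ u, f₀ u = F u := fun u => rfl
  have hfi : Function.Injective f₀ := constr_injective hM
  let G := (QuasiShuffle.basis k ℕ+).constr k (monomialQSym k)
  have hG : ∀ α, G (word k α) = monomialQSym k α := fun α =>
    (QuasiShuffle.basis k ℕ+).constr_basis k (monomialQSym k) α
  have hGF : ∀ u, Polynomial.C (G u) = f₀ (inclHom u) := by
    intro u
    induction u using QuasiShuffle.ind with
    | zero => simp
    | add u v hu hv => simp only [map_add, hu, hv]
    | smul r a =>
      rw [map_smul G, ← Polynomial.smul_C, map_smul inclHom, map_smul, inclHom_word, hf₀, hF, hQ,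
        hG]
  have hCi : Function.Injective (Polynomial.C : MvPowerSeries ℕ+ k →+* _) :=
    Polynomial.C_injective
  let g₀ := algHomOfWords G
    (hCi (by rw [hGF, map_one, ← one_def, map_one, map_one]))
    (fun a b => hCi (by rw [Polynomial.C_mul, hGF, hGF, hGF, map_mul, map_mul]))
  have hg₀ : ∀ u, g₀ u = G u := fun u => rfl
  have hgi : Function.Injective g₀ := by
    intro u v huv
    have h1 : inclHom u = inclHom v := hfi (by rw [← hGF, ← hGF, ← hg₀, ← hg₀, huv])
    -- Injectivity for QSym is inherited from RenQSym, since QS(ℙ) → QS(ℕ) has a left inverse.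
    rw [← dropZerosHom_inclHom u, h1, dropZerosHom_inclHom]
  let f := AlgEquiv.ofInjective f₀ hfi
  let g := AlgEquiv.ofInjective g₀ hgi
  have hf : ∀ u, (f u : Polynomial (MvPowerSeries ℕ+ k)) = f₀ u := fun u => rfl
  have hg : ∀ u, (g u : MvPowerSeries ℕ+ k) = g₀ u := fun u => rfl
  refine ⟨f₀.range, g₀.range, f, g, ?_, ?_, fun α => hF α, fun α => hG α,
    ⟨transportHom g f inclHom, ?_, ?_⟩, ?_⟩
  · exact (QuasiShuffle.basis k ℕ).constr_range k
  · exact (QuasiShuffle.basis k ℕ+).constr_range k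
  · intro q
    obtain ⟨u, rfl⟩ := g.surjective q
    rw [transportHom_apply, hf, hg, hg₀, hGF]
  · let := transportHopfAlgebra (k := k) (H := QuasiShuffle k ℕ) (B := f₀.range) f
    let := transportHopfAlgebra (k := k) (H := QuasiShuffle k ℕ+) (B := g₀.range) g
    exact isHopfHom_of_bialgHom _
  · exact isHopfQuotient_transport (k := k) (H := QuasiShuffle k ℕ) (K := QuasiShuffle k ℕ+)
      (B := f₀.range) (C := g₀.range) f g dropZerosHom inclHom dropZerosHom_inclHom

end Assembly

/-! ### Increasing index lists, cores and trailing zeros -/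

section IndexLists

/-- The increasing lists of `m` positive integers. -/
def increasingLists (m : ℕ) : Set (List ℕ+) := {l | l.Pairwise (· < ·) ∧ l.length = m}

/-- The increasing lists `i₁ < ⋯ < iₙ` with `x_{i₁}^{α₁} ⋯ x_{iₙ}^{αₙ} = x^d`. -/
def indexLists (α : List ℕ) (d : ℕ+ →₀ ℕ) : Set (List ℕ+) :=
  {l | l.Pairwise (· < ·) ∧ l.length = α.length ∧ monomialExponent l α = d}

theorem monomialExponent_ofFn {A : Type*} (p : A → ℕ) (w : List A) (I : Fin w.length → ℕ+) :
    monomialExponent (List.ofFn I) (w.map p) = ∑ j, Finsupp.single (I j) (p (w.get j)) := by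
  induction w with
  | nil => simp
  | cons a w ih =>
    rw [List.map_cons]
    change monomialExponent (List.ofFn (n := w.length + 1) I) _
      = ∑ j : Fin (w.length + 1), _
    rw [List.ofFn_succ, monomialExponent_cons, ih, Fin.sum_univ_succ]
    rfl

theorem pairwise_ofFn_lt_iff {n : ℕ} (I : Fin n → ℕ+) :
    (List.ofFn I).Pairwise (· < ·) ↔ StrictMono I := by
  rw [List.pairwise_ofFn]
  exact ⟨fun h i j hij => h hij, fun h i j hij => h hij⟩

/-- Index tuples and index lists are the same. -/
def indexTuplesEquiv {A : Type*} (p : A → ℕ) (w : List A) (d : ℕ+ →₀ ℕ) :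
    indexTuples (fun j => p (w.get j)) d ≃ indexLists (w.map p) d :=
  Equiv.ofBijective (fun I => ⟨List.ofFn I.1, (pairwise_ofFn_lt_iff I.1).2 I.2.1, by simp,
      (monomialExponent_ofFn p w I.1).trans I.2.2⟩) (by
    constructor
    · intro I J h
      exact Subtype.ext (List.ofFn_injective (congrArg Subtype.val h))
    · rintro ⟨l, hl, hlen, hd⟩
      rw [List.length_map] at hlen
      have hI : List.ofFn (fun j : Fin w.length => l.get (j.cast hlen.symm)) = l := by
        refine List.ext_get (by simp [hlen]) fun n h1 h2 => by simp
      refine ⟨⟨fun j => l.get (j.cast hlen.symm), (pairwise_ofFn_lt_iff _).1 (hI.symm ▸ hl), ?_⟩,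
        Subtype.ext hI⟩
      rw [← monomialExponent_ofFn, hI, hd])

theorem coe_indexTuplesEquiv {A : Type*} (p : A → ℕ) (w : List A) (d : ℕ+ →₀ ℕ)
    (I : indexTuples (fun j => p (w.get j)) d) :
    (indexTuplesEquiv p w d I : List ℕ+) = List.ofFn I.1 := rfl

theorem sublist_firstIndices {l : List ℕ+} (hl : l.Pairwise (· < ·)) {N : ℕ}
    (hN : ∀ i ∈ l, (i : ℕ) ≤ N) : l.Sublist (firstIndices N) := by
  have h2 : (firstIndices N).Pairwise (· < ·) := by
    rw [firstIndices, List.pairwise_map]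
    exact List.pairwise_lt_range.imp fun h => Nat.succPNat_strictMono h
  refine List.sublist_of_subperm_of_pairwise ?_ hl h2
  exact (List.subperm_of_subset (hl.imp ne_of_lt) fun i hi => mem_firstIndices.2 (hN i hi))

theorem pairwise_of_sublist_firstIndices {l : List ℕ+} {N : ℕ} (h : l.Sublist (firstIndices N)) :
    l.Pairwise (· < ·) := by
  refine List.Pairwise.sublist h ?_
  rw [firstIndices, List.pairwise_map]
  exact List.pairwise_lt_range.imp fun h => Nat.succPNat_strictMono h

theorem coe_sublistsLen_firstIndices (m N : ℕ) :
    {l | l ∈ (firstIndices N).sublistsLen m}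
      = {l | l ∈ increasingLists m ∧ ∀ i ∈ l, (i : ℕ) ≤ N} := by
  ext l
  simp only [Set.mem_ofPred_eq, List.mem_sublistsLen, increasingLists]
  constructor
  · rintro ⟨h1, h2⟩
    exact ⟨⟨pairwise_of_sublist_firstIndices h1, h2⟩,
      fun i hi => mem_firstIndices.1 (h1.subset hi)⟩
  · rintro ⟨⟨h1, h2⟩, h3⟩
    exact ⟨sublist_firstIndices h1 h3, h2⟩

theorem ncard_increasingLists_le (m N : ℕ) :
    {l | l ∈ increasingLists m ∧ ∀ i ∈ l, (i : ℕ) ≤ N}.ncard = N.choose m := by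
  classical
  rw [← coe_sublistsLen_firstIndices, ← List.coe_toFinset, Set.ncard_coe_finset,
    List.toFinset_card_of_nodup (List.nodup_sublistsLen m (nodup_firstIndices N)),
    List.length_sublistsLen, length_firstIndices]

theorem coeff_truncWord {k : Type*} [CommRing k] (α : List ℕ) (N : ℕ) (d : ℕ+ →₀ ℕ) :
    MvPowerSeries.coeff d (truncWord k α (firstIndices N))
      = ({l | l ∈ indexLists α d ∧ ∀ i ∈ l, (i : ℕ) ≤ N}.ncard : k) := by
  classical
  have hset : {l | l ∈ indexLists α d ∧ ∀ i ∈ l, (i : ℕ) ≤ N}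
      = (((firstIndices N).sublistsLen α.length).toFinset.filter
        fun l => monomialExponent l α = d : Finset (List ℕ+)) := by
    have h := coe_sublistsLen_firstIndices α.length N
    ext l
    have h' := Set.ext_iff.1 h l
    simp only [Set.mem_ofPred_eq, increasingLists] at h'
    simp only [Set.mem_ofPred_eq, indexLists, Finset.coe_filter, List.mem_toFinset, h']
    tauto
  rw [hset, Set.ncard_coe_finset, truncWord_eq_sum,
    ← List.sum_toFinset _ (List.nodup_sublistsLen _ (nodup_firstIndices N)), map_sum,
    Finset.card_filter, Nat.cast_sum]
  refine Finset.sum_congr rfl fun l _ => ?_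
  rw [MvPowerSeries.coeff_monomial, Nat.cast_ite, Nat.cast_one, Nat.cast_zero]
  exact if_congr eq_comm rfl rfl

/-- Words that are empty or end in a non-zero letter. -/
def IsCore (u : List ℕ) : Prop := ∀ a ∈ u.getLast?, a ≠ 0

theorem isCore_nil : IsCore [] := by simp [IsCore]

theorem exists_core (α : List ℕ) : ∃ u m, IsCore u ∧ α = u ++ List.replicate m 0 := by
  induction α using List.reverseRecOn with
  | nil => exact ⟨[], 0, isCore_nil, rfl⟩
  | append_singleton α a ih =>
    obtain ⟨u, m, hu, rfl⟩ := ih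
    rcases eq_or_ne a 0 with rfl | ha
    · exact ⟨u, m + 1, hu, by rw [List.replicate_succ', List.append_assoc]⟩
    · exact ⟨u ++ List.replicate m 0 ++ [a], 0, by simpa [IsCore] using ha, by simp⟩

theorem isCore_map_coe (α : List ℕ+) : IsCore (α.map fun n : ℕ+ => (n : ℕ)) := by
  intro a ha
  rw [List.getLast?_map, Option.mem_def, Option.map_eq_some_iff] at ha
  obtain ⟨n, _, rfl⟩ := ha
  exact n.ne_zero

/-- The last letter of a nonempty core is nonzero, so the last and largest index really occurs in
x^d. This bounds the list and makes the number of index lists of a core finite. -/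
theorem le_maxIndex_of_mem {u : List ℕ} (hu : IsCore u) {d : ℕ+ →₀ ℕ} {l : List ℕ+}
    (hl : l ∈ indexLists u d) : ∀ i ∈ l, (i : ℕ) ≤ maxIndex d := by
  obtain ⟨h1, h2, rfl⟩ := hl
  induction l generalizing u with
  | nil => simp
  | cons i l ih =>
    rcases u with _ | ⟨a, u⟩
    · simp at h2
    rcases u with _ | ⟨b, u⟩
    · have : l = [] := by simpa using h2
      subst this
      have ha : a ≠ 0 := hu a (by simp)
      intro j hj
      rw [List.mem_singleton] at hj
      subst hj
      exact maxIndex_le_iff.1 le_rfl j (by simpa using ha)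
    · have hu' : IsCore (b :: u) := by
        intro c hc
        exact hu c (by simpa [List.getLast?_cons_cons] using hc)
      have h1' := List.pairwise_cons.1 h1
      have ih' := ih hu' h1'.2 (by simpa using h2)
      have hle : maxIndex (monomialExponent l (b :: u))
          ≤ maxIndex (monomialExponent (i :: l) (a :: b :: u)) := by
        rw [monomialExponent_cons i]
        exact maxIndex_mono le_add_self
      rcases l with _ | ⟨j, l⟩
      · simp at h2
      intro i' hi'
      rcases List.mem_cons.1 hi' with rfl | hi'
      · have := h1'.1 j (by simp)
        exact (PNat.coe_lt_coe _ _).2 this |>.le.trans ((ih' j (by simp)).trans hle)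
      · exact (ih' i' hi').trans hle

theorem finite_indexLists {u : List ℕ} (hu : IsCore u) (d : ℕ+ →₀ ℕ) :
    (indexLists u d).Finite := by
  refine ((firstIndices (maxIndex d)).sublists.finite_toSet).subset fun l hl => ?_
  exact List.mem_sublists.2 (sublist_firstIndices hl.1 (le_maxIndex_of_mem hu hl))

/-- Adding `L` to an index. -/
def shiftIndex (L : ℕ) (j : ℕ+) : ℕ+ := ⟨L + j, by have := j.pos; omega⟩

@[simp] theorem coe_shiftIndex (L : ℕ) (j : ℕ+) : (shiftIndex L j : ℕ) = L + j := rfl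

theorem shiftIndex_lt_iff {L : ℕ} {i j : ℕ+} : shiftIndex L i < shiftIndex L j ↔ i < j := by
  rw [← PNat.coe_lt_coe, ← PNat.coe_lt_coe, coe_shiftIndex, coe_shiftIndex, add_lt_add_iff_left]

theorem shiftIndex_injective (L : ℕ) : Function.Injective (shiftIndex L) := fun i j h => by
  have := congrArg PNat.val h
  exact PNat.eq (by simpa [shiftIndex] using this)

theorem mem_range_shiftIndex {L : ℕ} {j : ℕ+} (h : L < j) : j ∈ Set.range (shiftIndex L) :=
  ⟨Nat.toPNat (j - L) (by omega), PNat.eq (Nat.add_sub_cancel' h.le)⟩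

theorem pairwise_map_shiftIndex {L : ℕ} {l : List ℕ+} :
    (l.map (shiftIndex L)).Pairwise (· < ·) ↔ l.Pairwise (· < ·) := by
  rw [List.pairwise_map]
  simp only [shiftIndex_lt_iff]

theorem exists_map_shiftIndex {L : ℕ} {l : List ℕ+} (h : ∀ j ∈ l, L < (j : ℕ)) :
    ∃ l' : List ℕ+, l'.map (shiftIndex L) = l := by
  have : l ∈ Set.range (List.map (shiftIndex L)) := by
    rw [Set.range_list_map]
    exact fun j hj => mem_range_shiftIndex (h j hj)
  exact this

theorem monomialExponent_append {l l' : List ℕ+} {α β : List ℕ} (h : l.length = α.length) :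
    monomialExponent (l ++ l') (α ++ β) = monomialExponent l α + monomialExponent l' β := by
  rw [monomialExponent, List.zipWith_append h, List.sum_append]
  rfl

@[simp] theorem monomialExponent_replicate_zero (l : List ℕ+) (m : ℕ) :
    monomialExponent l (List.replicate m 0) = 0 := by
  induction m generalizing l with
  | zero => simp
  | succ m ih =>
    rcases l with _ | ⟨i, l⟩
    · simp
    · rw [List.replicate_succ, monomialExponent_cons, ih]
      simp

/-- Index lists of `u 0 ⋯ 0` consist of an index list of `u` and an arbitrary increasing list. -/
theorem bijOn_append {u : List ℕ} (hu : IsCore u) (m : ℕ) (d : ℕ+ →₀ ℕ) :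
    Set.BijOn (fun p : List ℕ+ × List ℕ+ => p.1 ++ p.2.map (shiftIndex (maxIndex d)))
      (indexLists u d ×ˢ increasingLists m) (indexLists (u ++ List.replicate m 0) d) := by
  refine ⟨?_, ?_, ?_⟩
  · rintro ⟨I, J⟩ ⟨hI, hJ⟩
    have hI' := hI
    obtain ⟨h1, h2, h3⟩ := hI'
    obtain ⟨h4, h5⟩ := hJ
    refine ⟨List.pairwise_append.2 ⟨h1, pairwise_map_shiftIndex.2 h4, ?_⟩, ?_, ?_⟩
    · intro i hi j hj
      obtain ⟨j, _, rfl⟩ := List.mem_map.1 hj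
      have := le_maxIndex_of_mem hu hI i hi
      have hj := j.pos
      rw [← PNat.coe_lt_coe, coe_shiftIndex]
      omega
    · simp only at h2 h5
      simp [h2, h5]
    · simp only at h2 h3
      rw [monomialExponent_append h2, h3]
      simp
  · rintro ⟨I, J⟩ ⟨hI, _⟩ ⟨I', J'⟩ ⟨hI', _⟩ h
    obtain ⟨e1, e2⟩ := List.append_inj h (hI.2.1.trans hI'.2.1.symm)
    exact Prod.ext e1 ((shiftIndex_injective _).list_map e2)
  · rintro l ⟨h1, h2, h3⟩
    rw [List.length_append, List.length_replicate] at h2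
    obtain ⟨I, l', rfl, hI⟩ : ∃ I l', l = I ++ l' ∧ I.length = u.length :=
      ⟨l.take u.length, l.drop u.length, (List.take_append_drop _ _).symm, by simp; omega⟩
    rw [monomialExponent_append hI, monomialExponent_replicate_zero, add_zero] at h3
    obtain ⟨p1, p2, p3⟩ := List.pairwise_append.1 h1
    have hlt : ∀ j ∈ l', maxIndex d < (j : ℕ) := by
      intro j hj
      -- Every variable of x^d has its index in I, hence before j. Bounding by j - 1 also covers d =
      -- 0, where `maxIndex d` is 0.
      have hle : maxIndex d ≤ (j : ℕ) - 1 := by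
        refine maxIndex_le_iff.2 fun i hi => ?_
        have hiI : i ∈ I := by
          by_contra hc
          exact hi (h3 ▸ monomialExponent_apply_of_notMem hc u)
        have := (PNat.coe_lt_coe _ _).2 (p3 i hiI j hj)
        omega
      have := j.pos
      omega
    obtain ⟨J, rfl⟩ := exists_map_shiftIndex hlt
    refine ⟨(I, J), ⟨⟨p1, hI, h3⟩, pairwise_map_shiftIndex.1 p2, ?_⟩, rfl⟩
    rw [List.length_append, List.length_map] at h2
    simp only
    omega

theorem increasingLists_zero : increasingLists 0 = {[]} := by
  ext l
  simp only [increasingLists, Set.mem_ofPred_eq, Set.mem_singleton_iff, List.length_eq_zero_iff]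
  constructor
  · exact fun h => h.2
  · rintro rfl
    exact ⟨List.Pairwise.nil, rfl⟩

/-- Recording the later indices relative to the first one, i, makes the index sum equal to (m + 1) i
plus the sum of the shifted list, so sums over increasing lists become products of geometric series.
-/
theorem bijOn_cons (m : ℕ) :
    Set.BijOn (fun p : ℕ+ × List ℕ+ => p.1 :: p.2.map (shiftIndex p.1))
      (Set.univ ×ˢ increasingLists m) (increasingLists (m + 1)) := by
  refine ⟨?_, ?_, ?_⟩
  · rintro ⟨i, J⟩ ⟨-, h4, h5⟩
    refine ⟨List.pairwise_cons.2 ⟨?_, pairwise_map_shiftIndex.2 h4⟩, ?_⟩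
    · intro j hj
      obtain ⟨j, _, rfl⟩ := List.mem_map.1 hj
      have hj := j.pos
      rw [← PNat.coe_lt_coe, coe_shiftIndex]
      omega
    · simp only at h5
      simp [h5]
  · rintro ⟨i, J⟩ _ ⟨i', J'⟩ _ h
    obtain ⟨e1, e2⟩ := List.cons_eq_cons.1 h
    simp only at e1 e2
    subst e1
    exact Prod.ext rfl ((shiftIndex_injective _).list_map e2)
  · rintro l ⟨h1, h2⟩
    rcases l with _ | ⟨i, l'⟩
    · simp at h2
    obtain ⟨p1, p2⟩ := List.pairwise_cons.1 h1
    obtain ⟨J, rfl⟩ := exists_map_shiftIndex (L := i) fun j hj => (PNat.coe_lt_coe _ _).2 (p1 j hj)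
    exact ⟨(i, J), ⟨trivial, pairwise_map_shiftIndex.1 p2, by simpa using h2⟩, rfl⟩

/-- Once the core has been placed, the trailing zeros choose m of the N - `maxIndex d` indices that
remain. -/
theorem coeff_truncWord_core {k : Type*} [CommRing k] {u : List ℕ} (hu : IsCore u) (m : ℕ)
    {N : ℕ} {d : ℕ+ →₀ ℕ} (hN : maxIndex d ≤ N) :
    MvPowerSeries.coeff d (truncWord k (u ++ List.replicate m 0) (firstIndices N))
      = ((indexLists u d).ncard : k) * ((N - maxIndex d).choose m : k) := by
  rw [coeff_truncWord, ← Nat.cast_mul, ← ncard_increasingLists_le, ← Set.ncard_prod]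
  have hb := bijOn_append hu m d
  congr 1
  rw [← Set.InjOn.ncard_image (hb.injOn.mono (s₁ := indexLists u d ×ˢ
    {l | l ∈ increasingLists m ∧ ∀ i ∈ l, (i : ℕ) ≤ N - maxIndex d}) ?_)]
  · congr 1
    ext l
    constructor
    · rintro ⟨hl, hl'⟩
      obtain ⟨⟨I, J⟩, hp, rfl⟩ := hb.surjOn hl
      refine ⟨(I, J), ⟨hp.1, hp.2, fun j hj => ?_⟩, rfl⟩
      have := hl' (shiftIndex (maxIndex d) j) (List.mem_append_right _ (List.mem_map_of_mem hj))
      rw [coe_shiftIndex] at this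
      omega
    · rintro ⟨⟨I, J⟩, ⟨hI, hJ, hJ'⟩, rfl⟩
      refine ⟨hb.mapsTo (Set.mk_mem_prod hI hJ), fun i hi => ?_⟩
      rcases List.mem_append.1 hi with hi | hi
      · exact (le_maxIndex_of_mem hu hI i hi).trans hN
      · obtain ⟨j, hj, rfl⟩ := List.mem_map.1 hi
        have := hJ' j hj
        rw [coe_shiftIndex]
        omega
  · exact Set.prod_mono le_rfl fun l hl => hl.1

end IndexLists

/-! ### Binomial polynomials and the series (1 + X)^s -/

section Binomial

variable {R R' : Type*} [CommRing R] [CommRing R'] [Algebra ℚ R] [Algebra ℚ R']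

/-- The binomial polynomial `s (s - 1) ⋯ (s - m + 1) / m!`. -/
def binomial : ℕ → R → R
  | 0, _ => 1
  | m + 1, s => algebraMap ℚ R (1 / (m + 1)) * ((s - m) * binomial m s)

theorem map_binomial (f : R →+* R') (m : ℕ) (s : R) : f (binomial m s) = binomial m (f s) := by
  induction m with
  | zero => simp [binomial]
  | succ m ih =>
    rw [binomial, binomial, map_mul, map_mul, map_sub, map_natCast, ih]
    congr 1
    exact congrFun (congrArg DFunLike.coe (RingHom.ext_rat (f.comp (algebraMap ℚ R))
      (algebraMap ℚ R'))) _

theorem algebraMap_inv_succ_mul (n : ℕ) : (n + 1 : R) * algebraMap ℚ R (1 / (n + 1)) = 1 := by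
  have : (n + 1 : R) = algebraMap ℚ R (n + 1) := by simp
  rw [this, ← map_mul, mul_one_div_cancel (by positivity), map_one]

theorem succ_mul_binomial (m : ℕ) (s : R) :
    (m + 1 : R) * binomial (m + 1) s = (s - m) * binomial m s := by
  rw [binomial, ← mul_assoc, algebraMap_inv_succ_mul, one_mul]

theorem succ_mul_cancel {n : ℕ} {a b : R} (h : (n + 1 : R) * a = (n + 1 : R) * b) : a = b := by
  have := congrArg (algebraMap ℚ R (1 / (n + 1)) * ·) h
  simpa only [← mul_assoc, mul_comm (algebraMap ℚ R _) (n + 1 : R), algebraMap_inv_succ_mul,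
    one_mul] using this

theorem binomial_natCast (N m : ℕ) : binomial m (N : R) = (N.choose m : R) := by
  induction m with
  | zero => simp [binomial]
  | succ m ih =>
    refine succ_mul_cancel (n := m) ?_
    rw [succ_mul_binomial, ih]
    have h := congrArg (Nat.cast : ℕ → R) (Nat.choose_succ_right_eq N m)
    push_cast at h
    rcases le_or_gt m N with hm | hm
    · rw [Nat.cast_sub hm] at h
      linear_combination -h
    · rw [Nat.choose_eq_zero_of_lt hm, Nat.choose_eq_zero_of_lt (by omega)]
      simp

open PowerSeries

/-- The binomial series `∑ binomial m s X^m = (1 + X)^s`. -/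
def binomialPowerSeries (s : R) : PowerSeries R := PowerSeries.mk fun m => binomial m s

theorem one_add_X_mul_derivative_binomialPowerSeries (s : R) :
    (1 + X) * d⁄dX R (binomialPowerSeries s) = PowerSeries.C s * binomialPowerSeries s := by
  ext n
  rw [add_mul, one_mul, map_add, coeff_C_mul, coeff_derivative, binomialPowerSeries, coeff_mk,
    coeff_mk]
  rcases n with _ | n
  · rw [coeff_zero_X_mul]
    have := succ_mul_binomial 0 s
    push_cast at this ⊢
    linear_combination this
  · rw [coeff_succ_X_mul, coeff_derivative, coeff_mk]
    have := succ_mul_binomial (n + 1) s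
    push_cast at this ⊢
    linear_combination this

/-- The alternating geometric series `∑ (-1)^m X^m = 1 / (1 + X)`. -/
def alternating (R : Type*) [CommRing R] : PowerSeries R := PowerSeries.mk fun m => (-1) ^ m

theorem one_add_X_mul_alternating (R : Type*) [CommRing R] : (1 + X) * alternating R = 1 := by
  ext n
  rw [add_mul, one_mul, map_add, alternating, coeff_mk]
  rcases n with _ | n
  · simp
  · rw [coeff_succ_X_mul, coeff_mk, coeff_one, if_neg (by omega), pow_succ]
    ring

theorem derivative_binomialPowerSeries (s : R) :
    d⁄dX R (binomialPowerSeries s) = binomialPowerSeries s * (PowerSeries.C s * alternating R) := by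
  have h := one_add_X_mul_derivative_binomialPowerSeries s
  have h' := one_add_X_mul_alternating R
  linear_combination alternating R * h - d⁄dX R (binomialPowerSeries s) * h'

end Binomial

/-! ### Words of zeros: q-products, Newton's identities and counterterms -/

section Laurent

variable {R R' : Type*} [CommRing R] [CommRing R'] [Algebra ℚ R] [Algebra ℚ R']

open HahnSeries

/-- The series `e^{az}`. -/
def expSeries (a : R) : LaurentSeries R :=
  ofPowerSeries ℤ R (PowerSeries.rescale a (PowerSeries.exp R))

theorem expSeries_add (a b : R) : expSeries (a + b) = expSeries a * expSeries b := by
  rw [expSeries, expSeries, expSeries, ← map_mul, PowerSeries.exp_mul_exp_eq_exp_add]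

theorem expSeries_zero : expSeries (0 : R) = 1 := by
  simp [expSeries]

theorem expSeries_nsmul (n : ℕ) (a : R) : expSeries (n * a) = expSeries a ^ n := by
  induction n with
  | zero => simp [expSeries_zero]
  | succ n ih => rw [Nat.cast_succ, add_mul, one_mul, expSeries_add, ih, pow_succ]

/-- The Laurent expansion of `e^{cz} / (1 - e^{cz})`. -/
def geomSeries (R : Type*) [CommRing R] [Algebra ℚ R] (c : ℚ) : LaurentSeries R :=
  -(single (-1) (algebraMap ℚ R c⁻¹) * ofPowerSeries ℤ R (PowerSeries.rescale (algebraMap ℚ R c)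
    (bernoulli'PowerSeries R)))

theorem geomSeries_mul {c : ℚ} (hc : c ≠ 0) :
    geomSeries R c * (1 - expSeries (algebraMap ℚ R c)) = expSeries (algebraMap ℚ R c) := by
  have h := congrArg (fun f => ofPowerSeries ℤ R (PowerSeries.rescale (algebraMap ℚ R c) f))
    (bernoulli'PowerSeries_mul_exp_sub_one R)
  simp only [map_mul, map_sub, map_one, PowerSeries.rescale_X, ofPowerSeries_C,
    ofPowerSeries_X] at h
  have h1 : single (-1) (algebraMap ℚ R c⁻¹) * (C (algebraMap ℚ R c) * single (1 : ℤ) 1)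
      = (1 : LaurentSeries R) := by
    rw [C_apply, single_mul_single, single_mul_single, mul_one, ← map_mul, inv_mul_cancel₀ hc,
      map_one]
    rfl
  rw [geomSeries]
  simp only [expSeries] at *
  linear_combination single (-1) (algebraMap ℚ R c⁻¹) * h
    + ofPowerSeries ℤ R (PowerSeries.rescale (algebraMap ℚ R c) (PowerSeries.exp R)) * h1

theorem isUnit_expSeries (a : R) : IsUnit (expSeries a) :=
  IsUnit.of_mul_eq_one (expSeries (-a)) (by rw [← expSeries_add, add_neg_cancel, expSeries_zero])

theorem isUnit_one_sub_expSeries {c : ℚ} (hc : c ≠ 0) :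
    IsUnit (1 - expSeries (algebraMap ℚ R c)) :=
  isUnit_of_mul_isUnit_right ((geomSeries_mul (R := R) hc).symm ▸ isUnit_expSeries _)

/-- The regularization of the word `0^m`, with `t` replaced by `τ`, in the direction `δ`. -/
def zeroSeries (δ : ℚ) (τ : R) (m : ℕ) : LaurentSeries R :=
  expSeries (m * (algebraMap ℚ R δ * τ)) *
    ∏ j ∈ Finset.range m, geomSeries R ((j + 1 : ℕ) * δ)

theorem zeroSeries_zero (δ : ℚ) (τ : R) : zeroSeries δ τ 0 = 1 := by
  simp [zeroSeries, expSeries_zero]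

theorem expSeries_algebraMap_mul (n : ℕ) (δ : ℚ) :
    expSeries (algebraMap ℚ R (n * δ)) = expSeries (algebraMap ℚ R δ) ^ n := by
  rw [map_mul, map_natCast, expSeries_nsmul]

theorem succ_mul_ne_zero {δ : ℚ} (hδ : δ ≠ 0) (n : ℕ) : ((n + 1 : ℕ) : ℚ) * δ ≠ 0 :=
  mul_ne_zero (by positivity) hδ

theorem zeroSeries_succ {δ : ℚ} (hδ : δ ≠ 0) (τ : R) (m : ℕ) :
    zeroSeries δ τ (m + 1) * (1 - expSeries (algebraMap ℚ R δ) ^ (m + 1))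
      = expSeries (algebraMap ℚ R δ * τ) * expSeries (algebraMap ℚ R δ) ^ (m + 1)
        * zeroSeries δ τ m := by
  have h := geomSeries_mul (R := R) (succ_mul_ne_zero hδ m)
  rw [expSeries_algebraMap_mul] at h
  rw [zeroSeries, zeroSeries, Finset.prod_range_succ, Nat.cast_succ, add_mul, one_mul,
    expSeries_add]
  linear_combination expSeries (m * (algebraMap ℚ R δ * τ)) * expSeries (algebraMap ℚ R δ * τ)
    * (∏ j ∈ Finset.range m, geomSeries R ((j + 1 : ℕ) * δ)) * h

/-- The power sums `e^{nδτz} e^{nδz} / (1 - e^{nδz})` occurring in Newton's identities. -/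
def powerSumSeries (δ : ℚ) (τ : R) (n : ℕ) : LaurentSeries R :=
  expSeries (n * (algebraMap ℚ R δ * τ)) * geomSeries R (n * δ)

theorem powerSumSeries_succ {δ : ℚ} (hδ : δ ≠ 0) (τ : R) (n : ℕ) :
    powerSumSeries δ τ (n + 1) * (1 - expSeries (algebraMap ℚ R δ) ^ (n + 1))
      = (expSeries (algebraMap ℚ R δ * τ) * expSeries (algebraMap ℚ R δ)) ^ (n + 1) := by
  have h := geomSeries_mul (R := R) (succ_mul_ne_zero hδ n)
  rw [expSeries_algebraMap_mul] at h
  rw [powerSumSeries, mul_assoc, h, expSeries_nsmul, mul_pow]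

section Newton

open PowerSeries

/-- The generating series of the `zeroSeries`. -/
def zeroGen (δ : ℚ) (τ : R) : PowerSeries (LaurentSeries R) := PowerSeries.mk (zeroSeries δ τ)

/-- The generating series of the signed power sums. -/
def powerSumGen (δ : ℚ) (τ : R) : PowerSeries (LaurentSeries R) :=
  PowerSeries.mk fun n => (-1) ^ n * powerSumSeries δ τ (n + 1)

theorem derivative_rescale {S : Type*} [CommRing S] (q : S) (f : PowerSeries S) :
    d⁄dX S (rescale q f) = PowerSeries.C q * rescale q (d⁄dX S f) := by
  ext n
  simp only [coeff_derivative, coeff_C_mul, coeff_rescale]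
  ring

/-- With q = e^{δz} and Q = e^{δτz}, the generating series stands for the product over j ≥ 1 of 1 +
Q q^j X. Replacing X by qX removes the factor j = 1. -/
theorem zeroGen_eq {δ : ℚ} (hδ : δ ≠ 0) (τ : R) :
    zeroGen δ τ = (1 + PowerSeries.C (expSeries (algebraMap ℚ R δ * τ)
      * expSeries (algebraMap ℚ R δ)) * X)
      * rescale (expSeries (algebraMap ℚ R δ)) (zeroGen δ τ) := by
  ext1 n
  rw [add_mul, one_mul, map_add, mul_assoc, coeff_C_mul, coeff_rescale, zeroGen, coeff_mk]
  rcases n with _ | n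
  · simp
  · rw [coeff_succ_X_mul, coeff_rescale, coeff_mk]
    have := zeroSeries_succ hδ τ n
    linear_combination this

/-- The series stands for the sum over j ≥ 1 of Q q^j / (1 + Q q^j X), the logarithmic derivative of
the product; passing to q times its value at qX removes the term j = 1. -/
theorem powerSumGen_eq {δ : ℚ} (hδ : δ ≠ 0) (τ : R) :
    (1 + PowerSeries.C (expSeries (algebraMap ℚ R δ * τ) * expSeries (algebraMap ℚ R δ)) * X)
      * (powerSumGen δ τ - PowerSeries.C (expSeries (algebraMap ℚ R δ))
          * rescale (expSeries (algebraMap ℚ R δ)) (powerSumGen δ τ))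
      = PowerSeries.C (expSeries (algebraMap ℚ R δ * τ) * expSeries (algebraMap ℚ R δ)) := by
  set q := expSeries (algebraMap ℚ R δ)
  set Q := expSeries (algebraMap ℚ R δ * τ)
  have h : powerSumGen δ τ - PowerSeries.C q * rescale q (powerSumGen δ τ)
      = PowerSeries.mk fun n => (-1) ^ n * (Q * q) ^ (n + 1) := by
    ext1 n
    rw [map_sub, coeff_C_mul, coeff_rescale, powerSumGen, coeff_mk, coeff_mk]
    have := powerSumSeries_succ hδ τ n
    linear_combination (-1) ^ n * this
  rw [h]
  ext1 n
  rw [add_mul, one_mul, map_add, mul_assoc, coeff_C_mul, coeff_mk, PowerSeries.coeff_C]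
  rcases n with _ | n
  · simp
  · rw [coeff_succ_X_mul, coeff_mk, if_neg (by omega)]
    ring

/-- Newton's identities. -/
theorem derivative_zeroGen {δ : ℚ} (hδ : δ ≠ 0) (τ : R) :
    d⁄dX _ (zeroGen δ τ) = zeroGen δ τ * powerSumGen δ τ := by
  set q := expSeries (algebraMap ℚ R δ) with hq
  set Q := expSeries (algebraMap ℚ R δ * τ) with hQ
  have h1 := zeroGen_eq hδ τ
  have h2 := powerSumGen_eq hδ τ
  rw [← hq, ← hQ] at h1 h2
  set E := zeroGen δ τ
  set D := powerSumGen δ τ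
  have h3 := congrArg (d⁄dX (LaurentSeries R)) h1
  rw [Derivation.leibniz, map_add, Derivation.map_one_eq_zero, Derivation.leibniz, derivative_C,
    derivative_X,
    derivative_rescale, smul_eq_mul, smul_eq_mul, smul_eq_mul, smul_eq_mul, zero_add, mul_zero,
    add_zero, mul_one] at h3
  set W := d⁄dX (LaurentSeries R) E - E * D with hW
  -- The infinite product is avoided: the q-difference equations of E and D force the defect W = E'
  -- - E D to satisfy a homogeneous one.
  have h4 : W = (1 + PowerSeries.C (Q * q) * X) * (PowerSeries.C q * rescale q W) := by
    have h5 : rescale q W = rescale q (d⁄dX (LaurentSeries R) E) - rescale q E * rescale q D := by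
      rw [hW, map_sub, map_mul]
    rw [h5]
    linear_combination h3 - D * h1 + hW - rescale q E * h2
  have h6 : W = 0 := by
    ext1 n
    rw [map_zero]
    -- Comparing coefficients, (1 - q^{n+1}) W_n is a multiple of W_{n-1}, so invertibility of this
    -- factor gives W = 0 by induction.
    have hu : IsUnit (1 - q ^ (n + 1)) := by
      rw [hq, ← expSeries_algebraMap_mul]
      exact isUnit_one_sub_expSeries (succ_mul_ne_zero hδ n)
    have h7 := congrArg (PowerSeries.coeff n) h4
    rw [add_mul, one_mul, map_add, mul_assoc, coeff_C_mul, coeff_C_mul, coeff_rescale] at h7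
    induction n with
    | zero =>
      rw [coeff_zero_X_mul] at h7
      refine hu.mul_right_eq_zero.1 ?_
      linear_combination h7
    | succ n ih =>
      have hu' : IsUnit (1 - q ^ (n + 1)) := by
        rw [hq, ← expSeries_algebraMap_mul]
        exact isUnit_one_sub_expSeries (succ_mul_ne_zero hδ n)
      have h8 := congrArg (PowerSeries.coeff n) h4
      rw [add_mul, one_mul, map_add, mul_assoc, coeff_C_mul, coeff_C_mul, coeff_rescale] at h8
      rw [coeff_succ_X_mul, coeff_C_mul, coeff_rescale, ih hu' h8] at h7
      refine hu.mul_right_eq_zero.1 ?_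
      linear_combination h7
  exact sub_eq_zero.1 h6

/-- The solution `a` of `A' = A * B`, `A(0) = 1`, for `A = ∑ a_m X^m` and `B = ∑ b_m X^m`. -/
def logDerivSolution {S : Type*} [CommRing S] [Algebra ℚ S] (b : ℕ → S) : ℕ → S
  | 0 => 1
  | m + 1 => algebraMap ℚ S (1 / (m + 1)) *
      ∑ i : Fin (m + 1), logDerivSolution b i * b (m - i)

theorem map_logDerivSolution {S S' : Type*} [CommRing S] [Algebra ℚ S] [CommRing S'] [Algebra ℚ S']
    (f : S →+* S') (b : ℕ → S) (m : ℕ) :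
    f (logDerivSolution b m) = logDerivSolution (fun i => f (b i)) m := by
  induction m using Nat.strong_induction_on with
  | _ m ih =>
  rcases m with _ | m
  · rw [logDerivSolution, logDerivSolution, map_one]
  · rw [logDerivSolution, logDerivSolution, map_mul, map_sum]
    congr 1
    · exact congrFun (congrArg DFunLike.coe (RingHom.ext_rat (f.comp (algebraMap ℚ S))
        (algebraMap ℚ S'))) _
    · exact Finset.sum_congr rfl fun i _ => by rw [map_mul, ih i (by omega)]

theorem derivative_logDerivSolution {S : Type*} [CommRing S] [Algebra ℚ S] (b : ℕ → S) :
    d⁄dX S (PowerSeries.mk (logDerivSolution b))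
      = PowerSeries.mk (logDerivSolution b) * PowerSeries.mk b := by
  ext n
  rw [coeff_derivative, PowerSeries.coeff_mul, coeff_mk, logDerivSolution, mul_comm, ← mul_assoc,
    algebraMap_inv_succ_mul, one_mul, Finset.Nat.sum_antidiagonal_eq_sum_range_succ_mk,
    Finset.sum_range]
  simp only [coeff_mk]

/-- The counterterm of the word `0^m`. -/
def counterterm (R : Type*) [CommRing R] [Algebra ℚ R] (δ : ℚ) : ℕ → LaurentSeries R :=
  logDerivSolution fun n => (-1) ^ n * single (-1) (algebraMap ℚ R ((n + 1 : ℕ) * δ)⁻¹)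

theorem counterterm_zero (δ : ℚ) : counterterm R δ 0 = 1 := by
  rw [counterterm, logDerivSolution]

theorem algebraMap_rat_laurent (r : ℚ) :
    algebraMap ℚ (LaurentSeries R) r = HahnSeries.C (algebraMap ℚ R r) :=
  congrFun (congrArg DFunLike.coe (RingHom.ext_rat (algebraMap ℚ (LaurentSeries R))
    ((HahnSeries.C (Γ := ℤ)).comp (algebraMap ℚ R)))) r

theorem coeff_rat_mul (r : ℚ) (x : LaurentSeries R) (n : ℤ) :
    (algebraMap ℚ (LaurentSeries R) r * x).coeff n = algebraMap ℚ R r * x.coeff n := by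
  rw [algebraMap_rat_laurent, HahnSeries.C_apply, coeff_single_zero_mul]

/-- Each step of the recursion multiplies by a rational multiple of z⁻¹, so nothing regular can
appear for m ≥ 1. This is what lets these series be their own polar parts. -/
theorem coeff_counterterm (δ : ℚ) {m : ℕ} (hm : m ≠ 0) {n : ℤ} (hn : 0 ≤ n) :
    (counterterm R δ m).coeff n = 0 := by
  induction m using Nat.strong_induction_on generalizing n with
  | _ m ih =>
  obtain ⟨m, rfl⟩ := Nat.exists_eq_succ_of_ne_zero hm
  rw [counterterm, logDerivSolution, ← counterterm, coeff_rat_mul, coeff_sum, Finset.sum_eq_zero,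
    mul_zero]
  intro i _
  rw [mul_comm ((-1 : LaurentSeries R) ^ _), ← mul_assoc]
  have h : (counterterm R δ i * single (-1)
      (algebraMap ℚ R ((m - i + 1 : ℕ) * δ)⁻¹)).coeff n = 0 := by
    rw [coeff_mul_single]
    rcases eq_or_ne (i : ℕ) 0 with hi | hi
    · rw [hi, counterterm_zero, HahnSeries.coeff_one, if_neg (by omega), zero_mul]
    · rw [ih i (by omega) hi (by omega), zero_mul]
  rcases neg_one_pow_eq_or (LaurentSeries R) (m - i) with h' | h' <;> rw [h']
  · rw [mul_one, h]
  · rw [mul_neg, mul_one, coeff_neg, h, neg_zero]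

theorem exists_X_mul {R : Type*} [CommRing R] {f : PowerSeries R}
    (hf : PowerSeries.constantCoeff f = 0) :
    ∃ g, f = X * g ∧ PowerSeries.constantCoeff g = PowerSeries.coeff 1 f := by
  obtain ⟨g, rfl⟩ := X_dvd_iff.2 hf
  exact ⟨g, rfl, by rw [← zero_add 1, coeff_succ_X_mul, coeff_zero_eq_constantCoeff]⟩

/-- The regular part of the Newton power sums. -/
theorem exists_powerSumSeries_add {δ : ℚ} (hδ : δ ≠ 0) (τ : R) (n : ℕ) :
    ∃ f : PowerSeries R, ofPowerSeries ℤ R f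
      = powerSumSeries δ τ (n + 1) + single (-1) (algebraMap ℚ R ((n + 1 : ℕ) * δ)⁻¹)
      ∧ constantCoeff f = -(τ + algebraMap ℚ R (1 / 2)) := by
  have hc := succ_mul_ne_zero hδ n
  rw [powerSumSeries, geomSeries, expSeries, ← map_natCast (algebraMap ℚ R), ← mul_assoc, ← map_mul]
  set c := ((n + 1 : ℕ) : ℚ) * δ with hcdef
  -- The power sum is -(cz)⁻¹ e^{cτz} B(cz) with B(z) = z e^z / (e^z - 1), so adding its pole back
  -- leaves (cz)⁻¹ g, where g has no constant term.
  set g : PowerSeries R := 1 - rescale (algebraMap ℚ R c * τ) (PowerSeries.exp R)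
    * rescale (algebraMap ℚ R c) (bernoulli'PowerSeries R) with hg
  obtain ⟨h, hh, hh0⟩ := exists_X_mul (f := g) (by
    rw [hg, map_sub, map_mul, map_one, ← coeff_zero_eq_constantCoeff_apply,
      ← coeff_zero_eq_constantCoeff_apply, coeff_rescale, coeff_rescale, bernoulli'PowerSeries,
      coeff_mk, coeff_exp]
    simp)
  have hinv : algebraMap ℚ R c⁻¹ * algebraMap ℚ R c = 1 := by
    rw [← map_mul, inv_mul_cancel₀ hc, map_one]
  refine ⟨PowerSeries.C (algebraMap ℚ R c⁻¹) * h, ?_, ?_⟩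
  · have h1 : single (-1) (algebraMap ℚ R c⁻¹) * ofPowerSeries ℤ R g
        = ofPowerSeries ℤ R (PowerSeries.C (algebraMap ℚ R c⁻¹) * h) := by
      rw [hh, map_mul, map_mul, ofPowerSeries_X, ofPowerSeries_C, ← mul_assoc, single_mul_single,
        HahnSeries.C_apply, mul_one]
      rfl
    rw [← h1, hg, map_sub, map_one, map_mul]
    ring
  · have h2 : PowerSeries.coeff 1 g = -(algebraMap ℚ R c * τ + algebraMap ℚ R c *
        algebraMap ℚ R (1 / 2)) := by
      rw [hg, map_sub, PowerSeries.coeff_mul, Finset.Nat.antidiagonal_succ]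
      simp [coeff_rescale, bernoulli'PowerSeries, PowerSeries.coeff_one]
      ring
    rw [map_mul, hh0, h2, PowerSeries.constantCoeff_C]
    linear_combination -(τ + algebraMap ℚ R (1 / 2)) * hinv

/-- The renormalization of the word `0^m` is regular at `z = 0`, where its value is a binomial
polynomial in `-(t + 1/2)`. -/
theorem exists_renormalized_zero {δ : ℚ} (hδ : δ ≠ 0) (τ : R) (m : ℕ) :
    ∃ f : PowerSeries R, ofPowerSeries ℤ R f
      = ∑ p ∈ Finset.HasAntidiagonal.antidiagonal m, zeroSeries δ τ p.1 * counterterm R δ p.2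
      ∧ constantCoeff f = binomial m (-(τ + algebraMap ℚ R (1 / 2))) := by
  set σ := -(τ + algebraMap ℚ R (1 / 2)) with hσ
  set F := zeroGen δ τ * PowerSeries.mk (counterterm R δ) with hF
  have hcoeff : ∀ m, PowerSeries.coeff m F
      = ∑ p ∈ Finset.HasAntidiagonal.antidiagonal m, zeroSeries δ τ p.1 * counterterm R δ p.2 := by
    intro m
    rw [hF, PowerSeries.coeff_mul]
    simp only [zeroGen, coeff_mk]
  -- Logarithmic derivatives add, so each power sum meets exactly the term that cancels its pole; F
  -- is then regular coefficient by coefficient.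
  have hD : d⁄dX _ F = F * (powerSumGen δ τ + PowerSeries.mk fun n =>
      (-1) ^ n * single (-1) (algebraMap ℚ R ((n + 1 : ℕ) * δ)⁻¹)) := by
    rw [hF, Derivation.leibniz, derivative_zeroGen hδ, counterterm, derivative_logDerivSolution,
      smul_eq_mul, smul_eq_mul]
    ring
  rw [← hcoeff]
  clear_value F
  choose g hg hg0 using exists_powerSumSeries_add (R := R) hδ τ
  induction m using Nat.strong_induction_on with
  | _ m ih =>
  rcases m with _ | m
  · refine ⟨1, ?_, by simp [binomial]⟩
    rw [hcoeff]
    simp [zeroSeries_zero, counterterm_zero]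
  -- The bound is moved inside the existential, with default value 0, so that the regular series can
  -- be chosen for all i at once.
  have ih' : ∀ i, ∃ f : PowerSeries R, i ≤ m → ofPowerSeries ℤ R f = PowerSeries.coeff i F
      ∧ constantCoeff f = binomial i σ := by
    intro i
    by_cases hi : i ≤ m
    · obtain ⟨f, hf⟩ := ih i (by omega)
      exact ⟨f, fun _ => hf⟩
    · exact ⟨0, fun h => absurd h hi⟩
  choose f hf using ih'
  refine ⟨PowerSeries.C (algebraMap ℚ R (1 / (m + 1))) *
    ∑ p ∈ Finset.HasAntidiagonal.antidiagonal m, f p.1 * ((-1) ^ p.2 * g p.2), ?_, ?_⟩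
  · have h := congrArg (PowerSeries.coeff m) hD
    rw [coeff_derivative, PowerSeries.coeff_mul m] at h
    refine succ_mul_cancel (n := m) ?_
    rw [mul_comm _ (PowerSeries.coeff (m + 1) F), h, map_mul, ofPowerSeries_C,
      ← algebraMap_rat_laurent, ← mul_assoc, algebraMap_inv_succ_mul, one_mul, map_sum]
    refine Finset.sum_congr rfl fun p hp => ?_
    have hp' : p.1 ≤ m := by
      have := Finset.HasAntidiagonal.mem_antidiagonal.1 hp
      omega
    rw [map_mul, (hf p.1 hp').1, map_mul, hg, map_add, powerSumGen, coeff_mk, coeff_mk, map_pow,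
      map_neg, map_one]
    ring
  -- At z = 0 the logarithmic derivative becomes σ / (1 + X), so the values obey the recursion of (1
  -- + X)^σ.
  · have h := congrArg (PowerSeries.coeff m) (derivative_binomialPowerSeries σ)
    rw [coeff_derivative, PowerSeries.coeff_mul m, binomialPowerSeries, coeff_mk] at h
    refine succ_mul_cancel (n := m) ?_
    rw [mul_comm _ (binomial (m + 1) σ), h, map_mul, PowerSeries.constantCoeff_C, ← mul_assoc,
      algebraMap_inv_succ_mul, one_mul, map_sum]
    refine Finset.sum_congr rfl fun p hp => ?_
    have hp' : p.1 ≤ m := by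
      have := Finset.HasAntidiagonal.mem_antidiagonal.1 hp
      omega
    rw [map_mul, (hf p.1 hp').2, map_mul, hg0, coeff_mk, coeff_C_mul, alternating, coeff_mk,
      map_pow,
      map_neg, map_one]
    ring

end Newton

end Laurent

/-! ### Base change of Laurent series and polar parts -/

section LaurentMap

variable {R R' : Type*} [CommRing R] [CommRing R']

/-- The ring homomorphism of Laurent series induced by a ring homomorphism of the coefficients. -/
def laurentMap (f : R →+* R') : LaurentSeries R →+* LaurentSeries R' where
  toFun x := x.map f
  map_zero' := by ext; simp
  map_one' := by
    ext n
    simp only [HahnSeries.map_coeff, HahnSeries.coeff_one]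
    split <;> simp
  map_add' x y := by ext; simp
  map_mul' x y := by
    have h := HahnSeries.map_mul (f : R →ₙ+* R') (x := x) (y := y)
    exact h

@[simp] theorem coeff_laurentMap (f : R →+* R') (x : LaurentSeries R) (n : ℤ) :
    (laurentMap f x).coeff n = f (x.coeff n) := rfl

theorem laurentMap_single (f : R →+* R') (n : ℤ) (r : R) :
    laurentMap f (HahnSeries.single n r) = HahnSeries.single n (f r) := by
  ext m
  simp only [coeff_laurentMap, HahnSeries.coeff_single]
  split <;> simp

theorem laurentMap_ofPowerSeries (f : R →+* R') (p : PowerSeries R) :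
    laurentMap f (HahnSeries.ofPowerSeries ℤ R p)
      = HahnSeries.ofPowerSeries ℤ R' (PowerSeries.map f p) := by
  ext n
  rw [coeff_laurentMap, PowerSeries.coeff_coe, PowerSeries.coeff_coe]
  split <;> simp

theorem laurentMap_counterterm [Algebra ℚ R] [Algebra ℚ R'] (f : R →+* R') (δ : ℚ) (m : ℕ) :
    laurentMap f (counterterm R δ m) = counterterm R' δ m := by
  rw [counterterm, counterterm, map_logDerivSolution]
  congr 1
  funext i
  rw [map_mul, map_pow, map_neg, map_one, laurentMap_single]
  congr 2
  exact congrFun (congrArg DFunLike.coe (RingHom.ext_rat (f.comp (algebraMap ℚ R))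
    (algebraMap ℚ R'))) _

@[simp] theorem coeff_polarPart (f : LaurentSeries R) (n : ℤ) :
    (polarPart f).coeff n = if n < 0 then f.coeff n else 0 := rfl

theorem polarPart_laurentMap (f : R →+* R') (x : LaurentSeries R) :
    polarPart (laurentMap f x) = laurentMap f (polarPart x) := by
  ext n
  simp only [coeff_polarPart, coeff_laurentMap]
  split <;> simp

end LaurentMap

/-! ### Naturality of the Birkhoff factorization -/

section Birkhoff

variable {A B S S' : Type*} [CommRing S] [CommRing S']

/-- The sum to which the projection is applied in the Birkhoff factorization. -/
def birkhoffBar (φ : List A → LaurentSeries S) (a : List A) : LaurentSeries S :=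
  ∑ i ∈ Finset.range a.length, φ (a.take (i + 1)) * birkhoffMinus φ (a.drop (i + 1))

theorem birkhoffMinus_nil (φ : List A → LaurentSeries S) : birkhoffMinus φ [] = 1 := by
  rw [birkhoffMinus]

theorem birkhoffBar_cons (φ : List A → LaurentSeries S) (x : A) (a : List A) :
    birkhoffBar φ (x :: a) = φ (x :: a) + ∑ i : Fin a.length,
      φ ((x :: a).take (i + 1)) * birkhoffMinus φ ((x :: a).drop (i + 1)) := by
  rw [birkhoffBar, List.length_cons, Finset.sum_range_succ, Finset.sum_range, add_comm]
  congr 1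
  rw [List.take_of_length_le (by simp), List.drop_of_length_le (by simp), birkhoffMinus_nil,
    mul_one]

theorem birkhoffMinus_eq (φ : List A → LaurentSeries S) {a : List A} (ha : a ≠ []) :
    birkhoffMinus φ a = -polarPart (birkhoffBar φ a) := by
  obtain ⟨x, a, rfl⟩ := List.exists_cons_of_ne_nil ha
  rw [birkhoffMinus, birkhoffBar_cons]

theorem birkhoffPlus_eq (φ : List A → LaurentSeries S) {a : List A} (ha : a ≠ []) :
    birkhoffPlus φ a = birkhoffBar φ a - polarPart (birkhoffBar φ a) := by
  obtain ⟨x, a, rfl⟩ := List.exists_cons_of_ne_nil ha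
  rw [birkhoffPlus, birkhoffBar_cons]

theorem birkhoffMinus_map (φ : List B → LaurentSeries S) (g : A → B) (a : List A) :
    birkhoffMinus φ (a.map g) = birkhoffMinus (fun a => φ (a.map g)) a := by
  induction hn : a.length using Nat.strong_induction_on generalizing a with
  | _ n ih =>
  subst hn
  rcases eq_or_ne a [] with rfl | ha
  · simp [birkhoffMinus_nil]
  rw [birkhoffMinus_eq _ ha, birkhoffMinus_eq _ (by simpa using ha), birkhoffBar, birkhoffBar,
    List.length_map]
  congr 2
  refine Finset.sum_congr rfl fun i hi => ?_
  have := Finset.mem_range.1 hi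
  rw [← List.map_drop, ← List.map_take, ih _ (by rw [List.length_drop]; omega) _ rfl]

theorem birkhoffBar_map (φ : List B → LaurentSeries S) (g : A → B) (a : List A) :
    birkhoffBar φ (a.map g) = birkhoffBar (fun a => φ (a.map g)) a := by
  rw [birkhoffBar, birkhoffBar, List.length_map]
  refine Finset.sum_congr rfl fun i _ => ?_
  rw [← List.map_drop, ← List.map_take, birkhoffMinus_map]

theorem birkhoffPlus_map (φ : List B → LaurentSeries S) (g : A → B) (a : List A) :
    birkhoffPlus φ (a.map g) = birkhoffPlus (fun a => φ (a.map g)) a := by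
  rcases eq_or_ne a [] with rfl | ha
  · simp [birkhoffPlus]
  · rw [birkhoffPlus_eq _ ha, birkhoffPlus_eq _ (by simpa using ha), birkhoffBar_map]

theorem birkhoffMinus_laurentMap (φ : List A → LaurentSeries S) (h : S →+* S') (a : List A) :
    birkhoffMinus (fun a => laurentMap h (φ a)) a = laurentMap h (birkhoffMinus φ a) := by
  induction hn : a.length using Nat.strong_induction_on generalizing a with
  | _ n ih =>
  subst hn
  rcases eq_or_ne a [] with rfl | ha
  · simp [birkhoffMinus_nil]
  rw [birkhoffMinus_eq _ ha, birkhoffMinus_eq _ ha, birkhoffBar, birkhoffBar, map_neg,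
    ← polarPart_laurentMap, map_sum]
  congr 2
  refine Finset.sum_congr rfl fun i hi => ?_
  have := Finset.mem_range.1 hi
  rw [map_mul, ih _ (by rw [List.length_drop]; omega) _ rfl]

theorem birkhoffPlus_laurentMap (φ : List A → LaurentSeries S) (h : S →+* S') (a : List A) :
    birkhoffPlus (fun a => laurentMap h (φ a)) a = laurentMap h (birkhoffPlus φ a) := by
  rcases eq_or_ne a [] with rfl | ha
  · simp [birkhoffPlus]
  · have : birkhoffBar (fun a => laurentMap h (φ a)) a = laurentMap h (birkhoffBar φ a) := by
      rw [birkhoffBar, birkhoffBar, map_sum]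
      exact Finset.sum_congr rfl fun i _ => by rw [map_mul, birkhoffMinus_laurentMap]
    rw [birkhoffPlus_eq _ ha, birkhoffPlus_eq _ ha, this, polarPart_laurentMap, map_sub]

end Birkhoff

/-! ### Coefficientwise additive maps of Laurent series -/

section CoeffLaurent

variable {S T : Type*} [CommRing S] [CommRing T]

/-- Applying an additive map to every coefficient of a Laurent series. -/
def coeffLaurent (c : S →+ T) (x : LaurentSeries S) : LaurentSeries T := x.map c

@[simp] theorem coeff_coeffLaurent (c : S →+ T) (x : LaurentSeries S) (n : ℤ) :
    (coeffLaurent c x).coeff n = c (x.coeff n) := rfl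

theorem coeffLaurent_sum {ι : Type*} (c : S →+ T) (s : Finset ι) (f : ι → LaurentSeries S) :
    coeffLaurent c (∑ i ∈ s, f i) = ∑ i ∈ s, coeffLaurent c (f i) := by
  ext1
  funext n
  simp [HahnSeries.coeff_sum]

/-- Extracting the coefficient of x^d is not multiplicative, but it is linear over series free of X,
such as the counterterms. That suffices for treating the convolutions with counterterms one monomial
at a time. -/
theorem coeffLaurent_mul {c : S →+ T} {e : T →+* S} (hc : ∀ s t, c (s * e t) = c s * t)
    (x : LaurentSeries S) (y : LaurentSeries T) :
    coeffLaurent c (x * laurentMap e y) = coeffLaurent c x * y := by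
  ext1
  funext n
  rw [coeff_coeffLaurent, HahnSeries.coeff_mul_right' (s := y.support) y.isPWO_support,
    HahnSeries.coeff_mul_left' (s := x.support) x.isPWO_support, map_sum]
  · exact Finset.sum_congr rfl fun p _ => hc _ _
  · intro i hi h
    exact hi (by rw [coeff_coeffLaurent, h, map_zero])
  · intro i hi h
    exact hi (by rw [coeff_laurentMap, h, map_zero])

end CoeffLaurent

/-! ### The Birkhoff factorization of words with trailing zeros -/

section BirkhoffWords

theorem isCore_drop {u : List ℕ} (hu : IsCore u) (i : ℕ) : IsCore (u.drop i) := by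
  intro a ha
  rw [List.getLast?_drop] at ha
  split at ha
  · simp at ha
  · exact hu a ha

variable {S T : Type*} [CommRing S] [CommRing T] [Algebra ℚ S] [Algebra ℚ T]
  {c : (ℕ+ →₀ ℕ) → S →+ T} {e : T →+* S} {τ : T} {φ : List ℕ → LaurentSeries S} {δ : ℚ}

/-- Cuts leaving part of the core on the right contribute nothing, so only cuts among the zeros
survive. For an empty core the full convolution also contains the cut before the first letter,
absent from the Birkhoff sum; hence the subtracted term. -/
theorem birkhoffBar_core (h1 : φ [] = 1) {u : List ℕ} (hu : IsCore u) (m : ℕ)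
    (hminus : ∀ u' m', IsCore u' → u'.length + m' < u.length + m →
      birkhoffMinus φ (u' ++ List.replicate m' 0) = if u' = [] then counterterm S δ m' else 0) :
    birkhoffBar φ (u ++ List.replicate m 0)
      = ∑ p ∈ Finset.HasAntidiagonal.antidiagonal m,
          φ (u ++ List.replicate p.1 0) * counterterm S δ p.2
        - if u = [] then counterterm S δ m else 0 := by
  rw [Finset.Nat.sum_antidiagonal_eq_sum_range_succ_mk, birkhoffBar, List.length_append,
    List.length_replicate]
  rcases eq_or_ne u [] with rfl | hne
  · rw [Finset.sum_range_succ', if_pos rfl]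
    simp only [List.nil_append, List.length_nil, zero_add, List.replicate_zero, h1, one_mul,
      tsub_zero, add_sub_cancel_right] at hminus ⊢
    refine Finset.sum_congr rfl fun i hi => ?_
    have hi' := Finset.mem_range.1 hi
    have := hminus [] (m - (i + 1)) hu (by simp; omega)
    rw [List.nil_append, if_pos rfl] at this
    rw [List.take_replicate, List.drop_replicate, this, min_eq_left (by omega)]
  · obtain ⟨p, hp⟩ : ∃ p, u.length = p + 1 :=
      Nat.exists_eq_succ_of_ne_zero (by simpa using hne)
    rw [if_neg hne, sub_zero, show u.length + m = p + (m + 1) by omega, Finset.sum_range_add,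
      Finset.sum_eq_zero, zero_add]
    · refine Finset.sum_congr rfl fun j hj => ?_
      have hj' := Finset.mem_range.1 hj
      have := hminus [] (m - j) isCore_nil (by simp; omega)
      rw [List.nil_append, if_pos rfl] at this
      rw [show p + j + 1 = u.length + j by omega, List.take_append, List.drop_append,
        List.take_of_length_le (by omega), List.drop_of_length_le (by omega),
        Nat.add_sub_cancel_left,
        List.take_replicate, List.drop_replicate, List.nil_append, this, min_eq_left (by omega)]
    · intro i hi
      have hi' := Finset.mem_range.1 hi
      rw [List.drop_append_of_le_length (by omega),
        hminus _ m (isCore_drop hu _) (by rw [List.length_drop]; omega), if_neg, mul_zero]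
      rw [List.drop_eq_nil_iff]
      omega

/-- The form of the regularization of words, coefficient by coefficient: a factor that is regular at
`z = 0` times the regularization of the trailing zeros with `t` shifted. -/
def FactorsThroughZeros (c : (ℕ+ →₀ ℕ) → S →+ T) (τ : T) (δ : ℚ)
    (φ : List ℕ → LaurentSeries S) : Prop :=
  ∀ u, IsCore u → ∀ d, ∃ g : PowerSeries T,
    PowerSeries.constantCoeff g = ((indexLists u d).ncard : T) ∧
    ∀ m, coeffLaurent (c d) (φ (u ++ List.replicate m 0)) = HahnSeries.ofPowerSeries ℤ _ g *
      zeroSeries δ (τ + (maxIndex d : T)) m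

/-- The counterterms do not involve τ, so those of 0^m also cancel the poles of the regularization
shifted by `maxIndex d`, whatever d is. -/
theorem coeffLaurent_sum_counterterm (hc : ∀ d s t, c d (s * e t) = c d s * t) (hδ : δ ≠ 0)
    (hφ : FactorsThroughZeros c τ δ φ) {u : List ℕ}
    (hu : IsCore u) (m : ℕ) (d : ℕ+ →₀ ℕ) :
    ∃ f : PowerSeries T, HahnSeries.ofPowerSeries ℤ _ f
      = coeffLaurent (c d) (∑ p ∈ Finset.HasAntidiagonal.antidiagonal m,
          φ (u ++ List.replicate p.1 0) * counterterm S δ p.2)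
      ∧ PowerSeries.constantCoeff f = ((indexLists u d).ncard : T) *
        binomial m (-(τ + (maxIndex d : T)
          + algebraMap ℚ T (1 / 2))) := by
  obtain ⟨g, hg, hgφ⟩ := hφ u hu d
  obtain ⟨f, hf, hf0⟩ := exists_renormalized_zero hδ
    (τ + (maxIndex d : T)) m
  refine ⟨g * f, ?_, by rw [map_mul, hg, hf0]⟩
  rw [map_mul, hf, coeffLaurent_sum, Finset.mul_sum]
  refine Finset.sum_congr rfl fun p _ => ?_
  rw [← laurentMap_counterterm e, coeffLaurent_mul (hc d), hgφ, mul_assoc]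

theorem coeff_sum_counterterm_of_neg (hc : ∀ d s t, c d (s * e t) = c d s * t)
    (hinj : ∀ s, (∀ d, c d s = 0) → s = 0) (hδ : δ ≠ 0)
    (hφ : FactorsThroughZeros c τ δ φ) {u : List ℕ}
    (hu : IsCore u) (m : ℕ) {n : ℤ} (hn : n < 0) :
    (∑ p ∈ Finset.HasAntidiagonal.antidiagonal m,
          φ (u ++ List.replicate p.1 0) * counterterm S δ p.2).coeff n = 0 := by
  refine hinj _ fun d => ?_
  obtain ⟨f, hf, -⟩ := coeffLaurent_sum_counterterm hc hδ hφ hu m d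
  rw [← coeff_coeffLaurent, ← hf, PowerSeries.coeff_coe, if_pos hn]

/-- Induction on length. The convolution with the counterterms has no polar part, so only the
subtracted term of `birkhoffBar_core` is seen by the projection, and that term is purely polar
unless the word is empty. -/
theorem birkhoffMinus_core (hc : ∀ d s t, c d (s * e t) = c d s * t)
    (hinj : ∀ s, (∀ d, c d s = 0) → s = 0) (hδ : δ ≠ 0) (h1 : φ [] = 1)
    (hφ : FactorsThroughZeros c τ δ φ) {u : List ℕ}
    (hu : IsCore u) (m : ℕ) :
    birkhoffMinus φ (u ++ List.replicate m 0) = if u = [] then counterterm S δ m else 0 := by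
  induction hn : u.length + m using Nat.strong_induction_on generalizing u m with
  | _ n ih =>
  subst hn
  by_cases hα : u ++ List.replicate m 0 = []
  · rw [hα, birkhoffMinus_nil]
    obtain ⟨rfl, h⟩ := List.append_eq_nil_iff.1 hα
    have : m = 0 := by simpa using h
    rw [this, if_pos rfl, counterterm_zero]
  rw [birkhoffMinus_eq _ hα, birkhoffBar_core h1 hu m fun u' m' hu' hlt => ih _ hlt hu' m' rfl]
  ext1
  funext n
  rw [HahnSeries.coeff_neg, coeff_polarPart]
  split_ifs with hn hu0 hu0
  · rw [HahnSeries.coeff_sub, coeff_sum_counterterm_of_neg hc hinj hδ hφ hu m hn, zero_sub, neg_neg]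
  · rw [HahnSeries.coeff_sub, coeff_sum_counterterm_of_neg hc hinj hδ hφ hu m hn]
    simp
  · rw [neg_zero, coeff_counterterm δ _ (by omega)]
    rintro rfl
    simp [hu0] at hα
  · simp

theorem coeff_birkhoffPlus_core (hc : ∀ d s t, c d (s * e t) = c d s * t)
    (hinj : ∀ s, (∀ d, c d s = 0) → s = 0) (hδ : δ ≠ 0) (h1 : φ [] = 1)
    (hφ : FactorsThroughZeros c τ δ φ)
    {u : List ℕ} (hu : IsCore u) (m : ℕ) (d : ℕ+ →₀ ℕ) :
    c d ((birkhoffPlus φ (u ++ List.replicate m 0)).coeff 0)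
      = ((indexLists u d).ncard : T) *
        binomial m (-(τ + (maxIndex d : T)
          + algebraMap ℚ T (1 / 2))) := by
  obtain ⟨f, hf, hf0⟩ := coeffLaurent_sum_counterterm hc hδ hφ hu m d
  have h0 : ∀ x, HahnSeries.ofPowerSeries ℤ _ f = coeffLaurent (c d) x →
      c d (x.coeff 0) = PowerSeries.constantCoeff f := fun x hx => by
    rw [← coeff_coeffLaurent, ← hx, PowerSeries.coeff_coe, if_neg (lt_irrefl _),
      Int.natAbs_zero, PowerSeries.coeff_zero_eq_constantCoeff_apply]
  rw [← hf0, ← h0 _ hf]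
  by_cases hα : u ++ List.replicate m 0 = []
  · obtain ⟨rfl, h⟩ := List.append_eq_nil_iff.1 hα
    have : m = 0 := by simpa using h
    subst this
    simp [birkhoffPlus, h1, counterterm_zero]
  rw [birkhoffPlus_eq _ hα, birkhoffBar_core h1 hu m fun u' m' hu' _ =>
    birkhoffMinus_core hc hinj hδ h1 hφ hu' m', HahnSeries.coeff_sub, coeff_polarPart,
    if_neg (lt_irrefl _), sub_zero, HahnSeries.coeff_sub]
  split_ifs with hu0
  · rw [coeff_counterterm δ _ le_rfl, sub_zero]
    rintro rfl
    simp [hu0] at hα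
  · simp

end BirkhoffWords

/-! ### Convergent Laurent series and the expansion of e^{cz} / (1 - e^{cz}) -/

section LaurentSum

open Filter
open scoped Topology

theorem HasSum.of_eq {ι : Type*} {f g : ι → ℂ} {a : ℂ} (h : HasSum f a) (hfg : ∀ i, f i = g i) :
    HasSum g a :=
  (funext hfg : f = g) ▸ h

/-- The Laurent series `F` converges at `z` to `s`. -/
def HasLaurentSum (F : LaurentSeries ℂ) (z s : ℂ) : Prop :=
  HasSum (fun n : ℤ => F.coeff n * z ^ n) s

namespace HasLaurentSum

variable {F G : LaurentSeries ℂ} {z a b : ℂ}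

theorem add (hF : HasLaurentSum F z a) (hG : HasLaurentSum G z b) :
    HasLaurentSum (F + G) z (a + b) := by
  simpa only [HasLaurentSum, HahnSeries.coeff_add, add_mul] using HasSum.add hF hG

theorem neg (hF : HasLaurentSum F z a) : HasLaurentSum (-F) z (-a) := by
  simpa only [HasLaurentSum, HahnSeries.coeff_neg, neg_mul] using HasSum.neg hF

theorem sub (hF : HasLaurentSum F z a) (hG : HasLaurentSum G z b) :
    HasLaurentSum (F - G) z (a - b) := by
  rw [sub_eq_add_neg, sub_eq_add_neg]
  exact hF.add hG.neg

theorem single (n : ℤ) (c z : ℂ) : HasLaurentSum (HahnSeries.single n c) z (c * z ^ n) := by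
  have h := hasSum_single (f := fun m : ℤ => (HahnSeries.single n c).coeff m * z ^ m) n
    fun m hm => by rw [HahnSeries.coeff_single_of_ne hm, zero_mul]
  rwa [HahnSeries.coeff_single_same] at h

theorem one (z : ℂ) : HasLaurentSum 1 z 1 := by
  have h := single 0 1 z
  rwa [zpow_zero, mul_one] at h

/-- Pairs of integers, as the sum and the first component. -/
def diffEquiv : ℤ × ℤ ≃ ℤ × ℤ where
  toFun p := (p.2, p.1 - p.2)
  invFun p := (p.1 + p.2, p.1)
  left_inv p := Prod.ext (add_sub_cancel p.2 p.1) rfl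
  right_inv p := Prod.ext rfl (add_sub_cancel_left p.1 p.2)

theorem hasSum_coeff_mul (hz : z ≠ 0) (n : ℤ) :
    HasSum (fun i : ℤ => F.coeff i * z ^ i * (G.coeff (n - i) * z ^ (n - i)))
      ((F * G).coeff n * z ^ n) := by
  have hfin : ∀ i ∉ (Finset.antidiagonal F.isPWO_support G.isPWO_support n).image Prod.fst,
      F.coeff i * z ^ i * (G.coeff (n - i) * z ^ (n - i)) = 0 := by
    intro i hi
    by_contra hc
    refine hi (Finset.mem_image.2 ⟨(i, n - i), ?_, rfl⟩)
    rw [Finset.mem_antidiagonal]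
    refine ⟨fun h0 => hc (by rw [h0, zero_mul, zero_mul]),
      fun h0 => hc (by rw [h0, zero_mul, mul_zero]), add_sub_cancel i n⟩
  have h2 := hasSum_sum_of_ne_finset_zero (L := SummationFilter.unconditional ℤ) hfin
  rwa [Finset.sum_image, Finset.sum_congr rfl (g := fun p : ℤ × ℤ =>
    F.coeff p.1 * G.coeff p.2 * z ^ n), ← Finset.sum_mul, ← HahnSeries.coeff_mul] at h2
  · intro p hp
    rw [Finset.mem_antidiagonal] at hp
    rw [← hp.2.2, add_sub_cancel_left, mul_mul_mul_comm, ← zpow_add₀ hz]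
  · intro p hp q hq hpq
    have hp' := (Finset.mem_antidiagonal.1 (Finset.mem_coe.1 hp)).2.2
    have hq' := (Finset.mem_antidiagonal.1 (Finset.mem_coe.1 hq)).2.2
    have h : p.1 = q.1 := hpq
    rw [← hq', h] at hp'
    exact Prod.ext h (add_left_cancel hp')

/-- Convergence over ℤ is absolute, so the double series may be regrouped by total degree; each
group is a finite sum because the supports are partially well-ordered. -/
theorem mul (hz : z ≠ 0) (hF : HasLaurentSum F z a) (hG : HasLaurentSum G z b) :
    HasLaurentSum (F * G) z (a * b) := by
  have h : HasSum (fun p : ℤ × ℤ => F.coeff p.1 * z ^ p.1 * (G.coeff p.2 * z ^ p.2)) (a * b) :=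
    HasSum.mul (f := fun n : ℤ => F.coeff n * z ^ n) (g := fun n : ℤ => G.coeff n * z ^ n) hF hG
      (summable_mul_of_summable_norm (f := fun n : ℤ => F.coeff n * z ^ n)
        (g := fun n : ℤ => G.coeff n * z ^ n) (Summable.norm (HasSum.summable hF))
        (Summable.norm (HasSum.summable hG)))
  exact HasSum.prod_fiberwise (f := fun p : ℤ × ℤ =>
      F.coeff p.2 * z ^ p.2 * (G.coeff (p.1 - p.2) * z ^ (p.1 - p.2)))
    (diffEquiv.hasSum_iff.2 h) fun n => hasSum_coeff_mul hz n

theorem prod {ι : Type*} (s : Finset ι) {F : ι → LaurentSeries ℂ} {a : ι → ℂ} (hz : z ≠ 0)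
    (h : ∀ i ∈ s, HasLaurentSum (F i) z (a i)) :
    HasLaurentSum (∏ i ∈ s, F i) z (∏ i ∈ s, a i) := by
  classical
  induction s using Finset.induction_on with
  | empty => simpa using one z
  | insert i s hi ih =>
    rw [Finset.prod_insert hi, Finset.prod_insert hi]
    exact mul hz (h i (Finset.mem_insert_self i s))
      (ih fun j hj => h j (Finset.mem_insert_of_mem hj))

theorem sum {ι : Type*} (s : Finset ι) {F : ι → LaurentSeries ℂ} {a : ι → ℂ}
    (h : ∀ i ∈ s, HasLaurentSum (F i) z (a i)) :
    HasLaurentSum (∑ i ∈ s, F i) z (∑ i ∈ s, a i) := by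
  classical
  induction s using Finset.induction_on with
  | empty => simp [HasLaurentSum, hasSum_zero]
  | insert i s hi ih =>
    rw [Finset.sum_insert hi, Finset.sum_insert hi]
    exact (h i (Finset.mem_insert_self i s)).add
      (ih fun j hj => h j (Finset.mem_insert_of_mem hj))

theorem ofPowerSeries_iff {p : PowerSeries ℂ} :
    HasLaurentSum (HahnSeries.ofPowerSeries ℤ ℂ p) z a
      ↔ HasSum (fun n : ℕ => PowerSeries.coeff n p * z ^ n) a := by
  rw [HasLaurentSum, ← Function.Injective.hasSum_iff (Nat.cast_injective (R := ℤ))]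
  · refine iff_of_eq (congrArg (HasSum · a) (funext fun n => ?_))
    simp [PowerSeries.coeff_coe]
  · intro n hn
    rw [PowerSeries.coeff_coe, if_pos, zero_mul]
    by_contra hc
    exact hn ⟨n.toNat, by simp; omega⟩

theorem expSeries (c z : ℂ) : HasLaurentSum (_root_.expSeries c) z (Complex.exp (c * z)) := by
  rw [_root_.expSeries, ofPowerSeries_iff, Complex.exp_eq_exp_ℂ]
  refine (NormedSpace.expSeries_div_hasSum_exp (c * z)).of_eq fun n => ?_
  rw [PowerSeries.coeff_rescale, PowerSeries.coeff_exp, mul_pow, map_div₀, map_one, map_natCast]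
  ring

/-- A Laurent series whose sum vanishes near `0` in the left half plane is zero. -/
theorem eq_zero (h : ∀ᶠ z in 𝓝[{z : ℂ | z.re < 0}] 0, HasLaurentSum F z 0) : F = 0 := by
  by_contra hF
  -- Dividing by the leading power of z gives a power series with nonzero constant term that still
  -- sums to 0. Letting z tend to 0 in the half plane, dominated by the terms at one fixed z₀,
  -- yields a contradiction.
  set P := F.powerSeriesPart with hP
  have hP0 : PowerSeries.coeff 0 P ≠ 0 := by
    rw [hP, LaurentSeries.powerSeriesPart_coeff, Nat.cast_zero, add_zero]
    exact HahnSeries.coeff_order_eq_zero.not.2 hF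
  have hne : ∀ᶠ z : ℂ in 𝓝[{z : ℂ | z.re < 0}] 0, z ≠ 0 := by
    filter_upwards [self_mem_nhdsWithin] with z hz
    rintro rfl
    exact lt_irrefl (0 : ℝ) hz
  have h1 : ∀ᶠ z in 𝓝[{z : ℂ | z.re < 0}] 0,
      HasSum (fun n : ℕ => PowerSeries.coeff n P * z ^ n) 0 := by
    filter_upwards [h, hne] with z hz hz0
    have h2 := (single (-F.order) 1 z).mul hz0 hz
    have h3 : HahnSeries.single (-F.order) 1 * F = HahnSeries.ofPowerSeries ℤ ℂ P := by
      rw [hP, LaurentSeries.ofPowerSeries_powerSeriesPart]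
    rwa [h3, mul_zero, ofPowerSeries_iff] at h2
  have hbot : (𝓝[{z : ℂ | z.re < 0}] (0 : ℂ)).NeBot := by
    rw [← mem_closure_iff_nhdsWithin_neBot, Complex.closure_setOfPred_re_lt]
    exact le_refl (0 : ℝ)
  obtain ⟨z₀, hz₀, hz₀'⟩ := (h1.and hne).exists
  have hlim : Tendsto (fun z : ℂ => ∑' n : ℕ, PowerSeries.coeff n P * z ^ n)
      (𝓝[{z : ℂ | z.re < 0}] 0) (𝓝 (∑' n : ℕ, PowerSeries.coeff n P * 0 ^ n)) := by
    refine tendsto_tsum_of_dominated_convergence (Summable.norm hz₀.summable) (fun n => ?_) ?_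
    · have : Continuous fun z : ℂ => PowerSeries.coeff n P * z ^ n := by fun_prop
      exact (this.tendsto 0).mono_left nhdsWithin_le_nhds
    · have hball : ∀ᶠ z : ℂ in 𝓝[{z : ℂ | z.re < 0}] 0, ‖z‖ < ‖z₀‖ :=
        nhdsWithin_le_nhds ((continuous_norm.tendsto (0 : ℂ)).eventually_lt_const
          (by simpa using hz₀'))
      filter_upwards [hball] with z hz n
      rw [norm_mul, norm_mul, norm_pow, norm_pow]
      gcongr
  have hzero : Tendsto (fun z : ℂ => ∑' n : ℕ, PowerSeries.coeff n P * z ^ n)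
      (𝓝[{z : ℂ | z.re < 0}] 0) (𝓝 0) :=
    tendsto_const_nhds.congr' (by filter_upwards [h1] with z hz using hz.tsum_eq.symm)
  have h0 := tendsto_nhds_unique hlim hzero
  rw [tsum_eq_single 0 fun n hn => by rw [zero_pow hn, mul_zero], pow_zero, mul_one] at h0
  exact hP0 h0

end HasLaurentSum

/-- The function is e^z divided by the difference quotient of exp at 0, which is analytic with value
1 there, so a convergent Taylor series exists. It is the Bernoulli series because both give X e^X
when multiplied by e^X - 1, which can be cancelled. -/
theorem eventually_hasSum_bernoulli : ∀ᶠ z : ℂ in 𝓝[≠] 0,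
    HasSum (fun n : ℕ => PowerSeries.coeff n (bernoulli'PowerSeries ℂ) * z ^ n)
      (z * Complex.exp z / (Complex.exp z - 1)) := by
  have hexp : AnalyticAt ℂ Complex.exp 0 := Complex.differentiable_exp.analyticAt 0
  obtain ⟨p, hp⟩ := hexp
  have hds : AnalyticAt ℂ (dslope Complex.exp 0) 0 := ⟨_, hp.has_fpower_series_dslope_fslope⟩
  have hds0 : dslope Complex.exp 0 0 ≠ 0 := by
    rw [dslope_same, Complex.deriv_exp, Complex.exp_zero]
    exact one_ne_zero
  obtain ⟨q, hq⟩ := (Complex.differentiable_exp.analyticAt 0).div hds hds0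
  have hval : ∀ z : ℂ, z ≠ 0 → (Complex.exp / dslope Complex.exp 0) z
      = z * Complex.exp z / (Complex.exp z - 1) := by
    intro z hz
    rw [Pi.div_apply, dslope_of_ne _ hz, slope_def_field, Complex.exp_zero, sub_zero,
      div_div_eq_mul_div,
      mul_comm]
  set Q : PowerSeries ℂ := PowerSeries.mk fun n => q.coeff n with hQ
  have h1 : ∀ᶠ z : ℂ in 𝓝[≠] 0, HasSum (fun n : ℕ => PowerSeries.coeff n Q * z ^ n)
      (z * Complex.exp z / (Complex.exp z - 1)) := by
    filter_upwards [nhdsWithin_le_nhds hq.eventually_hasSum, self_mem_nhdsWithin] with z hz hz0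
    rw [zero_add, hval z hz0] at hz
    refine hz.of_eq fun n => ?_
    rw [FormalMultilinearSeries.apply_eq_pow_smul_coeff, hQ, PowerSeries.coeff_mk, smul_eq_mul,
      mul_comm]
  have hne : ∀ᶠ z : ℂ in 𝓝[≠] 0, Complex.exp z - 1 ≠ 0 := by
    filter_upwards [nhdsWithin_le_nhds (hds.continuousAt.eventually_ne hds0),
      self_mem_nhdsWithin] with z hz hz0 h0
    rw [dslope_of_ne _ hz0, slope_def_field, Complex.exp_zero, h0, zero_div] at hz
    exact hz rfl
  have hle : 𝓝[{z : ℂ | z.re < 0}] (0 : ℂ) ≤ 𝓝[≠] 0 := nhdsWithin_mono _ fun z hz h0 => by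
    rw [Set.mem_singleton_iff.1 h0] at hz
    exact lt_irrefl (0 : ℝ) hz
  have hQB : Q = bernoulli'PowerSeries ℂ := by
    have hz : HahnSeries.ofPowerSeries ℤ ℂ (Q * (PowerSeries.exp ℂ - 1)
        - PowerSeries.X * PowerSeries.exp ℂ) = 0 := by
      refine HasLaurentSum.eq_zero ?_
      filter_upwards [hle h1, hle hne, hle self_mem_nhdsWithin] with z hz hz1 hz0
      have e1 := HasLaurentSum.expSeries 1 z
      rw [expSeries, PowerSeries.rescale_one, RingHom.id_apply, one_mul] at e1
      have e2 := ((HasLaurentSum.ofPowerSeries_iff.2 hz).mul hz0 (e1.sub (HasLaurentSum.one z))).sub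
        ((HasLaurentSum.single 1 1 z).mul hz0 e1)
      rw [div_mul_cancel₀ _ hz1, zpow_one, one_mul, sub_self] at e2
      simpa only [map_sub, map_mul, map_one, HahnSeries.ofPowerSeries_X] using e2
    have hz' := HahnSeries.ofPowerSeries_injective (hz.trans (map_zero _).symm)
    have hexp : PowerSeries.exp ℂ - 1 ≠ 0 := fun h0 => by
      have := congrArg (PowerSeries.coeff 1) h0
      simp [PowerSeries.coeff_one] at this
    exact mul_right_cancel₀ hexp
      ((sub_eq_zero.1 hz').trans (bernoulli'PowerSeries_mul_exp_sub_one ℂ).symm)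
  rwa [hQB] at h1

theorem eventually_hasLaurentSum_geomSeries {c : ℚ} (hc : c ≠ 0) : ∀ᶠ z : ℂ in 𝓝[≠] 0,
    HasLaurentSum (geomSeries ℂ c) z
      (Complex.exp (c * z) / (1 - Complex.exp (c * z))) := by
  have hc' : (c : ℂ) ≠ 0 := by exact_mod_cast hc
  have ht : Tendsto (fun z : ℂ => (c : ℂ) * z) (𝓝[≠] 0) (𝓝[≠] 0) := by
    refine tendsto_nhdsWithin_iff.2 ⟨?_, ?_⟩
    · have : Continuous fun z : ℂ => (c : ℂ) * z := by fun_prop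
      have h := this.tendsto 0
      rw [mul_zero] at h
      exact h.mono_left nhdsWithin_le_nhds
    · filter_upwards [self_mem_nhdsWithin] with z hz
      exact mul_ne_zero hc' hz
  filter_upwards [ht.eventually eventually_hasSum_bernoulli, self_mem_nhdsWithin] with z hz hz0
  have hz0' : z ≠ 0 := hz0
  have h1 : HasLaurentSum (HahnSeries.ofPowerSeries ℤ ℂ (PowerSeries.rescale (algebraMap ℚ ℂ c)
      (bernoulli'PowerSeries ℂ))) z (c * z * Complex.exp (c * z) / (Complex.exp (c * z) - 1)) := by
    refine HasLaurentSum.ofPowerSeries_iff.2 (hz.of_eq fun n => ?_)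
    rw [PowerSeries.coeff_rescale, mul_pow, eq_ratCast]
    ring
  have h2 := ((HasLaurentSum.single (-1) (algebraMap ℚ ℂ c⁻¹) z).mul hz0' h1).neg
  have h3 : -(algebraMap ℚ ℂ c⁻¹ * z ^ (-1 : ℤ) *
      (c * z * Complex.exp (c * z) / (Complex.exp (c * z) - 1)))
      = Complex.exp (c * z) / (1 - Complex.exp (c * z)) := by
    rw [eq_ratCast, Rat.cast_inv, zpow_neg_one, ← neg_sub (Complex.exp (c * z)) 1, div_neg]
    field_simp
  rwa [h3] at h2

end LaurentSum

/-! ### Summing exponentials over index lists -/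

section TupleSums

/-- The sum of a list of indices. -/
def indexSum (l : List ℕ+) : ℕ := (l.map PNat.val).sum

@[simp] theorem indexSum_nil : indexSum [] = 0 := rfl

@[simp] theorem indexSum_cons (i : ℕ+) (l : List ℕ+) : indexSum (i :: l) = i + indexSum l := by
  simp [indexSum]

theorem indexSum_append (l l' : List ℕ+) : indexSum (l ++ l') = indexSum l + indexSum l' := by
  simp [indexSum]

theorem indexSum_map_shiftIndex (L : ℕ) (l : List ℕ+) :
    indexSum (l.map (shiftIndex L)) = l.length * L + indexSum l := by
  induction l with
  | nil => simp
  | cons i l ih =>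
    rw [List.map_cons, indexSum_cons, indexSum_cons, ih, coe_shiftIndex, List.length_cons]
    ring

/-- The bijection from a product of subtypes given by a bijection on a product of sets. -/
def Set.BijOn.prodEquiv {A B C : Type*} {s : Set A} {t : Set B} {r : Set C} {f : A × B → C}
    (h : Set.BijOn f (s ×ˢ t) r) : s × t ≃ r :=
  (Equiv.Set.prod s t).symm.trans (h.equiv f)

theorem hasSum_geometric_pnat {r : ℂ} (hr : ‖r‖ < 1) :
    HasSum (fun i : ℕ+ => r ^ (i : ℕ)) (r / (1 - r)) := by
  have h := (hasSum_geometric_of_norm_lt_one hr).mul_left r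
  rw [← div_eq_mul_inv] at h
  rw [← Equiv.pnatEquivNat.symm.hasSum_iff]
  exact h.of_eq fun n => by
    rw [Function.comp_apply, Equiv.pnatEquivNat_symm_apply, Nat.succPNat_coe, pow_succ']

theorem HasSum.mul_of_complete {ι κ : Type*} {f : ι → ℂ} {g : κ → ℂ} {a b : ℂ} (hf : HasSum f a)
    (hg : HasSum g b) : HasSum (fun p : ι × κ => f p.1 * g p.2) (a * b) :=
  hf.mul hg (summable_mul_of_summable_norm hf.summable.norm hg.summable.norm)

theorem hasSum_increasingLists {c : ℂ} (hc : c.re < 0) (m : ℕ) :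
    HasSum (fun J : increasingLists m => Complex.exp (indexSum J.1 * c))
      (∏ j ∈ Finset.range m,
        (Complex.exp ((j + 1 : ℕ) * c) / (1 - Complex.exp ((j + 1 : ℕ) * c)))) := by
  induction m with
  | zero =>
    have : HasSum (fun J : ({[]} : Set (List ℕ+)) => Complex.exp (indexSum J.1 * c)) 1 := by
      have h := hasSum_unique fun J : ({[]} : Set (List ℕ+)) => Complex.exp (indexSum J.1 * c)
      simpa using h
    rw [Finset.range_zero, Finset.prod_empty, increasingLists_zero]
    exact this
  | succ m ih =>
    have hr : ‖Complex.exp ((m + 1 : ℕ) * c)‖ < 1 := by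
      rw [Complex.norm_exp, Real.exp_lt_one_iff, ← Complex.ofReal_natCast, Complex.re_ofReal_mul]
      exact mul_neg_of_pos_of_neg (by positivity) hc
    have h := (((Equiv.Set.univ ℕ+).hasSum_iff.2 (hasSum_geometric_pnat hr))).mul_of_complete ih
    rw [Finset.prod_range_succ, mul_comm, ← (bijOn_cons m).prodEquiv.hasSum_iff]
    refine h.of_eq fun p => ?_
    obtain ⟨⟨i, -⟩, J, hJ⟩ := p
    change Complex.exp ((m + 1 : ℕ) * c) ^ (i : ℕ) * Complex.exp (indexSum J * c)
      = Complex.exp (indexSum (i :: J.map (shiftIndex i)) * c)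
    rw [indexSum_cons, indexSum_map_shiftIndex, hJ.2, ← Complex.exp_nat_mul, ← Complex.exp_add]
    congr 1
    push_cast
    ring

/-- The m indices of the trailing zeros are each shifted by `maxIndex d`, which has the same effect
as adding `maxIndex d` to t for them. -/
theorem hasSum_indexLists {u : List ℕ} (hu : IsCore u) (m : ℕ) (d : ℕ+ →₀ ℕ) {c : ℂ}
    (hc : c.re < 0) (t : ℂ) :
    HasSum (fun l : indexLists (u ++ List.replicate m 0) d =>
        Complex.exp ((indexSum l.1 + l.1.length * t) * c))
      ((∑ I ∈ (finite_indexLists hu d).toFinset, Complex.exp ((indexSum I + u.length * t) * c)) *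
        (Complex.exp (m * (t + maxIndex d) * c) * ∏ j ∈ Finset.range m,
          (Complex.exp ((j + 1 : ℕ) * c) / (1 - Complex.exp ((j + 1 : ℕ) * c))))) := by
  have h1 : HasSum (fun I : indexLists u d => Complex.exp ((indexSum I.1 + u.length * t) * c))
      (∑ I ∈ (finite_indexLists hu d).toFinset,
        Complex.exp ((indexSum I + u.length * t) * c)) := by
    have := (finite_indexLists hu d).toFinset.hasSum
      fun I => Complex.exp ((indexSum I + u.length * t) * c)
    exact (Equiv.setCongr (finite_indexLists hu d).coe_toFinset.symm).hasSum_iff.2 this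
  have h := h1.mul_of_complete ((hasSum_increasingLists hc m).mul_left
    (Complex.exp (m * (t + maxIndex d) * c)))
  rw [← (bijOn_append hu m d).prodEquiv.hasSum_iff]
  refine h.of_eq fun p => ?_
  obtain ⟨⟨I, hI⟩, J, hJ⟩ := p
  change Complex.exp ((indexSum I + u.length * t) * c) *
      (Complex.exp (m * (t + maxIndex d) * c) * Complex.exp (indexSum J * c))
    = Complex.exp ((indexSum (I ++ J.map (shiftIndex (maxIndex d)))
        + (I ++ J.map (shiftIndex (maxIndex d))).length * t) * c)
  rw [indexSum_append, indexSum_map_shiftIndex, List.length_append, List.length_map, hJ.2, hI.2.1,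
    ← Complex.exp_add, ← Complex.exp_add]
  congr 1
  push_cast
  ring

theorem prod_exp_ofFn (t c : ℂ) {n : ℕ} (I : Fin n → ℕ+) :
    ∏ j, Complex.exp ((((I j : ℕ) : ℂ) + t) * c)
      = Complex.exp ((indexSum (List.ofFn I) + (List.ofFn I).length * t) * c) := by
  rw [← Complex.exp_sum, ← Finset.sum_mul, Finset.sum_add_distrib, List.length_ofFn, indexSum,
    List.map_ofFn, List.sum_ofFn]
  simp

theorem hasSum_indexTuples {w : List (ℕ × ℕ+)} {α : List ℕ} {δ : ℕ+} (hα : w.map Prod.fst = α)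
    (hδ : ∀ p ∈ w, p.2 = δ) {d : ℕ+ →₀ ℕ} {t z s : ℂ}
    (h : HasSum (fun l : indexLists α d =>
      Complex.exp ((indexSum l.1 + l.1.length * t) * (((δ : ℕ) : ℂ) * z))) s) :
    HasSum (fun I : indexTuples (fun j => (w.get j).1) d =>
      ∏ j, Complex.exp ((((I.1 j : ℕ) : ℂ) + t) * (((w.get j).2 : ℕ) : ℂ) * z)) s := by
  subst hα
  rw [← (indexTuplesEquiv Prod.fst w d).hasSum_iff] at h
  refine h.of_eq fun I => ?_
  rw [Function.comp_apply, coe_indexTuplesEquiv, ← prod_exp_ofFn]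
  refine Finset.prod_congr rfl fun j _ => ?_
  rw [hδ _ (w.get_mem j), mul_assoc]

end TupleSums

/-! ### Base change of the explicit series, and the regular factor of the core -/

section LaurentNatural

variable {R R' : Type*} [CommRing R] [CommRing R'] [Algebra ℚ R] [Algebra ℚ R'] (f : R →+* R')

theorem laurentMap_expSeries (a : R) : laurentMap f (expSeries a) = expSeries (f a) := by
  rw [expSeries, laurentMap_ofPowerSeries, expSeries]
  congr 1
  ext n
  rw [PowerSeries.coeff_map, PowerSeries.coeff_rescale, PowerSeries.coeff_rescale, map_mul, map_pow,
    ← PowerSeries.coeff_map, PowerSeries.map_exp]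

theorem map_algebraMap_rat (r : ℚ) : f (algebraMap ℚ R r) = algebraMap ℚ R' r :=
  congrFun (congrArg DFunLike.coe (RingHom.ext_rat (f.comp (algebraMap ℚ R)) (algebraMap ℚ R'))) r

theorem laurentMap_geomSeries (c : ℚ) : laurentMap f (geomSeries R c) = geomSeries R' c := by
  rw [geomSeries, map_neg, map_mul, laurentMap_single, laurentMap_ofPowerSeries, geomSeries,
    map_algebraMap_rat]
  congr 3
  ext n
  rw [PowerSeries.coeff_map, PowerSeries.coeff_rescale, PowerSeries.coeff_rescale, map_mul, map_pow,
    map_algebraMap_rat, bernoulli'PowerSeries, bernoulli'PowerSeries, PowerSeries.coeff_mk,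
    PowerSeries.coeff_mk, map_algebraMap_rat]

theorem laurentMap_zeroSeries (δ : ℚ) (τ : R) (m : ℕ) :
    laurentMap f (zeroSeries δ τ m) = zeroSeries δ (f τ) m := by
  rw [zeroSeries, map_mul, map_prod, laurentMap_expSeries, map_mul, map_mul, map_natCast,
    map_algebraMap_rat, zeroSeries]
  simp only [laurentMap_geomSeries]

/-- The contribution of the core of a word to its regularization. -/
def coreSeries (δ : ℚ) (τ : R) {u : List ℕ} (hu : IsCore u) (d : ℕ+ →₀ ℕ) : LaurentSeries R :=
  ∑ I ∈ (finite_indexLists hu d).toFinset,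
    expSeries (algebraMap ℚ R δ * (indexSum I + u.length * τ))

theorem laurentMap_coreSeries (δ : ℚ) (τ : R) {u : List ℕ} (hu : IsCore u) (d : ℕ+ →₀ ℕ) :
    laurentMap f (coreSeries δ τ hu d) = coreSeries δ (f τ) hu d := by
  rw [coreSeries, map_sum, coreSeries]
  refine Finset.sum_congr rfl fun I _ => ?_
  rw [laurentMap_expSeries, map_mul, map_add, map_mul, map_natCast, map_natCast, map_algebraMap_rat]

theorem exists_coreSeries (δ : ℚ) (τ : R) {u : List ℕ} (hu : IsCore u) (d : ℕ+ →₀ ℕ) :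
    ∃ g : PowerSeries R, PowerSeries.constantCoeff g = ((indexLists u d).ncard : R) ∧
      HahnSeries.ofPowerSeries ℤ R g = coreSeries δ τ hu d := by
  refine ⟨∑ I ∈ (finite_indexLists hu d).toFinset, PowerSeries.rescale
    (algebraMap ℚ R δ * (indexSum I + u.length * τ)) (PowerSeries.exp R), ?_, map_sum _ _ _⟩
  rw [map_sum, Set.ncard_eq_toFinset_card _ (finite_indexLists hu d), Finset.card_eq_sum_ones,
    Nat.cast_sum]
  refine Finset.sum_congr rfl fun I _ => ?_
  rw [← PowerSeries.coeff_zero_eq_constantCoeff_apply, PowerSeries.coeff_rescale, pow_zero, one_mul,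
    PowerSeries.coeff_exp]
  simp

end LaurentNatural

/-! ### Convergence to the explicit Laurent expansions -/

section Convergence

open Filter
open scoped Topology

theorem nhdsWithin_re_neg_le : 𝓝[{z : ℂ | z.re < 0}] (0 : ℂ) ≤ 𝓝[≠] 0 :=
  nhdsWithin_mono _ fun z hz h0 => by
    rw [Set.mem_singleton_iff.1 h0] at hz
    exact lt_irrefl (0 : ℝ) hz

theorem eventually_hasLaurentSum_core {u : List ℕ} (hu : IsCore u) (m : ℕ) (d : ℕ+ →₀ ℕ) (δ : ℕ+)
    (t : ℂ) : ∀ᶠ z : ℂ in 𝓝[{z : ℂ | z.re < 0}] 0, ∃ s : ℂ,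
      HasSum (fun l : indexLists (u ++ List.replicate m 0) d =>
        Complex.exp ((indexSum l.1 + l.1.length * t) * (((δ : ℕ) : ℂ) * z))) s ∧
      HasLaurentSum (coreSeries ((δ : ℕ) : ℚ) t hu d
        * zeroSeries ((δ : ℕ) : ℚ) (t + (maxIndex d : ℂ)) m) z s := by
  have hδ : ((δ : ℕ) : ℚ) ≠ 0 := by exact_mod_cast δ.ne_zero
  have hgeom : ∀ᶠ z : ℂ in 𝓝[≠] 0, ∀ j ∈ Finset.range m,
      HasLaurentSum (geomSeries ℂ ((j + 1 : ℕ) * ((δ : ℕ) : ℚ))) z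
        (Complex.exp ((((j + 1 : ℕ) * ((δ : ℕ) : ℚ) : ℚ) : ℂ) * z)
          / (1 - Complex.exp ((((j + 1 : ℕ) * ((δ : ℕ) : ℚ) : ℚ) : ℂ) * z))) :=
    (Filter.eventually_all_finset _).2 fun j _ =>
      eventually_hasLaurentSum_geomSeries (succ_mul_ne_zero hδ j)
  filter_upwards [nhdsWithin_re_neg_le hgeom, nhdsWithin_re_neg_le self_mem_nhdsWithin,
    self_mem_nhdsWithin] with z hz hz0 hre
  have hc : (((δ : ℕ) : ℂ) * z).re < 0 := by
    rw [← Complex.ofReal_natCast, Complex.re_ofReal_mul]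
    exact mul_neg_of_pos_of_neg (by exact_mod_cast δ.pos) hre
  refine ⟨_, hasSum_indexLists hu m d hc t, ?_⟩
  refine HasLaurentSum.mul hz0 (HasLaurentSum.sum _ fun I _ => ?_)
    (HasLaurentSum.mul hz0 ?_ (HasLaurentSum.prod _ hz0 fun j hj => ?_))
  · convert HasLaurentSum.expSeries _ z using 2
    rw [eq_ratCast, Rat.cast_natCast]
    ring
  · convert HasLaurentSum.expSeries _ z using 2
    rw [eq_ratCast, Rat.cast_natCast]
    ring
  · have h := hz j hj
    rwa [Rat.cast_mul, Rat.cast_natCast, Rat.cast_natCast, mul_assoc] at h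

end Convergence

/-! ### Existence, uniqueness and form of the regularization -/

section Characterization

open Filter
open scoped Topology

theorem coeffPoly_mul_C {k : Type*} [CommRing k] (d : ℕ+ →₀ ℕ) (P : Polynomial (MvPowerSeries ℕ+ k))
    (Q : Polynomial k) :
    coeffPoly d (P * Polynomial.mapRingHom MvPowerSeries.C Q) = coeffPoly d P * Q := by
  ext n
  rw [coeff_coeffPoly, Polynomial.coeff_mul, Polynomial.coeff_mul, map_sum]
  refine Finset.sum_congr rfl fun p _ => ?_
  rw [Polynomial.coe_mapRingHom, Polynomial.coeff_map, MvPowerSeries.coeff_mul_C, coeff_coeffPoly]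

/-- Evaluation of rational polynomials at a complex number. -/
def evalComplex (t : ℂ) : Polynomial ℚ →+* ℂ := Polynomial.eval₂RingHom (algebraMap ℚ ℂ) t

theorem sum_coeff_mul_pow (d : ℕ+ →₀ ℕ) (P : Polynomial (MvPowerSeries ℕ+ ℚ)) (t : ℂ) :
    (P.sum fun i f => ((MvPowerSeries.coeff d f : ℚ) : ℂ) * t ^ i)
      = evalComplex t (coeffPoly d P) := by
  have hdeg : (coeffPoly d P).natDegree ≤ P.natDegree := by
    refine Polynomial.natDegree_le_iff_coeff_eq_zero.2 fun N hN => ?_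
    rw [coeff_coeffPoly, Polynomial.coeff_eq_zero_of_natDegree_lt hN, map_zero]
  rw [evalComplex, Polynomial.coe_eval₂RingHom,
    Polynomial.eval₂_eq_sum_range' _ (Nat.lt_succ_of_le hdeg),
    Polynomial.sum_over_range' _ (fun i => by simp) _ (Nat.lt_succ_self _)]
  rfl

/-- The complex Laurent series given by a monomial and a value of `t`. -/
def specialize (d : ℕ+ →₀ ℕ) (t : ℂ) (Φ : LaurentSeries (Polynomial (MvPowerSeries ℕ+ ℚ))) :
    LaurentSeries ℂ :=
  laurentMap (evalComplex t) (coeffLaurent (coeffPoly d).toAddMonoidHom Φ)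

theorem hasSum_iff_specialize (d : ℕ+ →₀ ℕ) (t z s : ℂ)
    (Φ : LaurentSeries (Polynomial (MvPowerSeries ℕ+ ℚ))) :
    HasSum (fun n : ℤ =>
      (Φ.coeff n).sum (fun i f => ((MvPowerSeries.coeff d f : ℚ) : ℂ) * t ^ i) * z ^ n) s
      ↔ HasLaurentSum (specialize d t Φ) z s := by
  refine iff_of_eq (congrArg (HasSum · s) (funext fun n => ?_))
  rw [sum_coeff_mul_pow]
  rfl

theorem coeff_specialize (d : ℕ+ →₀ ℕ) (t : ℂ)
    (Φ : LaurentSeries (Polynomial (MvPowerSeries ℕ+ ℚ))) (n : ℤ) :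
    (specialize d t Φ).coeff n = evalComplex t (coeffPoly d (Φ.coeff n)) := rfl

theorem eq_zero_of_evalComplex {p : Polynomial ℚ}
    (h : ∀ t : ℝ, 0 ≤ t → evalComplex t p = 0) : p = 0 := by
  refine Polynomial.eq_zero_of_infinite_isRoot p (Set.Infinite.mono ?_
    (Set.infinite_range_of_injective (Nat.cast_injective (R := ℚ))))
  rintro _ ⟨n, rfl⟩
  have h1 := h n n.cast_nonneg
  rw [evalComplex, Polynomial.coe_eval₂RingHom, Complex.ofReal_natCast,
    ← map_natCast (algebraMap ℚ ℂ) n, Polynomial.eval₂_at_apply] at h1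
  exact (map_eq_zero _).1 h1

/-- For fixed d and t ≥ 0 both specialized series have the same sum near 0 in the half plane, so
they agree. Each coefficient is then a polynomial in t determined by its values at t ≥ 0. -/
theorem IsRegularization.unique {w : List (ℕ × ℕ+)}
    {Φ Ψ : LaurentSeries (Polynomial (MvPowerSeries ℕ+ ℚ))} (hΦ : IsRegularization w Φ)
    (hΨ : IsRegularization w Ψ) : Φ = Ψ := by
  have key : ∀ d (t : ℝ), 0 ≤ t → specialize d t Φ - specialize d t Ψ = 0 := by
    intro d t ht
    refine HasLaurentSum.eq_zero ?_
    filter_upwards [hΦ d t ht, hΨ d t ht] with z h1 h2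
    obtain ⟨s, hs, h1⟩ := h1
    obtain ⟨s', hs', h2⟩ := h2
    rw [hasSum_iff_specialize] at h1 h2
    have h3 := h1.sub h2
    rwa [hs.unique hs', sub_self] at h3
  ext1
  funext n
  refine ext_coeffPoly fun d => sub_eq_zero.1 (eq_zero_of_evalComplex fun t ht => ?_)
  rw [map_sub, ← coeff_specialize, ← coeff_specialize, ← HahnSeries.coeff_sub, key d t ht,
    HahnSeries.coeff_zero]

/-- The form of the regularization of a word in the direction `δ`. -/
theorem isRegularization_of_coeffLaurent {u : List ℕ} (hu : IsCore u) (m : ℕ) (δ : ℕ+)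
    {Φ : LaurentSeries (Polynomial (MvPowerSeries ℕ+ ℚ))}
    (hΦ : ∀ d, coeffLaurent (coeffPoly d).toAddMonoidHom Φ
      = coreSeries ((δ : ℕ) : ℚ) Polynomial.X hu d
        * zeroSeries ((δ : ℕ) : ℚ) (Polynomial.X + (maxIndex d : Polynomial ℚ)) m) :
    IsRegularization ((u ++ List.replicate m 0).map fun a => (a, δ)) Φ := by
  intro d t ht
  filter_upwards [eventually_hasLaurentSum_core hu m d δ t] with z hz
  obtain ⟨s, h1, h2⟩ := hz
  refine ⟨s, hasSum_indexTuples (by simp [List.map_map, Function.comp_def])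
    (by simp only [List.mem_map]; rintro _ ⟨a, -, rfl⟩; rfl) h1, ?_⟩
  rw [hasSum_iff_specialize, specialize, hΦ, map_mul, laurentMap_coreSeries, laurentMap_zeroSeries,
    map_add, map_natCast]
  have hX : evalComplex (t : ℂ) Polynomial.X = t := by simp [evalComplex]
  rwa [hX]

/-- The power series in the variables `X` with the given coefficients. -/
def ofCoeffs (c : (ℕ+ →₀ ℕ) → ℚ) : MvPowerSeries ℕ+ ℚ := c

theorem coeff_ofCoeffs (c : (ℕ+ →₀ ℕ) → ℚ) (d : ℕ+ →₀ ℕ) :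
    MvPowerSeries.coeff d (ofCoeffs c) = c d := rfl

/-- The power series in `z` whose coefficient series at `x^d` is `f d`. -/
def ofCoeffSeries (f : (ℕ+ →₀ ℕ) → PowerSeries ℚ) :
    PowerSeries (Polynomial (MvPowerSeries ℕ+ ℚ)) :=
  PowerSeries.mk fun n => Polynomial.C (ofCoeffs fun d => PowerSeries.coeff n (f d))

theorem coeffLaurent_ofCoeffSeries (d : ℕ+ →₀ ℕ) (f : (ℕ+ →₀ ℕ) → PowerSeries ℚ) :
    coeffLaurent (coeffPoly d).toAddMonoidHom (HahnSeries.ofPowerSeries ℤ _ (ofCoeffSeries f))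
      = laurentMap Polynomial.C (HahnSeries.ofPowerSeries ℤ ℚ (f d)) := by
  ext1
  funext n
  rw [coeff_coeffLaurent, coeff_laurentMap, PowerSeries.coeff_coe, PowerSeries.coeff_coe]
  split_ifs with h
  · rw [map_zero, map_zero]
  · rw [ofCoeffSeries, PowerSeries.coeff_mk]
    ext i
    change (coeffPoly d _).coeff i = _
    rw [coeff_coeffPoly, Polynomial.coeff_C, Polynomial.coeff_C]
    split_ifs
    · exact coeff_ofCoeffs _ d
    · rw [map_zero]

/-- A coefficient of z^n must be one polynomial in t for all d simultaneously, so its degree may not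
grow with d. This holds because t enters only through e^{(|u|+m)δtz}, common to all d, while
everything depending on d is free of t. -/
theorem exists_coeffLaurent_eq {u : List ℕ} (hu : IsCore u) (m : ℕ) (δ : ℚ) :
    ∃ Φ : LaurentSeries (Polynomial (MvPowerSeries ℕ+ ℚ)),
      ∀ d, coeffLaurent (coeffPoly d).toAddMonoidHom Φ
        = coreSeries δ Polynomial.X hu d
          * zeroSeries δ (Polynomial.X + (maxIndex d : Polynomial ℚ)) m := by
  -- The shift by `maxIndex d` of the m trailing zeros is absorbed here, in the part without t; y
  -- then carries all of t and all the poles.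
  let f : (ℕ+ →₀ ℕ) → PowerSeries ℚ := fun d => ∑ I ∈ (finite_indexLists hu d).toFinset,
    PowerSeries.rescale (δ * (indexSum I + m * maxIndex d)) (PowerSeries.exp ℚ)
  have hf : ∀ d, HahnSeries.ofPowerSeries ℤ ℚ (f d) = ∑ I ∈ (finite_indexLists hu d).toFinset,
      expSeries (δ * (indexSum I + m * maxIndex d)) := fun d => map_sum _ _ _
  let y : LaurentSeries (Polynomial ℚ) :=
    expSeries (((u.length + m : ℕ) : Polynomial ℚ) * (Polynomial.C δ * Polynomial.X)) *
      ∏ j ∈ Finset.range m, geomSeries (Polynomial ℚ) ((j + 1 : ℕ) * δ)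
  refine ⟨HahnSeries.ofPowerSeries ℤ _ (ofCoeffSeries f)
    * laurentMap (Polynomial.mapRingHom MvPowerSeries.C) y, fun d => ?_⟩
  rw [coeffLaurent_mul (coeffPoly_mul_C d), coeffLaurent_ofCoeffSeries, hf, map_sum, coreSeries,
    Finset.sum_mul, Finset.sum_mul]
  refine Finset.sum_congr rfl fun I _ => ?_
  rw [laurentMap_expSeries, zeroSeries, ← mul_assoc (expSeries (Polynomial.C _)),
    ← mul_assoc (expSeries (algebraMap ℚ (Polynomial ℚ) δ * _)), ← expSeries_add, ← expSeries_add]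
  congr 2
  rw [← Polynomial.C_eq_algebraMap]
  simp only [map_mul, map_add, map_natCast, Nat.cast_add]
  ring

theorem coeffLaurent_epsilon (δ : ℕ+) {u : List ℕ} (hu : IsCore u) (m : ℕ) (d : ℕ+ →₀ ℕ) :
    coeffLaurent (coeffPoly d).toAddMonoidHom (Classical.epsilon
        (IsRegularization ((u ++ List.replicate m 0).map fun a => (a, δ))))
      = coreSeries ((δ : ℕ) : ℚ) Polynomial.X hu d
        * zeroSeries ((δ : ℕ) : ℚ) (Polynomial.X + (maxIndex d : Polynomial ℚ)) m := by
  obtain ⟨Φ, hΦ⟩ := exists_coeffLaurent_eq hu m ((δ : ℕ) : ℚ)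
  have h := isRegularization_of_coeffLaurent hu m δ hΦ
  rw [(Classical.epsilon_spec ⟨Φ, h⟩ : IsRegularization _ _).unique h, hΦ]

theorem factorsThroughZeros_epsilon (δ : ℕ+) :
    FactorsThroughZeros (fun d => (coeffPoly (k := ℚ) d).toAddMonoidHom) Polynomial.X
      ((δ : ℕ) : ℚ) fun α => Classical.epsilon (IsRegularization (α.map fun a => (a, δ))) := by
  intro u hu d
  obtain ⟨g, hg, hg'⟩ := exists_coreSeries ((δ : ℕ) : ℚ) (Polynomial.X : Polynomial ℚ) hu d
  exact ⟨g, hg, fun m => by rw [hg', coeffLaurent_epsilon]⟩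

theorem indexLists_nil (d : ℕ+ →₀ ℕ) : indexLists [] d = if d = 0 then {[]} else ∅ := by
  ext l
  have : l ∈ indexLists [] d ↔ l = [] ∧ d = 0 := by
    constructor
    · rintro ⟨-, h1, h2⟩
      obtain rfl := List.length_eq_zero_iff.1 h1
      exact ⟨rfl, by simpa using h2.symm⟩
    · rintro ⟨rfl, rfl⟩
      exact ⟨List.Pairwise.nil, rfl, by simp⟩
  rw [this]
  split_ifs with h <;> simp [h]

theorem epsilon_nil (δ : ℕ+) :
    Classical.epsilon (IsRegularization (([] : List ℕ).map fun a => (a, δ))) = 1 := by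
  have h := coeffLaurent_epsilon δ isCore_nil 0
  rw [List.replicate_zero, List.append_nil] at h
  have hS : ∀ d, (finite_indexLists isCore_nil d).toFinset = if d = 0 then {[]} else ∅ := by
    intro d
    ext l
    rw [Set.Finite.mem_toFinset, indexLists_nil]
    split_ifs <;> simp
  ext1
  funext n
  refine ext_coeffPoly fun d => ?_
  have h1 := congrArg (fun F => HahnSeries.coeff F n) (h d)
  simp only [coeff_coeffLaurent, zeroSeries_zero, mul_one] at h1
  refine Eq.trans h1 ?_
  rw [coreSeries, hS]
  ext i
  rw [coeff_coeffPoly, HahnSeries.coeff_one]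
  by_cases hd : d = 0
  · subst hd
    simp only [if_true, Finset.sum_singleton, indexSum_nil, List.length_nil, Nat.cast_zero,
      zero_mul,
      add_zero, mul_zero, expSeries_zero, HahnSeries.coeff_one]
    split_ifs
    · rw [Polynomial.coeff_one, Polynomial.coeff_one]
      split_ifs <;> simp
    · simp
  · rw [if_neg hd, Finset.sum_empty, HahnSeries.coeff_zero]
    split_ifs
    · rw [Polynomial.coeff_one]
      split_ifs <;> simp [MvPowerSeries.coeff_one, hd]
    · simp

end Characterization

/-! ### The closed formula for renormalized monomials and its consequences -/

section Renormalized

variable (k : Type*) [CommRing k] [Algebra ℚ k]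

theorem renormalizedMonomial_eq (δ : ℕ+) (α : List ℕ) :
    renormalizedMonomial k δ α = Polynomial.mapRingHom (MvPowerSeries.map (algebraMap ℚ k))
      ((birkhoffPlus (fun α : List ℕ =>
        Classical.epsilon (IsRegularization (α.map fun a => (a, δ)))) α).coeff 0) := by
  rw [renormalizedMonomial, directionalQSym, birkhoffPlus_map, ← coeff_laurentMap,
    ← birkhoffPlus_laurentMap]
  rfl

theorem coeffPoly_mapRingHom (d : ℕ+ →₀ ℕ) (P : Polynomial (MvPowerSeries ℕ+ ℚ)) :
    coeffPoly d (Polynomial.mapRingHom (MvPowerSeries.map (algebraMap ℚ k)) P)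
      = Polynomial.mapRingHom (algebraMap ℚ k) (coeffPoly d P) := by
  ext i
  rw [coeff_coeffPoly, Polynomial.coe_mapRingHom, Polynomial.coe_mapRingHom, Polynomial.coeff_map,
    Polynomial.coeff_map, MvPowerSeries.coeff_map, coeff_coeffPoly]

/-- Everything later rests on this formula: δ is absent from it, t is absent for m = 0, and at t =
-N - 1/2 it counts index lists in N variables. The factorization is carried out over ℚ and then base
changed to k. -/
theorem coeffPoly_renormalizedMonomial (δ : ℕ+) {u : List ℕ} (hu : IsCore u) (m : ℕ)
    (d : ℕ+ →₀ ℕ) :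
    coeffPoly d (renormalizedMonomial k δ (u ++ List.replicate m 0))
      = ((indexLists u d).ncard : Polynomial k) * binomial m (-(Polynomial.X
          + (maxIndex d : Polynomial k) + algebraMap ℚ (Polynomial k) (1 / 2))) := by
  have h := coeff_birkhoffPlus_core (c := fun d => (coeffPoly (k := ℚ) d).toAddMonoidHom)
    (e := Polynomial.mapRingHom MvPowerSeries.C) coeffPoly_mul_C
    (fun s hs => ext_coeffPoly fun d => (hs d).trans (map_zero _).symm)
    (δ := ((δ : ℕ) : ℚ)) (by exact_mod_cast δ.ne_zero) (epsilon_nil δ)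
    (factorsThroughZeros_epsilon δ) hu m d
  rw [renormalizedMonomial_eq, coeffPoly_mapRingHom]
  refine (congrArg (Polynomial.mapRingHom (algebraMap ℚ k)) h).trans ?_
  rw [map_mul, map_natCast, map_binomial, map_neg, map_add, map_add, map_natCast,
    map_algebraMap_rat, Polynomial.coe_mapRingHom, Polynomial.map_X]

theorem renormalizedMonomial_direction (δ δ' : ℕ+) (α : List ℕ) :
    renormalizedMonomial k δ α = renormalizedMonomial k δ' α := by
  obtain ⟨u, m, hu, rfl⟩ := exists_core α
  exact ext_coeffPoly fun d => by
    rw [coeffPoly_renormalizedMonomial k δ hu, coeffPoly_renormalizedMonomial k δ' hu]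

theorem coeff_eval_renormalizedMonomial (δ : ℕ+) (α : List ℕ) {d : ℕ+ →₀ ℕ} {N : ℕ}
    (hN : maxIndex d ≤ N) :
    MvPowerSeries.coeff d ((renormalizedMonomial k δ α).eval (MvPowerSeries.C (node k N)))
      = MvPowerSeries.coeff d (truncWord k α (firstIndices N)) := by
  obtain ⟨u, m, hu, rfl⟩ := exists_core α
  rw [coeff_eval_C, coeffPoly_renormalizedMonomial k δ hu, coeff_truncWord_core hu m hN,
    ← binomial_natCast, ← Polynomial.coe_evalRingHom, map_mul, map_natCast, map_binomial, map_neg,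
    map_add, map_add, map_natCast, map_algebraMap_rat, Polynomial.coe_evalRingHom,
    Polynomial.eval_X]
  congr 2
  -- With L = `maxIndex d`, the binomial argument -((-N - 1/2) + L + 1/2) is N - L, a natural number
  -- precisely because L ≤ N.
  rw [node, Nat.cast_sub hN, map_sub, map_neg, map_natCast]
  ring

theorem renormalizedMonomial_composition (δ : ℕ+) (α : List ℕ+) :
    renormalizedMonomial k δ (α.map fun n : ℕ+ => (n : ℕ)) = Polynomial.C (monomialQSym k α) := by
  refine ext_coeffPoly fun d => ?_
  have h := coeffPoly_renormalizedMonomial k δ (isCore_map_coe α) 0 d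
  rw [List.replicate_zero, List.append_nil] at h
  have hcard : (indexLists (α.map fun n : ℕ+ => (n : ℕ)) d).ncard
      = Nat.card (indexTuples (fun j => (α.get j : ℕ)) d) :=
    (Nat.card_congr (indexTuplesEquiv (fun n : ℕ+ => (n : ℕ)) α d)).symm
  rw [h, hcard, binomial, mul_one]
  ext i
  rw [coeff_coeffPoly, Polynomial.coeff_C, ← Polynomial.C_eq_natCast, Polynomial.coeff_C]
  split_ifs
  · rfl
  · rfl

theorem renQSym_eq (δ : ℕ+) :
    RenQSym k = Submodule.span k (Set.range (renormalizedMonomial k δ)) := by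
  refine congrArg _ (Set.ext fun M => ?_)
  constructor
  · rintro ⟨δ', α, rfl⟩
    exact ⟨α, renormalizedMonomial_direction k δ δ' α⟩
  · rintro ⟨α, rfl⟩
    exact ⟨δ, α, rfl⟩

end Renormalized

end

theorem mainTheorem8 (k : Type*) [CommRing k] [Algebra ℚ k] :
    ∃ (R : Subalgebra k (Polynomial (MvPowerSeries ℕ+ k)))
      (Q : Subalgebra k (MvPowerSeries ℕ+ k))
      (f : QuasiShuffle k ℕ ≃ₐ[k] R) (g : QuasiShuffle k ℕ+ ≃ₐ[k] Q),
      -- `R` is the algebra of renormalized quasisymmetric functions, `Q` that of quasisymmetric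
      -- functions, identified with quasi-shuffle algebras through the monomial bases
      Subalgebra.toSubmodule R = RenQSym k ∧
      Subalgebra.toSubmodule Q = QSym k ∧
      (∀ (δ : ℕ+) (α : List ℕ),
        (f (QuasiShuffle.word k α) : Polynomial (MvPowerSeries ℕ+ k))
          = renormalizedMonomial k δ α) ∧
      (∀ α : List ℕ+,
        (g (QuasiShuffle.word k α) : MvPowerSeries ℕ+ k) = monomialQSym k α) ∧
      -- the transported Hopf algebra structures
      letI := transportHopfAlgebra (k := k) (H := QuasiShuffle k ℕ) (B := R) f
      letI := transportHopfAlgebra (k := k) (H := QuasiShuffle k ℕ+) (B := Q) g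
      -- `Q` is a Hopf subalgebra: its inclusion in `R` is a homomorphism of Hopf algebras
      (∃ ι : Q → R,
        (∀ q : Q, (ι q : Polynomial (MvPowerSeries ℕ+ k))
          = Polynomial.C (q : MvPowerSeries ℕ+ k)) ∧
        IsHopfHom k ι) ∧
      -- `Q` is a Hopf quotient algebra of `R`
      IsHopfQuotient k R Q := by
  -- The direction δ = 1 serves as reference; independence of the direction extends the result to
  -- every δ.
  obtain ⟨R, Q, f, g, hR, hQ, hf, hg, h⟩ := hopf_of_specialization
    (M := renormalizedMonomial k 1) (fun α d N hN => coeff_eval_renormalizedMonomial k 1 α hN)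
    (renormalizedMonomial_composition k 1)
  exact ⟨R, Q, f, g, hR.trans (renQSym_eq k 1).symm, hQ,
    fun δ α => (hf α).trans (renormalizedMonomial_direction k 1 δ α), hg, h⟩
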